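/- Let $X$ be a compact connected smooth manifold with boundary, of dimension $n+1$, with interior $X^\circ$, and let $g$ be an asymptotically hyperbolic metric on $X^\circ$: a smooth Riemannian metric on $X^\circ$ such that near each point of $\partial X$ there are smooth local coordinates $(x,y)=(x,y_1,\dots,y_n)$ of $X$, with $x\ge 0$ a defining function for the boundary, in which $$g=\frac{dx^2+\sum_{i,j}h_{ij}(x,y)\,dy_i\,dy_j}{x^2},$$ where $(h_{ij})$ is positive definite and smooth up to $x=0$. Let $d$ be the Riemannian distance function of $g$ on $X^\circ$. Let $X^2_0$ be the $0$-double space of $X$, that is, the real blow-up of $X^2=X\times X$ along the boundary of the diagonal $\{(q,q): q\in\partial X\}$: a compact manifold with corners with interior $X^\circ\times X^\circ$, in which each point $(q,q)$, $q\in\partial X$, is replaced by the inward-pointing rays in the normal space at $(q,q)$ to the boundary of the diagonal. Let $\mathrm{FL}$ and $\mathrm{FR}$ be the boundary hypersurfaces of $X^2_0$ that are the lifts of $\partial X\times X$ and $X\times\partial X$. Let $\rho_L$ and $\rho_R$ be any boundary defining functions for $\mathrm{FL}$ and $\mathrm{FR}$, i.e. smooth nonnegative functions on $X^2_0$ whose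 zero sets are exactly $\mathrm{FL}$, respectively $\mathrm{FR}$, and whose differentials do not vanish there. **Proposition.** There is a bounded function $b$ on $X^2_0$ such that for all $z,z'\in X^\circ$ the distance $d(z,z')$ is finite and $$d(z,z')=-\log(\rho_L\rho_R)(z,z')+b(z,z').$$ -/

import Mathlib

open Set Bundle Manifold Topology
open scoped Manifold ContDiff ENNReal Matrix

noncomputable section

namespace AsymptoticallyHyperbolic

/-- The point `(x, y)` of `ℝ × ℝⁿ = ℝⁿ⁺¹`. -/
def pt {n : ℕ} (x : ℝ) (y : EuclideanSpace ℝ (Fin n)) : EuclideanSpace ℝ (Fin (n + 1)) :=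
  WithLp.toLp 2 (Fin.cons x (fun i => y i))

/-- The last `n` coordinates `y` of a point `(x, y)` of `ℝ × ℝⁿ = ℝⁿ⁺¹`. -/
def tail {n : ℕ} (z : EuclideanSpace ℝ (Fin (n + 1))) : EuclideanSpace ℝ (Fin n) :=
  WithLp.toLp 2 (fun i => z i.succ)

section

variable (n : ℕ) (X : Type*) [TopologicalSpace X] [ChartedSpace (EuclideanHalfSpace (n + 1)) X]
  [IsManifold (𝓡∂ (n + 1)) ∞ X]

/-! ### The interior and its Riemannian metrics -/

/-- The interior `X°` of the manifold with boundary `X`, as an open submanifold. -/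
def Interior : TopologicalSpace.Opens X :=
  ⟨(𝓡∂ (n + 1)).interior X, (𝓡∂ (n + 1)).isOpen_interior (n := ∞) (by simp)⟩

/-- Smooth Riemannian metrics on `X°`. -/
abbrev InteriorMetric :=
  ContMDiffRiemannianMetric (𝓡∂ (n + 1)) ∞ (EuclideanSpace ℝ (Fin (n + 1)))
    (fun p : Interior n X => TangentSpace (𝓡∂ (n + 1)) p)

variable {n X}

/-- The Riemannian distance of `g` on `X°`: the infimum of the `g`-lengths of `C¹` paths in `X°`,
with value `⊤` where there is no such path. -/
def riemannianDist (g : InteriorMetric n X) (z z' : Interior n X) : ℝ≥0∞ :=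
  letI : RiemannianBundle (fun p : Interior n X => TangentSpace (𝓡∂ (n + 1)) p) :=
    ⟨g.toRiemannianMetric⟩
  Manifold.riemannianEDist (𝓡∂ (n + 1)) z z'

/-- `g` is asymptotically hyperbolic: near each boundary point there are smooth coordinates
`(x, y)` of `X` (so `x ≥ 0`, with equality exactly on the boundary) in which
`g = (dx² + ∑ hᵢⱼ(x, y) dyᵢ dyⱼ) / x²`, where `(hᵢⱼ)` is positive definite and smooth up
to the boundary. -/
def IsAsymptoticallyHyperbolic (g : InteriorMetric n X) : Prop :=
  ∀ q ∈ (𝓡∂ (n + 1)).boundary X,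
    ∃ e ∈ IsManifold.maximalAtlas (𝓡∂ (n + 1)) ∞ X, q ∈ e.source ∧
    ∃ h : EuclideanSpace ℝ (Fin (n + 1)) → Matrix (Fin n) (Fin n) ℝ,
      (∀ i j, ContDiffOn ℝ ∞ (fun z => h z i j) (e.extend (𝓡∂ (n + 1))).target) ∧
      (∀ z ∈ (e.extend (𝓡∂ (n + 1))).target, (h z).PosDef) ∧
      ∀ p : Interior n X, (p : X) ∈ e.source → ∀ v : TangentSpace (𝓡∂ (n + 1)) p,
        let z := e.extend (𝓡∂ (n + 1)) (p : X)
        let ξ : EuclideanSpace ℝ (Fin (n + 1)) :=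
          mfderiv (𝓡∂ (n + 1)) 𝓘(ℝ, EuclideanSpace ℝ (Fin (n + 1)))
            (fun p' : Interior n X => e.extend (𝓡∂ (n + 1)) (p' : X)) p v
        g.inner p v v = (ξ 0 ^ 2 + (fun i => tail ξ i) ⬝ᵥ (h z *ᵥ fun i => tail ξ i)) / z 0 ^ 2

/-! ### The inward pointing spherical normal bundle of the boundary of the diagonal -/

/-- The component of a tangent vector along the inward normal coordinate of the preferred chart.
At a boundary point, `v` points into `X` iff it is nonnegative, and `v` is tangent to the boundary
iff it vanishes. -/
def normalComponent (q : X) : TangentSpace (𝓡∂ (n + 1)) q →L[ℝ] ℝ :=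
  (EuclideanSpace.proj (0 : Fin (n + 1)) : EuclideanSpace ℝ (Fin (n + 1)) →L[ℝ] ℝ) ∘L
    (mfderiv (𝓡∂ (n + 1)) 𝓘(ℝ, EuclideanSpace ℝ (Fin (n + 1))) (extChartAt (𝓡∂ (n + 1)) q) q :
      TangentSpace (𝓡∂ (n + 1)) q →L[ℝ] EuclideanSpace ℝ (Fin (n + 1)))

/-- Vectors `(v, v') ∈ T_(q,q) X²` pointing into `X²` and not tangent to the boundary of the
diagonal. -/
def InwardPair (q : X) : Type :=
  { u : TangentSpace (𝓡∂ (n + 1)) q × TangentSpace (𝓡∂ (n + 1)) q //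
    0 ≤ normalComponent q u.1 ∧ 0 ≤ normalComponent q u.2 ∧
      ¬ (normalComponent q u.1 = 0 ∧ u.1 = u.2) }

/-- Two vectors define the same normal direction iff they agree up to a positive factor and up to
the addition of a vector `(w, w)` tangent to the boundary of the diagonal. -/
def normalSetoid (q : X) : Setoid (InwardPair (n := n) q) where
  r u u' := ∃ t : ℝ, 0 < t ∧ ∃ w : TangentSpace (𝓡∂ (n + 1)) q, normalComponent q w = 0 ∧
    u'.1.1 = t • u.1.1 + w ∧ u'.1.2 = t • u.1.2 + w
  iseqv :=
    { refl := fun u => ⟨1, one_pos, 0, map_zero _, by simp, by simp⟩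
      symm := by
        rintro u u' ⟨t, ht, w, hw, h1, h2⟩
        refine ⟨t⁻¹, inv_pos.2 ht, -(t⁻¹ • w), ?_, ?_, ?_⟩
        · rw [map_neg, map_smul, hw, smul_zero, neg_zero]
        · rw [h1, smul_add, smul_smul, inv_mul_cancel₀ ht.ne']; simp
        · rw [h2, smul_add, smul_smul, inv_mul_cancel₀ ht.ne']; simp
      trans := by
        rintro u u' u'' ⟨t, ht, w, hw, h1, h2⟩ ⟨s, hs, w', hw', h3, h4⟩
        refine ⟨s * t, mul_pos hs ht, s • w + w', ?_, ?_, ?_⟩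
        · rw [map_add, map_smul, hw, hw', smul_zero, add_zero]
        · rw [h3, h1, smul_add, smul_smul, add_assoc]
        · rw [h4, h2, smul_add, smul_smul, add_assoc] }

/-- The fibre over `(q, q)` of the inward pointing spherical normal bundle of the boundary of the
diagonal in `X²`. -/
def FrontFibre (q : X) : Type := Quotient (normalSetoid (n := n) q)

/-! ### The `0`-double space -/

variable (n X) in
/-- The complement in `X²` of the boundary of the diagonal. -/
def OffDiag [T2Space X] : TopologicalSpace.Opens (X × X) :=
  ⟨{p | ¬ (p.1 = p.2 ∧ p.1 ∈ (𝓡∂ (n + 1)).boundary X)},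
    ((isClosed_eq continuous_fst continuous_snd).inter
      (((𝓡∂ (n + 1)).isClosed_boundary (n := ∞) (by simp)).preimage
        continuous_fst)).isOpen_compl⟩

variable (n X) in
/-- The `0`-double space `X²₀`, i.e. the real blow-up of `X²` along the boundary of the diagonal:
as a set, the boundary of the diagonal is replaced by its inward pointing spherical normal
bundle. -/
inductive ZeroDoubleSpace [T2Space X] where
  /-- A point of `X²` off the boundary of the diagonal. -/
  | off (p : OffDiag n X)
  /-- A point of the front face, lying over `(q, q)`. -/
  | front (q : (𝓡∂ (n + 1)).boundary X) (ν : FrontFibre (n := n) (q : X))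

/-- Coordinates `(r, a, a', w, y)` near the front face; the point they describe lies over
`((r a, y), (r a', y + r w))`. Setting `a' = 1`, or `a = 1`, or a component of `w` equal to `±1`
gives the usual projective coordinate systems; setting `a² + a'² + |w|² = 1` gives polar
coordinates. -/
abbrev BlowupCoord (n : ℕ) : Type :=
  ℝ × ℝ × ℝ × EuclideanSpace ℝ (Fin n) × EuclideanSpace ℝ (Fin n)

/-- The range of the coordinates `(r, a, a', w, y)` belonging to a chart `(x, y)` of `X`. -/
def blowupDomain (e : OpenPartialHomeomorph X (EuclideanHalfSpace (n + 1))) :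
    Set (BlowupCoord n) :=
  {c | match c with
    | (r, a, a', w, y) => 0 ≤ r ∧ 0 ≤ a ∧ 0 ≤ a' ∧ ¬ (a = 0 ∧ a' = 0 ∧ w = 0) ∧
        pt (r * a) y ∈ (e.extend (𝓡∂ (n + 1))).target ∧
        pt (r * a') (y + r • w) ∈ (e.extend (𝓡∂ (n + 1))).target}

section

variable [T2Space X]

/-- `HasCoord e c ζ`: in the chart `e = (x, y)` of `X`, the point `ζ` of `X²₀` has coordinates
`c = (r, a, a', w, y)`. For `r > 0` this is the pair of points `(r a, y)`, `(r a', y + r w)`; for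
`r = 0` it is the normal direction at the boundary point `(0, y)` given by the velocity at `r = 0`
of that pair, namely by `(v, v')` with `dx(v) = a`, `dx(v') = a'`, `dy(v') - dy(v) = w`. Positive
multiples of `(a, a', w)` (with `r` divided accordingly) describe the same point. -/
def HasCoord (e : OpenPartialHomeomorph X (EuclideanHalfSpace (n + 1)))
    (c : BlowupCoord n) (ζ : ZeroDoubleSpace n X) : Prop :=
  match c, ζ with
  | (r, a, a', w, y), .off p =>
      0 < r ∧ p.1.1 ∈ e.source ∧ p.1.2 ∈ e.source ∧
        e.extend (𝓡∂ (n + 1)) p.1.1 = pt (r * a) y ∧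
        e.extend (𝓡∂ (n + 1)) p.1.2 = pt (r * a') (y + r • w)
  | (r, a, a', w, y), .front q ν =>
      r = 0 ∧ (q : X) ∈ e.source ∧ e.extend (𝓡∂ (n + 1)) (q : X) = pt 0 y ∧
        ∃ u : InwardPair (n := n) (q : X), Quotient.mk (normalSetoid (n := n) (q : X)) u = ν ∧
          let A := mfderiv (𝓡∂ (n + 1)) 𝓘(ℝ, EuclideanSpace ℝ (Fin (n + 1)))
            (e.extend (𝓡∂ (n + 1))) (q : X)
          let ξ : EuclideanSpace ℝ (Fin (n + 1)) := A u.1.1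
          let ξ' : EuclideanSpace ℝ (Fin (n + 1)) := A u.1.2
          ξ 0 = a ∧ ξ' 0 = a' ∧ tail ξ' - tail ξ = w

/-- `G` expresses the function `f` on `X²₀` in the coordinates `(r, a, a', w, y)` belonging to `e`,
and is smooth, up to the boundary faces. -/
def IsSmoothExpr (f : ZeroDoubleSpace n X → ℝ)
    (e : OpenPartialHomeomorph X (EuclideanHalfSpace (n + 1))) (G : BlowupCoord n → ℝ) : Prop :=
  ContDiffOn ℝ ∞ G (blowupDomain e) ∧
    ∀ c ∈ blowupDomain e, ∀ ζ, HasCoord e c ζ → f ζ = G c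

/-- Smooth functions on `X²₀`. -/
def IsSmooth (f : ZeroDoubleSpace n X → ℝ) : Prop :=
  ContMDiff ((𝓡∂ (n + 1)).prod (𝓡∂ (n + 1))) 𝓘(ℝ, ℝ) ∞ (fun p : OffDiag n X => f (.off p)) ∧
    ∀ e ∈ IsManifold.maximalAtlas (𝓡∂ (n + 1)) ∞ X, ∃ G, IsSmoothExpr f e G

/-- The differential of `f` at the point `ζ` of `X²₀` does not vanish. -/
def DifferentialNeZero (f : ZeroDoubleSpace n X → ℝ) : ZeroDoubleSpace n X → Prop
  | .off p =>
      mfderiv ((𝓡∂ (n + 1)).prod (𝓡∂ (n + 1))) 𝓘(ℝ, ℝ) (fun p : OffDiag n X => f (.off p)) p ≠ 0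
  | .front q ν =>
      ∀ e ∈ IsManifold.maximalAtlas (𝓡∂ (n + 1)) ∞ X, ∀ G, IsSmoothExpr f e G →
        ∀ c ∈ blowupDomain e, HasCoord e c (.front q ν) →
          fderivWithin ℝ G (blowupDomain e) c ≠ 0

variable (n X) in
/-- The left face `FL`: the lift of `∂X × X`. -/
def leftFace : Set (ZeroDoubleSpace n X) :=
  {ζ | match ζ with
    | .off p => p.1.1 ∈ (𝓡∂ (n + 1)).boundary X
    | .front q ν => ∃ u : InwardPair (n := n) (q : X),
        Quotient.mk (normalSetoid (n := n) (q : X)) u = ν ∧ normalComponent (q : X) u.1.1 = 0}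

variable (n X) in
/-- The right face `FR`: the lift of `X × ∂X`. -/
def rightFace : Set (ZeroDoubleSpace n X) :=
  {ζ | match ζ with
    | .off p => p.1.2 ∈ (𝓡∂ (n + 1)).boundary X
    | .front q ν => ∃ u : InwardPair (n := n) (q : X),
        Quotient.mk (normalSetoid (n := n) (q : X)) u = ν ∧ normalComponent (q : X) u.1.2 = 0}

/-- `ρ` is a boundary defining function for the boundary hypersurface `F` of `X²₀`. -/
structure IsBoundaryDefiningFunction (F : Set (ZeroDoubleSpace n X))
    (ρ : ZeroDoubleSpace n X → ℝ) : Prop where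
  smooth : IsSmooth ρ
  nonneg : ∀ ζ, 0 ≤ ρ ζ
  eq_zero_iff : ∀ ζ, ρ ζ = 0 ↔ ζ ∈ F
  differential_ne_zero : ∀ ζ ∈ F, DifferentialNeZero ρ ζ

/-- A pair of interior points as a point of `X²₀`. -/
def ofInterior (z z' : Interior n X) : ZeroDoubleSpace n X :=
  .off ⟨((z : X), (z' : X)), fun h =>
    Set.disjoint_left.1 (𝓡∂ (n + 1)).disjoint_interior_boundary z.2 h.2⟩

end

end

end AsymptoticallyHyperbolic

end

open AsymptoticallyHyperbolic

/-!
Both sides of the formula are estimated near each point of the compact space `X × X`, so that it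
suffices to bound the difference of `d(z, z')` and `-log (ρL ρR)` locally.

Near a boundary point `q` of `X`, in the coordinates `(x, y)` of the definition of an asymptotically
hyperbolic metric, `g` lies between `(dx² + κ² |dy|²) / x²` and `(dx² + κ⁻² |dy|²) / x²`
(`IsCollarChart`). Near `(q, q)` this gives `d(z, z') = log (r² / (x x')) + O(1)`, with
`r² = x² + x'² + |y - y'|²`. The upper bound comes from climbing vertically from both points to the
height `max (x, x', |y - y'|)` and moving horizontally there (`IsCollarChart.dist_le_log`). For the
lower bound (`IsCollarChart.exists_le_dist`), the Busemann functions `log ((x² + κ² |y - η|²) / x)`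
are `1`-Lipschitz for the lower metric; the one centred at `η = y(z)` equals `log x` at `z`, and
about `log (r² / x')` at `z'` if `x ≤ x'`. A path leaving the collar splits into two parts, of
length at least `-log x - O(1)` and `-log x' - O(1)`. Vertical paths and connectedness of `X` show
that `d` is finite (`riemannianDist_ne_top`). Together with the estimate for paths leaving a collar,
they also show that away from the boundary of the diagonal
`d(z, z') = -log σ(z) - log σ'(z') + O(1)`, where `σ`, `σ'` are local boundary defining functions of `X`
(`exists_dist_estimate`).

A smooth function which vanishes on a face `ℓ = 0` of a convex set, with nonzero differential there,
is bounded above and below by positive multiples of `ℓ` near the face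
(`comparable_of_fderivWithin_ne_zero`). Off the front face this makes `ρL` and `ρR` comparable with
`σ(z)` and `σ'(z')`. In the coordinates `(r, a, a', w, y)` near the front face, `FL` is `a = 0` and
`FR` is `a' = 0`, so that `ρL` and `ρR` are comparable with `a` and `a'`, uniformly on the compact
set `a² + a'² + |w|² = 1`. There `a = x / r` and `a' = x' / r`, so that `-log (ρL ρR)` is
`log (r² / (x x')) + O(1)` as well.
-/

namespace AsymptoticallyHyperbolic

/-! ### Coordinates on the half-space and charts of a manifold with boundary -/

section Coordinates

variable {n : ℕ}

@[simp] lemma pt_zero (x : ℝ) (y : EuclideanSpace ℝ (Fin n)) : pt x y 0 = x := rfl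

@[simp] lemma tail_pt (x : ℝ) (y : EuclideanSpace ℝ (Fin n)) : tail (pt x y) = y := rfl

@[simp] lemma pt_tail (z : EuclideanSpace ℝ (Fin (n + 1))) : pt (z 0) (tail z) = z := by
  ext i
  refine Fin.cases ?_ (fun i => ?_) i <;> rfl

/-- `tail` as a continuous linear map. -/
noncomputable def tailL (n : ℕ) :
    EuclideanSpace ℝ (Fin (n + 1)) →L[ℝ] EuclideanSpace ℝ (Fin n) :=
  LinearMap.toContinuousLinearMap
    { toFun := tail
      map_add' := fun _ _ => rfl
      map_smul' := fun _ _ => rfl }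

@[simp] lemma tailL_apply (z : EuclideanSpace ℝ (Fin (n + 1))) : tailL n z = tail z := rfl

/-- The pair `(x, y) ↦ pt x y` as a continuous linear map. -/
noncomputable def ptL (n : ℕ) :
    ℝ × EuclideanSpace ℝ (Fin n) →L[ℝ] EuclideanSpace ℝ (Fin (n + 1)) :=
  LinearMap.toContinuousLinearMap
    { toFun := fun p => pt p.1 p.2
      map_add' := fun p p' => by
        ext i
        refine Fin.cases ?_ (fun i => ?_) i <;> rfl
      map_smul' := fun c p => by
        ext i
        refine Fin.cases ?_ (fun i => ?_) i <;> rfl }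

@[simp] lemma ptL_apply (p : ℝ × EuclideanSpace ℝ (Fin n)) : ptL n p = pt p.1 p.2 := rfl

/-- The first coordinate `x` of `(x, y)` as a continuous linear map. -/
noncomputable def headL (n : ℕ) : EuclideanSpace ℝ (Fin (n + 1)) →L[ℝ] ℝ :=
  EuclideanSpace.proj (0 : Fin (n + 1))

@[simp] lemma headL_apply (z : EuclideanSpace ℝ (Fin (n + 1))) : headL n z = z 0 := rfl

lemma norm_sq_eq_head_tail (z : EuclideanSpace ℝ (Fin (n + 1))) :
    ‖z‖ ^ 2 = z 0 ^ 2 + ‖tail z‖ ^ 2 := by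
  rw [EuclideanSpace.real_norm_sq_eq, EuclideanSpace.real_norm_sq_eq, Fin.sum_univ_succ]
  rfl

lemma range_halfSpace_model : range (𝓡∂ (n + 1)) = {z | 0 ≤ z 0} :=
  range_euclideanHalfSpace (n + 1)

end Coordinates

section Charts

variable {n : ℕ} {X : Type*} [TopologicalSpace X]
  {e : OpenPartialHomeomorph X (EuclideanHalfSpace (n + 1))}

lemma head_nonneg_of_mem_target {z : EuclideanSpace ℝ (Fin (n + 1))}
    (hz : z ∈ (e.extend (𝓡∂ (n + 1))).target) : 0 ≤ z 0 := by
  have := e.extend_target_subset_range hz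
  rwa [range_halfSpace_model] at this

lemma extend_mem_target {p : X} (hp : p ∈ e.source) :
    e.extend (𝓡∂ (n + 1)) p ∈ (e.extend (𝓡∂ (n + 1))).target :=
  (e.extend (𝓡∂ (n + 1))).map_source (by rwa [e.extend_source])

lemma extend_symm_mem_source {z : EuclideanSpace ℝ (Fin (n + 1))}
    (hz : z ∈ (e.extend (𝓡∂ (n + 1))).target) :
    (e.extend (𝓡∂ (n + 1))).symm z ∈ e.source := by
  rw [← e.extend_source (I := 𝓡∂ (n + 1))]
  exact (e.extend (𝓡∂ (n + 1))).map_target hz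

lemma extend_mem_range (e : OpenPartialHomeomorph X (EuclideanHalfSpace (n + 1))) (p : X) :
    e.extend (𝓡∂ (n + 1)) p ∈ range (𝓡∂ (n + 1)) :=
  mem_range_self (e p)

variable [ChartedSpace (EuclideanHalfSpace (n + 1)) X]

/-- Being an interior point is detected by the sign of the first coordinate in any chart of the
maximal atlas. -/
lemma mem_interior_iff_head_pos [IsManifold (𝓡∂ (n + 1)) ∞ X]
    (he : e ∈ IsManifold.maximalAtlas (𝓡∂ (n + 1)) ∞ X) {p : X}
    (hp : p ∈ e.source) :
    p ∈ (𝓡∂ (n + 1)).interior X ↔ 0 < e.extend (𝓡∂ (n + 1)) p 0 := by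
  have hloc : IsLocalDiffeomorphAt (𝓡∂ (n + 1)) (𝓡∂ (n + 1)) ∞ e p :=
    ⟨{ toPartialEquiv := e.toPartialEquiv
       open_source := e.open_source
       open_target := e.open_target
       contMDiffOn_toFun := contMDiffOn_of_mem_maximalAtlas he
       contMDiffOn_invFun := contMDiffOn_symm_of_mem_maximalAtlas he }, hp, fun _ _ => rfl⟩
  have h := hloc.isInteriorPoint_iff (by simp)
  change (𝓡∂ (n + 1)).IsInteriorPoint p ↔ _
  rw [h, ModelWithCorners.IsInteriorPoint, interior_range_modelWithCornersEuclideanHalfSpace,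
    extChartAt_self_eq]
  rfl

lemma mem_boundary_iff_head_eq_zero [IsManifold (𝓡∂ (n + 1)) ∞ X]
    (he : e ∈ IsManifold.maximalAtlas (𝓡∂ (n + 1)) ∞ X) {p : X}
    (hp : p ∈ e.source) :
    p ∈ (𝓡∂ (n + 1)).boundary X ↔ e.extend (𝓡∂ (n + 1)) p 0 = 0 := by
  rw [← ModelWithCorners.compl_interior, mem_compl_iff, mem_interior_iff_head_pos he hp]
  have := head_nonneg_of_mem_target (extend_mem_target hp)
  constructor
  · intro h; linarith
  · intro h; linarith

lemma contMDiffOn_extend_symm_target (he : e ∈ IsManifold.maximalAtlas (𝓡∂ (n + 1)) ∞ X) :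
    ContMDiffOn 𝓘(ℝ, EuclideanSpace ℝ (Fin (n + 1))) (𝓡∂ (n + 1)) ∞
      (e.extend (𝓡∂ (n + 1))).symm (e.extend (𝓡∂ (n + 1))).target := by
  have := contMDiffOn_extend_symm he
  rwa [← e.extend_target'] at this

lemma contMDiffWithinAt_extend_symm_range (he : e ∈ IsManifold.maximalAtlas (𝓡∂ (n + 1)) ∞ X)
    {p : X} (hp : p ∈ e.source) :
    ContMDiffWithinAt 𝓘(ℝ, EuclideanSpace ℝ (Fin (n + 1))) (𝓡∂ (n + 1)) ∞
      (e.extend (𝓡∂ (n + 1))).symm (range (𝓡∂ (n + 1))) (e.extend (𝓡∂ (n + 1)) p) :=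
  (contMDiffOn_extend_symm_target he _ (extend_mem_target hp)).mono_of_mem_nhdsWithin
    (e.extend_target_mem_nhdsWithin hp)

lemma mdifferentiableAt_extend (he : e ∈ IsManifold.maximalAtlas (𝓡∂ (n + 1)) ∞ X)
    {p : X} (hp : p ∈ e.source) :
    MDifferentiableAt (𝓡∂ (n + 1)) 𝓘(ℝ, EuclideanSpace ℝ (Fin (n + 1)))
      (e.extend (𝓡∂ (n + 1))) p :=
  (e.contMDiffAt_extend he hp).mdifferentiableAt (by simp)

lemma surjective_mfderiv_extend (he : e ∈ IsManifold.maximalAtlas (𝓡∂ (n + 1)) ∞ X)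
    {p : X} (hp : p ∈ e.source) :
    Function.Surjective (mfderiv (𝓡∂ (n + 1)) 𝓘(ℝ, EuclideanSpace ℝ (Fin (n + 1)))
      (e.extend (𝓡∂ (n + 1))) p) := by
  set u := e.extend (𝓡∂ (n + 1)) p with hu
  have hpu : (e.extend (𝓡∂ (n + 1))).symm u = p := e.extend_left_inv hp
  have h1 : MDifferentiableWithinAt 𝓘(ℝ, EuclideanSpace ℝ (Fin (n + 1))) (𝓡∂ (n + 1))
      (e.extend (𝓡∂ (n + 1))).symm (range (𝓡∂ (n + 1))) u :=
    (contMDiffWithinAt_extend_symm_range he hp).mdifferentiableWithinAt (by simp)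
  have huniq : UniqueMDiffWithinAt 𝓘(ℝ, EuclideanSpace ℝ (Fin (n + 1)))
      (range (𝓡∂ (n + 1))) u := by
    rw [uniqueMDiffWithinAt_iff_uniqueDiffWithinAt]
    exact (𝓡∂ (n + 1)).uniqueDiffWithinAt_image
  have hcomp := mfderiv_comp_mfderivWithin_of_eq (mdifferentiableAt_extend he hp) h1 huniq hpu
  have hid : mfderivWithin 𝓘(ℝ, EuclideanSpace ℝ (Fin (n + 1)))
      𝓘(ℝ, EuclideanSpace ℝ (Fin (n + 1)))
      (e.extend (𝓡∂ (n + 1)) ∘ (e.extend (𝓡∂ (n + 1))).symm) (range (𝓡∂ (n + 1))) u =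
      ContinuousLinearMap.id ℝ _ := by
    rw [← mfderivWithin_id huniq]
    refine Filter.EventuallyEq.mfderivWithin_eq ?_ ?_
    · filter_upwards [e.extend_target_mem_nhdsWithin hp] with z hz
      exact (e.extend (𝓡∂ (n + 1))).right_inv hz
    · exact congrArg (e.extend (𝓡∂ (n + 1))) hpu
  intro ξ
  refine ⟨mfderivWithin 𝓘(ℝ, EuclideanSpace ℝ (Fin (n + 1))) (𝓡∂ (n + 1))
      (e.extend (𝓡∂ (n + 1))).symm (range (𝓡∂ (n + 1))) u ξ, ?_⟩
  have := congrArg (fun L => L ξ) (hcomp.symm.trans hid)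
  exact this

end Charts

/-! ### Lengths of paths and the Riemannian distance -/

section Lengths

variable {n : ℕ} {X : Type*} [TopologicalSpace X] [ChartedSpace (EuclideanHalfSpace (n + 1)) X]
  [IsManifold (𝓡∂ (n + 1)) ∞ X]

/-- The `g`-length of the path `γ` between the times `a` and `b`. -/
noncomputable def length (g : InteriorMetric n X) (γ : ℝ → Interior n X) (a b : ℝ) : ℝ≥0∞ :=
  letI : RiemannianBundle (fun p : Interior n X => TangentSpace (𝓡∂ (n + 1)) p) :=
    ⟨g.toRiemannianMetric⟩
  Manifold.pathELength (𝓡∂ (n + 1)) γ a b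

lemma length_eq_lintegral (g : InteriorMetric n X) (γ : ℝ → Interior n X) (a b : ℝ) :
    length g γ a b = ∫⁻ t in Icc a b, ENNReal.ofReal (Real.sqrt (g.inner (γ t)
      (mfderivWithin 𝓘(ℝ, ℝ) (𝓡∂ (n + 1)) γ (Icc a b) t (1 : ℝ))
      (mfderivWithin 𝓘(ℝ, ℝ) (𝓡∂ (n + 1)) γ (Icc a b) t (1 : ℝ)))) := by
  let _ : RiemannianBundle (fun p : Interior n X => TangentSpace (𝓡∂ (n + 1)) p) :=
    ⟨g.toRiemannianMetric⟩
  unfold length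
  rw [Manifold.pathELength_eq_lintegral_mfderivWithin_Icc]
  refine MeasureTheory.lintegral_congr fun t => ?_
  rw [← ofReal_norm, norm_eq_sqrt_real_inner]
  rfl

lemma length_add (g : InteriorMetric n X) (γ : ℝ → Interior n X) {a b c : ℝ} (hab : a ≤ b)
    (hbc : b ≤ c) : length g γ a b + length g γ b c = length g γ a c :=
  letI : RiemannianBundle (fun p : Interior n X => TangentSpace (𝓡∂ (n + 1)) p) :=
    ⟨g.toRiemannianMetric⟩
  Manifold.pathELength_add hab hbc

lemma length_mono (g : InteriorMetric n X) (γ : ℝ → Interior n X) {a b a' b' : ℝ}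
    (ha : a' ≤ a) (hb : b ≤ b') : length g γ a b ≤ length g γ a' b' :=
  letI : RiemannianBundle (fun p : Interior n X => TangentSpace (𝓡∂ (n + 1)) p) :=
    ⟨g.toRiemannianMetric⟩
  Manifold.pathELength_mono ha hb

lemma riemannianDist_le_length (g : InteriorMetric n X) {γ : ℝ → Interior n X} {a b : ℝ}
    (hab : a ≤ b) (hγ : ContMDiffOn 𝓘(ℝ, ℝ) (𝓡∂ (n + 1)) 1 γ (Icc a b)) :
    riemannianDist g (γ a) (γ b) ≤ length g γ a b :=
  letI : RiemannianBundle (fun p : Interior n X => TangentSpace (𝓡∂ (n + 1)) p) :=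
    ⟨g.toRiemannianMetric⟩
  Manifold.riemannianEDist_le_pathELength hγ rfl rfl hab

/-- A lower bound for the lengths of all paths is a lower bound for the distance. -/
lemma le_riemannianDist (g : InteriorMetric n X) {z z' : Interior n X} {B : ℝ≥0∞}
    (h : ∀ γ : ℝ → Interior n X, ContMDiffOn 𝓘(ℝ, ℝ) (𝓡∂ (n + 1)) 1 γ (Icc 0 1) →
      γ 0 = z → γ 1 = z' → B ≤ length g γ 0 1) : B ≤ riemannianDist g z z' := by
  let _ : RiemannianBundle (fun p : Interior n X => TangentSpace (𝓡∂ (n + 1)) p) :=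
    ⟨g.toRiemannianMetric⟩
  by_contra! hlt
  obtain ⟨γ, h0, h1, hγ, hl⟩ := Manifold.exists_lt_of_riemannianEDist_lt hlt
  exact absurd (h γ hγ h0 h1) (not_le.2 hl)

lemma riemannianDist_comm (g : InteriorMetric n X) (z z' : Interior n X) :
    riemannianDist g z z' = riemannianDist g z' z :=
  letI : RiemannianBundle (fun p : Interior n X => TangentSpace (𝓡∂ (n + 1)) p) :=
    ⟨g.toRiemannianMetric⟩
  Manifold.riemannianEDist_comm

lemma riemannianDist_triangle (g : InteriorMetric n X) (z z' z'' : Interior n X) :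
    riemannianDist g z z'' ≤ riemannianDist g z z' + riemannianDist g z' z'' :=
  letI : RiemannianBundle (fun p : Interior n X => TangentSpace (𝓡∂ (n + 1)) p) :=
    ⟨g.toRiemannianMetric⟩
  Manifold.riemannianEDist_triangle

lemma eventually_riemannianDist_lt_one (g : InteriorMetric n X) (z : Interior n X) :
    ∀ᶠ z' in 𝓝 z, riemannianDist g z z' < 1 := by
  let _ : RiemannianBundle (fun p : Interior n X => TangentSpace (𝓡∂ (n + 1)) p) :=
    ⟨g.toRiemannianMetric⟩
  have : IsContinuousRiemannianBundle (EuclideanSpace ℝ (Fin (n + 1)))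
      (fun p : Interior n X => TangentSpace (𝓡∂ (n + 1)) p) :=
    ⟨g.inner, g.contMDiff.continuous, fun _ _ _ => rfl⟩
  have : IsManifold (𝓡∂ (n + 1)) 1 (Interior n X) := IsManifold.of_le (n := ∞) (by simp)
  exact eventually_riemannianEDist_lt (𝓡∂ (n + 1)) z one_pos

/-- The differential at `p` of a function on `X°` with values in a normed space. -/
noncomputable def differential {F : Type*} [NormedAddCommGroup F] [NormedSpace ℝ F]
    (f : Interior n X → F) (p : Interior n X) : TangentSpace (𝓡∂ (n + 1)) p →L[ℝ] F :=
  mfderiv (𝓡∂ (n + 1)) 𝓘(ℝ, F) f p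

/-- Along a path on which `|df| ≤ 1` with respect to `g`, the function `f` varies at most by the
length of the path. -/
lemma enorm_sub_le_length (g : InteriorMetric n X) {f : Interior n X → ℝ}
    {γ : ℝ → Interior n X} {a b : ℝ} (hab : a ≤ b)
    (hγ : ContMDiffOn 𝓘(ℝ, ℝ) (𝓡∂ (n + 1)) 1 γ (Icc a b))
    (hf : ∀ t ∈ Icc a b, ContMDiffAt (𝓡∂ (n + 1)) 𝓘(ℝ, ℝ) 1 f (γ t))
    (hbd : ∀ t ∈ Icc a b, ∀ v : TangentSpace (𝓡∂ (n + 1)) (γ t),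
      |differential f (γ t) v| ≤ Real.sqrt (g.inner (γ t) v v)) :
    ‖f (γ b) - f (γ a)‖ₑ ≤ length g γ a b := by
  rcases hab.eq_or_lt with rfl | hlt
  · simp
  have hfγ : ContDiffOn ℝ 1 (f ∘ γ) (Icc a b) := by
    rw [← contMDiffOn_iff_contDiffOn]
    exact fun t ht => (hf t ht).comp_contMDiffWithinAt t (hγ t ht)
  refine (enorm_sub_le_lintegral_derivWithin_Icc_of_contDiffOn_Icc hfγ hab).trans ?_
  rw [length_eq_lintegral]
  refine MeasureTheory.setLIntegral_mono' measurableSet_Icc fun t ht => ?_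
  have huniq : UniqueMDiffWithinAt 𝓘(ℝ, ℝ) (Icc a b) t := by
    rw [uniqueMDiffWithinAt_iff_uniqueDiffWithinAt]
    exact uniqueDiffOn_Icc hlt t ht
  have hcomp := mfderiv_comp_mfderivWithin (I := 𝓘(ℝ, ℝ)) (I' := 𝓡∂ (n + 1)) (I'' := 𝓘(ℝ, ℝ))
    (x := t) ((hf t ht).mdifferentiableAt one_ne_zero)
    ((hγ t ht).mdifferentiableWithinAt one_ne_zero) huniq
  have hd : derivWithin (f ∘ γ) (Icc a b) t =
      differential f (γ t) (mfderivWithin 𝓘(ℝ, ℝ) (𝓡∂ (n + 1)) γ (Icc a b) t (1 : ℝ)) := by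
    rw [← fderivWithin_derivWithin, ← mfderivWithin_eq_fderivWithin, hcomp]
    rfl
  rw [hd, ← ofReal_norm, Real.norm_eq_abs]
  exact ENNReal.ofReal_le_ofReal (hbd t ht _)

/-- The chart coordinates of interior points. -/
noncomputable abbrev coord (e : OpenPartialHomeomorph X (EuclideanHalfSpace (n + 1)))
    (p : Interior n X) : EuclideanSpace ℝ (Fin (n + 1)) :=
  e.extend (𝓡∂ (n + 1)) (p : X)

lemma contMDiffAt_coord {e : OpenPartialHomeomorph X (EuclideanHalfSpace (n + 1))}
    (he : e ∈ IsManifold.maximalAtlas (𝓡∂ (n + 1)) ∞ X) {p : Interior n X}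
    (hp : (p : X) ∈ e.source) :
    ContMDiffAt (𝓡∂ (n + 1)) 𝓘(ℝ, EuclideanSpace ℝ (Fin (n + 1))) ∞ (coord e) p :=
  contMDiffAt_subtype_iff.2 (e.contMDiffAt_extend he hp)

lemma coord_pos {e : OpenPartialHomeomorph X (EuclideanHalfSpace (n + 1))}
    (he : e ∈ IsManifold.maximalAtlas (𝓡∂ (n + 1)) ∞ X) {p : Interior n X}
    (hp : (p : X) ∈ e.source) : 0 < coord e p 0 :=
  (mem_interior_iff_head_pos he hp).1 p.2

/-- A point of a chart with positive first coordinate comes from an interior point. -/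
lemma exists_coord_eq {e : OpenPartialHomeomorph X (EuclideanHalfSpace (n + 1))}
    (he : e ∈ IsManifold.maximalAtlas (𝓡∂ (n + 1)) ∞ X) {u : EuclideanSpace ℝ (Fin (n + 1))}
    (hu : u ∈ (e.extend (𝓡∂ (n + 1))).target) (hu0 : 0 < u 0) :
    ∃ p : Interior n X, (p : X) ∈ e.source ∧ coord e p = u := by
  have h := (e.extend (𝓡∂ (n + 1))).right_inv hu
  refine ⟨⟨(e.extend (𝓡∂ (n + 1))).symm u, ?_⟩, extend_symm_mem_source hu, h⟩
  refine (mem_interior_iff_head_pos he (extend_symm_mem_source hu)).2 ?_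
  rwa [h]

lemma eq_of_coord_eq {e : OpenPartialHomeomorph X (EuclideanHalfSpace (n + 1))}
    {p p' : Interior n X} (hp : (p : X) ∈ e.source) (hp' : (p' : X) ∈ e.source)
    (h : coord e p = coord e p') : p = p' :=
  Subtype.ext ((e.extend (𝓡∂ (n + 1))).injOn (by rwa [e.extend_source])
    (by rwa [e.extend_source]) h)

/-- A smooth curve in a chart, of `g`-speed at most `L` on `[0, 1]`, bounds the distance. -/
lemma riemannianDist_le_of_curve (g : InteriorMetric n X)
    {e : OpenPartialHomeomorph X (EuclideanHalfSpace (n + 1))}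
    (he : e ∈ IsManifold.maximalAtlas (𝓡∂ (n + 1)) ∞ X)
    {u : ℝ → EuclideanSpace ℝ (Fin (n + 1))} (hu : ContDiff ℝ ∞ u)
    (hut : ∀ t ∈ Icc (0 : ℝ) 1, u t ∈ (e.extend (𝓡∂ (n + 1))).target)
    (hu0 : ∀ t ∈ Icc (0 : ℝ) 1, 0 < u t 0)
    {z z' : Interior n X} (hz : (z : X) ∈ e.source) (hz' : (z' : X) ∈ e.source)
    (hzu : coord e z = u 0) (hzu' : coord e z' = u 1) {L : ℝ}
    (hL : ∀ t ∈ Icc (0 : ℝ) 1, ∀ p : Interior n X, (p : X) ∈ e.source → coord e p = u t →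
      ∀ v : TangentSpace (𝓡∂ (n + 1)) p,
        differential (coord e) p v = deriv u t → Real.sqrt (g.inner p v v) ≤ L) :
    riemannianDist g z z' ≤ ENNReal.ofReal L := by
  classical
  have hex : ∀ t ∈ Icc (0 : ℝ) 1, ∃ p : Interior n X, (p : X) ∈ e.source ∧ coord e p = u t :=
    fun t ht => exists_coord_eq he (hut t ht) (hu0 t ht)
  have : Nonempty (Interior n X) := ⟨z⟩
  choose! γ hγs hγu using hex
  have hval : ∀ t ∈ Icc (0 : ℝ) 1, (γ t : X) = (e.extend (𝓡∂ (n + 1))).symm (u t) :=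
    fun t ht => by rw [← hγu t ht]; exact (e.extend_left_inv (hγs t ht)).symm
  have hγ : ContMDiffOn 𝓘(ℝ, ℝ) (𝓡∂ (n + 1)) ∞ γ (Icc 0 1) := by
    intro t ht
    rw [← ContMDiffWithinAt.subtypeVal_comp_iff]
    refine ContMDiffWithinAt.congr ?_ hval (hval t ht)
    exact ((contMDiffOn_extend_symm_target he).comp hu.contMDiff.contMDiffOn hut) t ht
  have h0 : γ 0 = z := eq_of_coord_eq (hγs 0 (by simp)) hz (by rw [hγu 0 (by simp), hzu])
  have h1 : γ 1 = z' := eq_of_coord_eq (hγs 1 (by simp)) hz' (by rw [hγu 1 (by simp), hzu'])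
  have hγ1 : ContMDiffOn 𝓘(ℝ, ℝ) (𝓡∂ (n + 1)) 1 γ (Icc 0 1) := hγ.of_le (by simp)
  have hle := riemannianDist_le_length g zero_le_one hγ1
  rw [h0, h1] at hle
  refine hle.trans ?_
  rw [length_eq_lintegral]
  refine (MeasureTheory.setLIntegral_mono' (g := fun _ => ENNReal.ofReal L) measurableSet_Icc
    fun t ht => ENNReal.ofReal_le_ofReal (hL t ht _ (hγs t ht) (hγu t ht) _ ?_)).trans ?_
  · have huniq : UniqueMDiffWithinAt 𝓘(ℝ, ℝ) (Icc (0 : ℝ) 1) t := by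
      rw [uniqueMDiffWithinAt_iff_uniqueDiffWithinAt]
      exact uniqueDiffOn_Icc zero_lt_one t ht
    have hcomp := mfderiv_comp_mfderivWithin (I := 𝓘(ℝ, ℝ)) (I' := 𝓡∂ (n + 1))
      (I'' := 𝓘(ℝ, EuclideanSpace ℝ (Fin (n + 1)))) (x := t)
      ((contMDiffAt_coord he (hγs t ht)).mdifferentiableAt (by simp))
      ((hγ1 t ht).mdifferentiableWithinAt one_ne_zero) huniq
    have hcongr : mfderivWithin 𝓘(ℝ, ℝ) 𝓘(ℝ, EuclideanSpace ℝ (Fin (n + 1))) (coord e ∘ γ)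
        (Icc 0 1) t = mfderivWithin 𝓘(ℝ, ℝ) 𝓘(ℝ, EuclideanSpace ℝ (Fin (n + 1))) u
        (Icc 0 1) t :=
      mfderivWithin_congr (fun s hs => hγu s hs) (hγu t ht)
    rw [hcomp, mfderivWithin_eq_fderivWithin] at hcongr
    have hd : fderivWithin ℝ u (Icc (0 : ℝ) 1) t 1 = deriv u t := by
      rw [fderivWithin_derivWithin]
      exact ((hu.differentiable (by simp)) t).derivWithin (uniqueDiffOn_Icc zero_lt_one t ht)
    rw [← hd]
    exact congrArg (fun A => A (1 : ℝ)) hcongr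
  · simp

end Lengths

/-! ### Bounds for positive definite quadratic forms -/

section QuadraticForms

variable {n : ℕ}

/-- By compactness of the unit sphere and homogeneity, a positive definite quadratic form is
comparable with the square of the norm. -/
lemma exists_le_dotProduct_mulVec_le {A : Matrix (Fin n) (Fin n) ℝ} (hA : A.PosDef) :
    ∃ m > 0, ∃ M > 0, ∀ η : EuclideanSpace ℝ (Fin n),
      m * ‖η‖ ^ 2 ≤ (fun i => η i) ⬝ᵥ (A *ᵥ fun i => η i) ∧
        (fun i => η i) ⬝ᵥ (A *ᵥ fun i => η i) ≤ M * ‖η‖ ^ 2 := by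
  set F : EuclideanSpace ℝ (Fin n) → ℝ := fun η => (fun i => η i) ⬝ᵥ (A *ᵥ fun i => η i) with hF
  have hcont : Continuous F := by
    simp only [hF, dotProduct, Matrix.mulVec]
    fun_prop
  have hK : IsCompact (Metric.sphere (0 : EuclideanSpace ℝ (Fin n)) 1) := isCompact_sphere 0 1
  have hpos : ∀ η ∈ Metric.sphere (0 : EuclideanSpace ℝ (Fin n)) 1, 0 < F η := by
    intro η hη
    have hne : (fun i => η i) ≠ 0 := by
      intro h0
      have : η = 0 := by ext i; exact congrFun h0 i
      simp [this] at hη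
    simpa using hA.dotProduct_mulVec_pos hne
  obtain ⟨m, hm, hmF⟩ := hK.exists_forall_le' hcont.continuousOn hpos
  obtain ⟨M, hM⟩ := hK.bddAbove_image hcont.continuousOn
  have hscale : ∀ η : EuclideanSpace ℝ (Fin n), ∀ c : ℝ, F (c • η) = c ^ 2 * F η := by
    intro η c
    simp only [hF, dotProduct, Matrix.mulVec, PiLp.smul_apply, smul_eq_mul, Finset.mul_sum]
    refine Finset.sum_congr rfl fun i _ => Finset.sum_congr rfl fun j _ => ?_
    ring
  refine ⟨m, hm, max M 1, by positivity, fun η => ?_⟩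
  rcases eq_or_ne η 0 with rfl | hη
  · simp
  have hn : 0 < ‖η‖ := norm_pos_iff.2 hη
  have hs : ‖η‖⁻¹ • η ∈ Metric.sphere (0 : EuclideanSpace ℝ (Fin n)) 1 := by
    simp [norm_smul, hn.ne']
  have hFη : F η = ‖η‖ ^ 2 * F (‖η‖⁻¹ • η) := by
    rw [hscale]; field_simp
  have h1 := hmF _ hs
  have h2 := (hM (mem_image_of_mem F hs)).trans (le_max_left M 1)
  change m * ‖η‖ ^ 2 ≤ F η ∧ F η ≤ max M 1 * ‖η‖ ^ 2
  rw [hFη]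
  constructor <;> nlinarith [sq_nonneg ‖η‖]

lemma abs_dotProduct_mulVec_sub_le (A B : Matrix (Fin n) (Fin n) ℝ)
    (η : EuclideanSpace ℝ (Fin n)) :
    |(fun i => η i) ⬝ᵥ (A *ᵥ fun i => η i) - (fun i => η i) ⬝ᵥ (B *ᵥ fun i => η i)| ≤
      (∑ i, ∑ j, |A i j - B i j|) * ‖η‖ ^ 2 := by
  have hη : ∀ i, |η i| ≤ ‖η‖ := fun i => PiLp.norm_apply_le η i
  simp only [dotProduct, Matrix.mulVec, ← Finset.sum_sub_distrib, Finset.mul_sum,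
    Finset.sum_mul]
  refine (Finset.abs_sum_le_sum_abs _ _).trans (Finset.sum_le_sum fun i _ => ?_)
  refine (Finset.abs_sum_le_sum_abs _ _).trans (Finset.sum_le_sum fun j _ => ?_)
  have : η i * (A i j * η j) - η i * (B i j * η j) = (A i j - B i j) * (η i * η j) := by ring
  rw [this, abs_mul, abs_mul, sq]
  gcongr <;> exact hη _

/-- A family of matrices, continuous and positive definite at `u₀`, is uniformly comparable with the
identity near `u₀`. -/
lemma eventually_dotProduct_mulVec_bounds {F : Type*} [TopologicalSpace F]
    {h : F → Matrix (Fin n) (Fin n) ℝ} {S : Set F} {u₀ : F}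
    (hc : ∀ i j, ContinuousWithinAt (fun z => h z i j) S u₀) (hpos : (h u₀).PosDef) :
    ∃ κ > 0, ∀ᶠ z in 𝓝[S] u₀, ∀ η : EuclideanSpace ℝ (Fin n),
      κ ^ 2 * ‖η‖ ^ 2 ≤ (fun i => η i) ⬝ᵥ (h z *ᵥ fun i => η i) ∧
        (fun i => η i) ⬝ᵥ (h z *ᵥ fun i => η i) ≤ (‖η‖ / κ) ^ 2 := by
  obtain ⟨m, hm, M, hM, hmM⟩ := exists_le_dotProduct_mulVec_le hpos
  set κ : ℝ := min (Real.sqrt (m / 2)) (1 / Real.sqrt (M + m / 2)) with hκ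
  have hκpos : 0 < κ := lt_min (by positivity) (by positivity)
  have hκ1 : κ ^ 2 ≤ m / 2 := by
    have := pow_le_pow_left₀ hκpos.le (min_le_left (Real.sqrt (m / 2))
      (1 / Real.sqrt (M + m / 2))) 2
    rwa [Real.sq_sqrt (by positivity)] at this
  have hκ2 : κ ^ 2 ≤ 1 / (M + m / 2) := by
    have := pow_le_pow_left₀ hκpos.le (min_le_right (Real.sqrt (m / 2))
      (1 / Real.sqrt (M + m / 2))) 2
    rwa [div_pow, Real.sq_sqrt (by positivity), one_pow] at this
  refine ⟨κ, hκpos, ?_⟩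
  have hD : Filter.Tendsto (fun z => ∑ i, ∑ j, |h z i j - h u₀ i j|) (𝓝[S] u₀) (𝓝 0) := by
    have : (0 : ℝ) = ∑ i, ∑ j, |h u₀ i j - h u₀ i j| := by simp
    rw [this]
    exact tendsto_finsetSum _ fun i _ => tendsto_finsetSum _ fun j _ =>
      ((hc i j).tendsto.sub_const _).abs
  filter_upwards [hD.eventually_le_const (show (0 : ℝ) < m / 2 by positivity)] with z hz η
  have h1 := abs_le.1 (abs_dotProduct_mulVec_sub_le (h z) (h u₀) η)
  have h2 := hmM η
  have h3 : (∑ i, ∑ j, |h z i j - h u₀ i j|) * ‖η‖ ^ 2 ≤ m / 2 * ‖η‖ ^ 2 := by gcongr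
  constructor
  · have : κ ^ 2 * ‖η‖ ^ 2 ≤ m / 2 * ‖η‖ ^ 2 := by gcongr
    linarith [h1.1, h2.1]
  · have h4 : (M + m / 2) * ‖η‖ ^ 2 ≤ (‖η‖ / κ) ^ 2 := by
      rw [div_pow, le_div_iff₀ (by positivity)]
      have : κ ^ 2 * (M + m / 2) ≤ 1 := (le_div_iff₀ (by positivity)).1 hκ2
      nlinarith [sq_nonneg ‖η‖]
    linarith [h1.2, h2.2]

end QuadraticForms

/-! ### Busemann functions of the half-space model -/

section Busemann

variable {n : ℕ}

/-- The Busemann function `log ((x² + κ² |y - η|²) / x)` of the metric `(dx² + κ² |dy|²) / x²` on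
the half-space, belonging to the boundary point `η`. -/
noncomputable def busemann (κ : ℝ) (η : EuclideanSpace ℝ (Fin n))
    (z : EuclideanSpace ℝ (Fin (n + 1))) : ℝ :=
  Real.log (z 0 ^ 2 + κ ^ 2 * ‖tail z - η‖ ^ 2) - Real.log (z 0)

variable {κ : ℝ} {η : EuclideanSpace ℝ (Fin n)} {z : EuclideanSpace ℝ (Fin (n + 1))}

lemma contDiffAt_busemann (hz : 0 < z 0) : ContDiffAt ℝ ∞ (busemann κ η) z := by
  have h0 : ContDiffAt ℝ ∞ (fun z : EuclideanSpace ℝ (Fin (n + 1)) => z 0) z :=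
    (headL n).contDiff.contDiffAt
  have h1 : ContDiffAt ℝ ∞ (fun z : EuclideanSpace ℝ (Fin (n + 1)) => ‖tail z - η‖ ^ 2) z :=
    (((tailL n).contDiff.sub contDiff_const).norm_sq ℝ).contDiffAt
  unfold busemann
  exact (((h0.pow 2).add (contDiffAt_const.mul h1)).log (by positivity)).sub (h0.log hz.ne')

/-- The differential of the Busemann function has norm at most `1` with respect to the metric
`(dx² + κ² |dy|²) / x²`. With `W = |y - η|²`, it sends `ξ` to
`(ξ₀ (x² - κ² W) + 2 x κ² ⟨y - η, tail ξ⟩) / (x (x² + κ² W))`, and the bound is the Cauchy-Schwarz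
inequality combined with `(x² - κ² W)² + 4 x² κ² W = (x² + κ² W)²`. -/
lemma abs_fderiv_busemann_le (hz : 0 < z 0) (ξ : EuclideanSpace ℝ (Fin (n + 1))) :
    |fderiv ℝ (busemann κ η) z ξ| ≤
      Real.sqrt ((ξ 0 ^ 2 + κ ^ 2 * ‖tail ξ‖ ^ 2) / z 0 ^ 2) := by
  have h0 : HasFDerivAt (fun z : EuclideanSpace ℝ (Fin (n + 1)) => z 0) (headL n) z :=
    (headL n).hasFDerivAt
  have h1 : HasFDerivAt (fun z : EuclideanSpace ℝ (Fin (n + 1)) => tail z - η) (tailL n) z :=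
    (tailL n).hasFDerivAt.sub_const η
  have hS : 0 < z 0 ^ 2 + κ ^ 2 * ‖tail z - η‖ ^ 2 := by positivity
  have h2 := (((h0.pow 2).add (h1.norm_sq.const_mul (κ ^ 2))).log hS.ne').sub (h0.log hz.ne')
  have h3 : fderiv ℝ (busemann κ η) z ξ =
      (z 0 ^ 2 + κ ^ 2 * ‖tail z - η‖ ^ 2)⁻¹ *
        (2 * z 0 * ξ 0 + κ ^ 2 * (2 * inner ℝ (tail z - η) (tail ξ))) - (z 0)⁻¹ * ξ 0 := by
    have : HasFDerivAt (busemann κ η) _ z := h2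
    rw [this.fderiv]
    simp [inner_sub_left, mul_add]
  rw [h3]
  refine Real.abs_le_sqrt ?_
  have hCS : (inner ℝ (tail z - η) (tail ξ)) ^ 2 ≤ ‖tail z - η‖ ^ 2 * ‖tail ξ‖ ^ 2 := by
    rw [← mul_pow, ← sq_abs]
    exact pow_le_pow_left₀ (abs_nonneg _) (abs_real_inner_le_norm _ _) 2
  set x := z 0
  set a := ξ 0
  set W := ‖tail z - η‖ ^ 2
  set c : ℝ := inner ℝ (tail z - η) (tail ξ)
  set V := ‖tail ξ‖ ^ 2
  set k := κ ^ 2 with hk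
  have hk0 : 0 ≤ k := sq_nonneg κ
  have heq : (x ^ 2 + k * W)⁻¹ * (2 * x * a + k * (2 * c)) - x⁻¹ * a =
      (a * (x ^ 2 - k * W) + 2 * x * (k * c)) / ((x ^ 2 + k * W) * x) := by
    field_simp
    ring
  rw [heq, div_pow, mul_pow, div_le_div_iff₀ (by positivity) (by positivity)]
  have hmain : (a * (x ^ 2 - k * W) + 2 * x * (k * c)) ^ 2 ≤
      (a ^ 2 + k * V) * (x ^ 2 + k * W) ^ 2 := by
    have h5 : k ^ 2 * c ^ 2 ≤ k ^ 2 * (W * V) := by gcongr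
    have hV : 0 ≤ V := sq_nonneg _
    have hW : 0 ≤ W := sq_nonneg _
    rcases eq_or_lt_of_le (mul_nonneg hk0 hV) with hkV | hkV
    · have hc : k * c = 0 := by
        have : (k * c) ^ 2 ≤ 0 := by nlinarith
        nlinarith [sq_nonneg (k * c)]
      rw [hc, ← hkV]
      have : (x ^ 2 - k * W) ^ 2 ≤ (x ^ 2 + k * W) ^ 2 := by
        nlinarith [mul_nonneg (sq_nonneg x) (mul_nonneg hk0 hW)]
      nlinarith [mul_le_mul_of_nonneg_left this (sq_nonneg a)]
    · -- Cauchy-Schwarz for `(a, √(kV))` and `(x² - kW, 2 x k c / √(kV))`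
      have h6 : (k * c) ^ 2 / (k * V) ≤ k * W := by
        rw [div_le_iff₀ hkV]; nlinarith
      set r := k * c / (k * V) with hr
      have hrc : k * c = r * (k * V) := by rw [hr, div_mul_cancel₀ _ hkV.ne']
      have h7 : r ^ 2 * (k * V) ≤ k * W := by
        have : (k * c) ^ 2 / (k * V) = r ^ 2 * (k * V) := by rw [hrc]; field_simp
        linarith
      rw [hrc]
      have h8 : (a * (x ^ 2 - k * W) + 2 * x * (r * (k * V))) ^ 2 ≤
          (a ^ 2 + k * V) * ((x ^ 2 - k * W) ^ 2 + 4 * x ^ 2 * (r ^ 2 * (k * V))) := by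
        nlinarith [mul_nonneg hkV.le (sq_nonneg (a * (2 * x * r) - (x ^ 2 - k * W)))]
      have h9 : (x ^ 2 - k * W) ^ 2 + 4 * x ^ 2 * (r ^ 2 * (k * V)) ≤ (x ^ 2 + k * W) ^ 2 := by
        nlinarith [mul_le_mul_of_nonneg_left h7 (sq_nonneg x)]
      exact h8.trans (by gcongr)
  nlinarith [mul_le_mul_of_nonneg_right hmain (sq_nonneg x)]

end Busemann

/-! ### Collar charts -/

section Collar

variable {n : ℕ} {X : Type*} [TopologicalSpace X]

/-- The part of the chart `e = (x, y)` with `x < r` and `|y - y₀| < r`. -/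
def cylinder (e : OpenPartialHomeomorph X (EuclideanHalfSpace (n + 1)))
    (y₀ : EuclideanSpace ℝ (Fin n)) (r : ℝ) : Set X :=
  {p | p ∈ e.source ∧ e.extend (𝓡∂ (n + 1)) p 0 < r ∧
    ‖tail (e.extend (𝓡∂ (n + 1)) p) - y₀‖ < r}

/-- The part of the chart `e = (x, y)` with `x ≤ r` and `|y - y₀| ≤ r`. -/
def closedCylinder (e : OpenPartialHomeomorph X (EuclideanHalfSpace (n + 1)))
    (y₀ : EuclideanSpace ℝ (Fin n)) (r : ℝ) : Set X :=
  {p | p ∈ e.source ∧ e.extend (𝓡∂ (n + 1)) p 0 ≤ r ∧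
    ‖tail (e.extend (𝓡∂ (n + 1)) p) - y₀‖ ≤ r}

variable {e : OpenPartialHomeomorph X (EuclideanHalfSpace (n + 1))}
  {y₀ : EuclideanSpace ℝ (Fin n)} {r : ℝ}

lemma cylinder_subset_closedCylinder : cylinder e y₀ r ⊆ closedCylinder e y₀ r :=
  fun _ hp => ⟨hp.1, hp.2.1.le, hp.2.2.le⟩

lemma cylinder_mono {r' : ℝ} (h : r ≤ r') : cylinder e y₀ r ⊆ cylinder e y₀ r' :=
  fun _ hp => ⟨hp.1, hp.2.1.trans_le h, hp.2.2.trans_le h⟩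

lemma isOpen_cylinder : IsOpen (cylinder e y₀ r) := by
  have h : IsOpen {z : EuclideanSpace ℝ (Fin (n + 1)) | z 0 < r ∧ ‖tail z - y₀‖ < r} :=
    (isOpen_lt (headL n).continuous continuous_const).inter
      (isOpen_lt ((tailL n).continuous.sub continuous_const).norm continuous_const)
  exact e.isOpen_extend_preimage (I := 𝓡∂ (n + 1)) h

lemma cylinder_mem_nhds {q : X} (hq : q ∈ e.source) (hr : 0 < r)
    (hq0 : e.extend (𝓡∂ (n + 1)) q 0 = 0) :
    cylinder e (tail (e.extend (𝓡∂ (n + 1)) q)) r ∈ 𝓝 q :=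
  isOpen_cylinder.mem_nhds ⟨hq, by rwa [hq0], by simpa⟩

lemma exists_cylinder_subset {q : X} (hq : q ∈ e.source)
    (hq0 : e.extend (𝓡∂ (n + 1)) q 0 = 0) {V : Set X} (hV : V ∈ 𝓝 q) :
    ∃ r > 0, cylinder e (tail (e.extend (𝓡∂ (n + 1)) q)) r ⊆ V := by
  have hc := e.continuousAt_extend_symm (I := 𝓡∂ (n + 1)) hq
  have hV' : (e.extend (𝓡∂ (n + 1))).symm ⁻¹' V ∈ 𝓝 (e.extend (𝓡∂ (n + 1)) q) :=
    hc.preimage_mem_nhds (by rwa [e.extend_left_inv hq])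
  obtain ⟨ε, hε, hball⟩ := Metric.mem_nhds_iff.1 hV'
  refine ⟨ε / 2, by positivity, fun p hp => ?_⟩
  obtain ⟨hps, hp0, hpt⟩ := hp
  have hx := head_nonneg_of_mem_target (extend_mem_target hps)
  have hmem : e.extend (𝓡∂ (n + 1)) p ∈ Metric.ball (e.extend (𝓡∂ (n + 1)) q) ε := by
    rw [Metric.mem_ball, dist_eq_norm]
    refine lt_of_pow_lt_pow_left₀ 2 hε.le ?_
    have h1 : (e.extend (𝓡∂ (n + 1)) p - e.extend (𝓡∂ (n + 1)) q) 0 =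
        e.extend (𝓡∂ (n + 1)) p 0 := by
      rw [PiLp.sub_apply, hq0, sub_zero]
    have h2 : tail (e.extend (𝓡∂ (n + 1)) p - e.extend (𝓡∂ (n + 1)) q) =
      tail (e.extend (𝓡∂ (n + 1)) p) - tail (e.extend (𝓡∂ (n + 1)) q) := rfl
    rw [norm_sq_eq_head_tail, h1, h2]
    nlinarith [norm_nonneg (tail (e.extend (𝓡∂ (n + 1)) p) - tail (e.extend (𝓡∂ (n + 1)) q))]
  have := hball hmem
  rwa [mem_preimage, e.extend_left_inv hps] at this

/-- A closed cylinder whose coordinates stay in the range of the chart is compact, hence closed in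
`X`. -/
lemma isClosed_closedCylinder [T2Space X]
    (h : ∀ z : EuclideanSpace ℝ (Fin (n + 1)), 0 ≤ z 0 → z 0 ≤ r → ‖tail z - y₀‖ ≤ r →
      z ∈ (e.extend (𝓡∂ (n + 1))).target) :
    IsClosed (closedCylinder e y₀ r) := by
  set K : Set (EuclideanSpace ℝ (Fin (n + 1))) := ptL n '' (Icc 0 r ×ˢ Metric.closedBall y₀ r)
  have hK : IsCompact K :=
    (isCompact_Icc.prod (isCompact_closedBall y₀ r)).image (ptL n).continuous
  have hKt : K ⊆ (e.extend (𝓡∂ (n + 1))).target := by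
    rintro _ ⟨⟨x, y⟩, ⟨hx, hy⟩, rfl⟩
    exact h _ hx.1 hx.2 (by simpa [dist_eq_norm] using hy)
  have heq : closedCylinder e y₀ r = (e.extend (𝓡∂ (n + 1))).symm '' K := by
    ext p
    constructor
    · rintro ⟨hps, hp0, hpt⟩
      refine ⟨e.extend (𝓡∂ (n + 1)) p, ⟨(e.extend (𝓡∂ (n + 1)) p 0,
        tail (e.extend (𝓡∂ (n + 1)) p)), ⟨⟨?_, hp0⟩, ?_⟩, pt_tail _⟩, e.extend_left_inv hps⟩
      · exact head_nonneg_of_mem_target (extend_mem_target hps)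
      · simpa [dist_eq_norm] using hpt
    · rintro ⟨z, hz, rfl⟩
      have hzt := hKt hz
      have hr := (e.extend (𝓡∂ (n + 1))).right_inv hzt
      obtain ⟨⟨x, y⟩, ⟨hx, hy⟩, rfl⟩ := hz
      refine ⟨extend_symm_mem_source hzt, ?_, ?_⟩
      · rw [hr]; exact hx.2
      · rw [hr]; simpa [dist_eq_norm] using hy
  rw [heq]
  exact (hK.image_of_continuousOn (e.continuousOn_extend_symm.mono hKt)).isClosed

variable [ChartedSpace (EuclideanHalfSpace (n + 1)) X] [IsManifold (𝓡∂ (n + 1)) ∞ X]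

/-- The chart `e = (x, y)` around the boundary point `q` contains all `(x, y)` with `0 ≤ x ≤ δ` and
`|y - y(q)| ≤ δ`, and `(dx² + κ² |dy|²) / x² ≤ g ≤ (dx² + κ⁻² |dy|²) / x²` there. -/
structure IsCollarChart (g : InteriorMetric n X)
    (e : OpenPartialHomeomorph X (EuclideanHalfSpace (n + 1))) (q : X) (κ δ : ℝ) : Prop where
  mem_maximalAtlas : e ∈ IsManifold.maximalAtlas (𝓡∂ (n + 1)) ∞ X
  mem_source : q ∈ e.source
  head_eq_zero : e.extend (𝓡∂ (n + 1)) q 0 = 0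
  κ_pos : 0 < κ
  δ_pos : 0 < δ
  mem_target : ∀ z : EuclideanSpace ℝ (Fin (n + 1)), 0 ≤ z 0 → z 0 ≤ δ →
    ‖tail z - tail (e.extend (𝓡∂ (n + 1)) q)‖ ≤ δ → z ∈ (e.extend (𝓡∂ (n + 1))).target
  metric_bounds : ∀ p : Interior n X,
    (p : X) ∈ closedCylinder e (tail (e.extend (𝓡∂ (n + 1)) q)) δ →
    ∀ v : TangentSpace (𝓡∂ (n + 1)) p,
      (differential (coord e) p v 0 ^ 2 + κ ^ 2 * ‖tail (differential (coord e) p v)‖ ^ 2) /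
          coord e p 0 ^ 2 ≤ g.inner p v v ∧
      g.inner p v v ≤ (differential (coord e) p v 0 ^ 2 +
        (‖tail (differential (coord e) p v)‖ / κ) ^ 2) / coord e p 0 ^ 2

lemma IsCollarChart.mono {g : InteriorMetric n X} {q : X} {κ δ δ' : ℝ}
    (h : IsCollarChart g e q κ δ) (h0 : 0 < δ') (hδ : δ' ≤ δ) : IsCollarChart g e q κ δ' where
  __ := h
  δ_pos := h0
  mem_target z h1 h2 h3 := h.mem_target z h1 (h2.trans hδ) (h3.trans hδ)
  metric_bounds p hp v := h.metric_bounds p ⟨hp.1, hp.2.1.trans hδ, hp.2.2.trans hδ⟩ v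

/-- The coordinates in the definition of an asymptotically hyperbolic metric form a collar chart, as
`(hᵢⱼ)` is continuous and positive definite up to the boundary. -/
lemma exists_isCollarChart {g : InteriorMetric n X} (hg : IsAsymptoticallyHyperbolic g) {q : X}
    (hq : q ∈ (𝓡∂ (n + 1)).boundary X) : ∃ e κ δ, IsCollarChart g e q κ δ := by
  obtain ⟨e, he, hqe, h, hh, hpos, hgh⟩ := hg q hq
  set u₀ := e.extend (𝓡∂ (n + 1)) q with hu₀
  have hq0 : u₀ 0 = 0 := (mem_boundary_iff_head_eq_zero he hqe).1 hq
  have hu₀t : u₀ ∈ (e.extend (𝓡∂ (n + 1))).target := extend_mem_target hqe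
  obtain ⟨κ, hκ, hκb⟩ := eventually_dotProduct_mulVec_bounds
    (fun i j => (hh i j).continuousOn u₀ hu₀t) (hpos u₀ hu₀t)
  have hev : ∀ᶠ z in 𝓝[range (𝓡∂ (n + 1))] u₀, z ∈ (e.extend (𝓡∂ (n + 1))).target ∧
      ∀ η : EuclideanSpace ℝ (Fin n),
      κ ^ 2 * ‖η‖ ^ 2 ≤ (fun i => η i) ⬝ᵥ (h z *ᵥ fun i => η i) ∧
        (fun i => η i) ⬝ᵥ (h z *ᵥ fun i => η i) ≤ (‖η‖ / κ) ^ 2 := by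
    rw [e.nhdsWithin_extend_target_eq hqe] at hκb
    exact Filter.Eventually.and (e.extend_target_mem_nhdsWithin hqe) hκb
  rw [range_halfSpace_model] at hev
  obtain ⟨ε, hε, hball⟩ := Metric.mem_nhdsWithin_iff.1 hev
  have hcyl : ∀ z : EuclideanSpace ℝ (Fin (n + 1)), 0 ≤ z 0 → z 0 ≤ ε / 2 →
      ‖tail z - tail u₀‖ ≤ ε / 2 → z ∈ Metric.ball u₀ ε ∩ {z | 0 ≤ z 0} := by
    intro z h0 h1 h2
    refine ⟨?_, h0⟩
    rw [Metric.mem_ball, dist_eq_norm]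
    refine lt_of_pow_lt_pow_left₀ 2 hε.le ?_
    have h3 : (z - u₀) 0 = z 0 := by rw [PiLp.sub_apply, hq0, sub_zero]
    have h4 : tail (z - u₀) = tail z - tail u₀ := rfl
    rw [norm_sq_eq_head_tail, h3, h4]
    nlinarith [norm_nonneg (tail z - tail u₀)]
  refine ⟨e, κ, ε / 2, he, hqe, hq0, hκ, by positivity,
    fun z h0 h1 h2 => (hball (hcyl z h0 h1 h2)).1, fun p hp v => ?_⟩
  have hx := coord_pos he hp.1
  have hb := (hball (hcyl (coord e p) hx.le hp.2.1 hp.2.2)).2 (tail (differential (coord e) p v))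
  have hgp : g.inner p v v = (differential (coord e) p v 0 ^ 2 +
      (fun i => tail (differential (coord e) p v) i) ⬝ᵥ
        (h (coord e p) *ᵥ fun i => tail (differential (coord e) p v) i)) / coord e p 0 ^ 2 :=
    hgh p hp.1 v
  rw [hgp]
  constructor
  · gcongr; exact hb.1
  · gcongr; exact hb.2

end Collar

/-! ### Distance estimates in a collar chart -/

section CollarEstimates

variable {n : ℕ} {X : Type*} [TopologicalSpace X] [ChartedSpace (EuclideanHalfSpace (n + 1)) X]
  [IsManifold (𝓡∂ (n + 1)) ∞ X] {g : InteriorMetric n X}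
  {e : OpenPartialHomeomorph X (EuclideanHalfSpace (n + 1))} {q : X} {κ δ : ℝ}

lemma length_comp_neg (g : InteriorMetric n X) {γ : ℝ → Interior n X} {a b : ℝ} (hab : a ≤ b)
    (hγ : ContMDiffOn 𝓘(ℝ, ℝ) (𝓡∂ (n + 1)) 1 γ (Icc a b)) :
    length g (fun t => γ (-t)) (-b) (-a) = length g γ a b := by
  let _ : RiemannianBundle (fun p : Interior n X => TangentSpace (𝓡∂ (n + 1)) p) :=
    ⟨g.toRiemannianMetric⟩
  have h := Manifold.pathELength_comp_of_antitoneOn (I := 𝓡∂ (n + 1)) (γ := γ) (a := -b) (b := -a)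
    (f := fun t => -t) (by linarith) (fun s _ t _ hst => by simpa using hst)
    differentiable_neg.differentiableOn
    (by simpa using hγ.mdifferentiableOn one_ne_zero)
  simp only [neg_neg] at h
  exact h

lemma differential_comp {φ : EuclideanSpace ℝ (Fin (n + 1)) → ℝ}
    (he : e ∈ IsManifold.maximalAtlas (𝓡∂ (n + 1)) ∞ X) {p : Interior n X}
    (hp : (p : X) ∈ e.source) (hφ : DifferentiableAt ℝ φ (coord e p))
    (v : TangentSpace (𝓡∂ (n + 1)) p) :
    differential (fun p => φ (coord e p)) p v =
      fderiv ℝ φ (coord e p) (differential (coord e) p v) := by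
  have h := mfderiv_comp (I := 𝓡∂ (n + 1)) (I' := 𝓘(ℝ, EuclideanSpace ℝ (Fin (n + 1))))
    (I'' := 𝓘(ℝ, ℝ)) p hφ.mdifferentiableAt
    ((contMDiffAt_coord he hp).mdifferentiableAt (by simp))
  rw [mfderiv_eq_fderiv] at h
  exact congrArg (fun A => A v) h

/-- The Busemann functions of the model vary along a path in a collar at most by its length. -/
lemma IsCollarChart.enorm_busemann_sub_le_length (h : IsCollarChart g e q κ δ)
    (η : EuclideanSpace ℝ (Fin n)) {γ : ℝ → Interior n X} {a b : ℝ} (hab : a ≤ b)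
    (hγ : ContMDiffOn 𝓘(ℝ, ℝ) (𝓡∂ (n + 1)) 1 γ (Icc a b))
    (hmem : ∀ t ∈ Icc a b,
      (γ t : X) ∈ closedCylinder e (tail (e.extend (𝓡∂ (n + 1)) q)) δ) :
    ‖busemann κ η (coord e (γ b)) - busemann κ η (coord e (γ a))‖ₑ ≤ length g γ a b := by
  have hb : ∀ t ∈ Icc a b, ContDiffAt ℝ ∞ (busemann κ η) (coord e (γ t)) := fun t ht =>
    contDiffAt_busemann (coord_pos h.mem_maximalAtlas (hmem t ht).1)
  refine enorm_sub_le_length g (f := fun p => busemann κ η (coord e p)) hab hγ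
    (fun t ht => ?_) (fun t ht v => ?_)
  · exact ((hb t ht).contMDiffAt.comp (γ t)
      (contMDiffAt_coord h.mem_maximalAtlas (hmem t ht).1)).of_le (by simp)
  · rw [differential_comp h.mem_maximalAtlas (hmem t ht).1 ((hb t ht).differentiableAt (by simp))]
    refine (abs_fderiv_busemann_le (coord_pos h.mem_maximalAtlas (hmem t ht).1) _).trans ?_
    exact Real.sqrt_le_sqrt (h.metric_bounds _ (hmem t ht) v).1

lemma busemann_self (z : EuclideanSpace ℝ (Fin (n + 1))) :
    busemann κ (tail z) z = Real.log (z 0) := by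
  simp only [busemann, sub_self, norm_zero]
  rw [zero_pow two_ne_zero, mul_zero, add_zero, Real.log_pow]
  push_cast; ring

/-- A path leaving the collar is long: on the part of the path before it leaves, the Busemann
function of its starting point grows from `log x` to a value bounded from below. -/
lemma IsCollarChart.le_length_of_notMem [T2Space X] (h : IsCollarChart g e q κ δ)
    {γ : ℝ → Interior n X} {a b : ℝ} (hab : a ≤ b)
    (hγ : ContMDiffOn 𝓘(ℝ, ℝ) (𝓡∂ (n + 1)) 1 γ (Icc a b))
    (ha : (γ a : X) ∈ cylinder e (tail (e.extend (𝓡∂ (n + 1)) q)) (δ / 2))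
    (hb : (γ b : X) ∉ cylinder e (tail (e.extend (𝓡∂ (n + 1)) q)) δ) :
    ENNReal.ofReal (Real.log (min δ (κ ^ 2 * δ / 4)) - Real.log (coord e (γ a) 0)) ≤
      length g γ a b := by
  have hκ := h.κ_pos
  have hδ := h.δ_pos
  set y₀ := tail (e.extend (𝓡∂ (n + 1)) q)
  have hcont : ContinuousOn (fun t => (γ t : X)) (Icc a b) :=
    continuous_subtype_val.comp_continuousOn hγ.continuousOn
  have hcl : IsCompact {t ∈ Icc a b | (γ t : X) ∉ cylinder e y₀ δ} :=
    isCompact_Icc.of_isClosed_subset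
      (hcont.preimage_isClosed_of_isClosed isClosed_Icc isOpen_cylinder.isClosed_compl)
      (fun t ht => ht.1)
  obtain ⟨T, ⟨hT, hTnot⟩, hTmin⟩ := hcl.exists_isLeast ⟨b, ⟨hab, le_rfl⟩, hb⟩
  have hbefore : ∀ s ∈ Ico a T, (γ s : X) ∈ cylinder e y₀ δ := by
    intro s hs
    by_contra hns
    exact absurd (hTmin ⟨⟨hs.1, hs.2.le.trans hT.2⟩, hns⟩) (not_le.2 hs.2)
  have haT : a < T := by
    rcases hT.1.eq_or_lt with heq | hlt
    · exact absurd (cylinder_mono (by linarith) (heq ▸ ha)) hTnot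
    · exact hlt
  have hTmem : (γ T : X) ∈ closedCylinder e y₀ δ := by
    refine (isClosed_closedCylinder h.mem_target).mem_of_frequently_of_tendsto
      (f := fun t => (γ t : X)) (b := 𝓝[Ico a T] T) ?_ ?_
    · have : (𝓝[Ico a T] T).NeBot := by
        rw [← mem_closure_iff_nhdsWithin_neBot, closure_Ico haT.ne]
        exact ⟨haT.le, le_rfl⟩
      refine Filter.Eventually.frequently ?_
      filter_upwards [self_mem_nhdsWithin] with s hs
      exact cylinder_subset_closedCylinder (hbefore s hs)
    · exact ((hcont T hT).mono (fun s hs => ⟨hs.1, hs.2.le.trans hT.2⟩)).tendsto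
  have hmem : ∀ t ∈ Icc a T, (γ t : X) ∈ closedCylinder e y₀ δ := by
    intro t ht
    rcases ht.2.eq_or_lt with rfl | hlt
    · exact hTmem
    · exact cylinder_subset_closedCylinder (hbefore t ⟨ht.1, hlt⟩)
  have hlen := h.enorm_busemann_sub_le_length (tail (coord e (γ a))) hT.1
    (hγ.mono (Icc_subset_Icc_right hT.2)) hmem
  have hxa := coord_pos h.mem_maximalAtlas ha.1
  have hxT := coord_pos h.mem_maximalAtlas hTmem.1
  rw [busemann_self] at hlen
  refine le_trans ?_ (hlen.trans (length_mono g γ le_rfl hT.2))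
  rw [Real.enorm_eq_ofReal_abs]
  refine ENNReal.ofReal_le_ofReal (le_trans ?_ (le_abs_self _))
  have hc : 0 < min δ (κ ^ 2 * δ / 4) := lt_min hδ (by positivity)
  refine sub_le_sub_right ?_ _
  rw [busemann, ← Real.log_div (by positivity) hxT.ne']
  refine Real.log_le_log hc ?_
  rw [le_div_iff₀ hxT]
  have hx1 : coord e (γ T) 0 ≤ δ := hTmem.2.1
  by_cases hcase : coord e (γ T) 0 < δ
  · -- the path leaves the collar through its lateral boundary
    have hlat : δ ≤ ‖tail (coord e (γ T)) - y₀‖ := by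
      by_contra! hlt
      exact hTnot ⟨hTmem.1, hcase, hlt⟩
    have hhalf : ‖tail (coord e (γ a)) - y₀‖ < δ / 2 := ha.2.2
    have h2 : δ / 2 ≤ ‖tail (coord e (γ T)) - tail (coord e (γ a))‖ := by
      have := norm_sub_norm_le (tail (coord e (γ T)) - y₀) (tail (coord e (γ a)) - y₀)
      rw [sub_sub_sub_cancel_right] at this
      linarith
    calc min δ (κ ^ 2 * δ / 4) * coord e (γ T) 0 ≤ κ ^ 2 * δ / 4 * δ := by
          gcongr; exact min_le_right _ _
      _ = κ ^ 2 * (δ / 2) ^ 2 := by ring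
      _ ≤ κ ^ 2 * ‖tail (coord e (γ T)) - tail (coord e (γ a))‖ ^ 2 := by gcongr
      _ ≤ _ := le_add_of_nonneg_left (sq_nonneg _)
  · have heq : coord e (γ T) 0 = δ := le_antisymm hx1 (not_lt.1 hcase)
    have := min_le_left δ (κ ^ 2 * δ / 4)
    rw [heq]
    nlinarith [mul_nonneg (sq_nonneg κ)
      (sq_nonneg ‖tail (coord e (γ T)) - tail (coord e (γ a))‖)]

/-- The reversed form of `IsCollarChart.le_length_of_notMem`, for paths entering the collar. -/
lemma IsCollarChart.le_length_of_notMem' [T2Space X] (h : IsCollarChart g e q κ δ)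
    {γ : ℝ → Interior n X} {a b : ℝ} (hab : a ≤ b)
    (hγ : ContMDiffOn 𝓘(ℝ, ℝ) (𝓡∂ (n + 1)) 1 γ (Icc a b))
    (ha : (γ a : X) ∉ cylinder e (tail (e.extend (𝓡∂ (n + 1)) q)) δ)
    (hb : (γ b : X) ∈ cylinder e (tail (e.extend (𝓡∂ (n + 1)) q)) (δ / 2)) :
    ENNReal.ofReal (Real.log (min δ (κ ^ 2 * δ / 4)) - Real.log (coord e (γ b) 0)) ≤
      length g γ a b := by
  rw [← length_comp_neg g hab hγ]
  have hγ' : ContMDiffOn 𝓘(ℝ, ℝ) (𝓡∂ (n + 1)) 1 (fun t => γ (-t)) (Icc (-b) (-a)) :=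
    hγ.comp contDiff_neg.contMDiff.contMDiffOn
      fun t ht => ⟨by linarith [ht.2], by linarith [ht.1]⟩
  have := h.le_length_of_notMem (γ := fun t => γ (-t)) (neg_le_neg hab) hγ'
    (by simpa using hb) (by simpa using ha)
  simpa using this

lemma norm_add_smul_sub_sub_le {F : Type*} [NormedAddCommGroup F] [NormedSpace ℝ F] {y y' c : F}
    {r t : ℝ} (hy : ‖y - c‖ ≤ r) (hy' : ‖y' - c‖ ≤ r) (ht : t ∈ Icc (0 : ℝ) 1) :
    ‖y + t • (y' - y) - c‖ ≤ r := by
  have := (convex_closedBall c r).add_smul_sub_mem (x := y) (y := y')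
    (by simpa [dist_eq_norm] using hy) (by simpa [dist_eq_norm] using hy') ht
  simpa [dist_eq_norm] using this

/-- The vertical curve `t ↦ (x exp (t l), y)` has constant speed `l = log (x' / x)`. -/
lemma IsCollarChart.dist_le_vertical (h : IsCollarChart g e q κ δ) {z z' : Interior n X}
    (hz : (z : X) ∈ closedCylinder e (tail (e.extend (𝓡∂ (n + 1)) q)) δ)
    (hz' : (z' : X) ∈ closedCylinder e (tail (e.extend (𝓡∂ (n + 1)) q)) δ)
    (hle : coord e z 0 ≤ coord e z' 0) (htail : tail (coord e z) = tail (coord e z')) :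
    riemannianDist g z z' ≤
      ENNReal.ofReal (Real.log (coord e z' 0) - Real.log (coord e z 0)) := by
  have hx := coord_pos h.mem_maximalAtlas hz.1
  have hM := coord_pos h.mem_maximalAtlas hz'.1
  set x := coord e z 0 with hxdef
  set M := coord e z' 0 with hMdef
  set y := tail (coord e z) with hydef
  set l := Real.log M - Real.log x with hl
  have hl0 : 0 ≤ l := sub_nonneg.2 (Real.log_le_log hx hle)
  have hexp : x * Real.exp l = M := by
    rw [hl, Real.exp_sub, Real.exp_log hx, Real.exp_log hM]; field_simp
  set u : ℝ → EuclideanSpace ℝ (Fin (n + 1)) := fun t => ptL n (x * Real.exp (t * l), y) with hu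
  have hub : ∀ t ∈ Icc (0 : ℝ) 1, x * Real.exp (t * l) ≤ M := by
    intro t ht
    rw [← hexp]
    gcongr
    nlinarith [ht.2]
  have hut : ∀ t ∈ Icc (0 : ℝ) 1, u t ∈ (e.extend (𝓡∂ (n + 1))).target := by
    intro t ht
    refine h.mem_target _ ?_ ?_ ?_
    · change 0 ≤ x * Real.exp (t * l); positivity
    · exact (hub t ht).trans hz'.2.1
    · exact hz.2.2
  refine riemannianDist_le_of_curve g h.mem_maximalAtlas (u := u) ?_ hut ?_ hz.1 hz'.1 ?_ ?_ ?_
  · exact (ptL n).contDiff.comp ((contDiff_const.mul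
      (Real.contDiff_exp.comp (contDiff_id.mul contDiff_const))).prodMk contDiff_const)
  · intro t _
    change 0 < x * Real.exp (t * l); positivity
  · simp only [hu, ptL_apply, zero_mul, Real.exp_zero, mul_one]
    exact (pt_tail _).symm
  · simp only [hu, ptL_apply, one_mul, hexp, htail]
    exact (pt_tail _).symm
  · intro t ht p hp hpu v hv
    have hpx : coord e p 0 = x * Real.exp (t * l) := by rw [hpu]; rfl
    have hd : deriv u t = pt (x * (Real.exp (t * l) * l)) 0 := by
      have h1 : HasDerivAt (fun t : ℝ => (x * Real.exp (t * l), y))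
          (x * (Real.exp (t * l) * l), (0 : EuclideanSpace ℝ (Fin n))) t := by
        refine HasDerivAt.prodMk ?_ (hasDerivAt_const _ _)
        simpa using (((hasDerivAt_id t).mul_const l).exp).const_mul x
      exact ((ptL n).hasFDerivAt.comp_hasDerivAt t h1).deriv
    have hpm : (p : X) ∈ closedCylinder e (tail (e.extend (𝓡∂ (n + 1)) q)) δ := by
      refine ⟨hp, ?_, ?_⟩
      · exact hpx.le.trans ((hub t ht).trans hz'.2.1)
      · rw [show e.extend (𝓡∂ (n + 1)) p = u t from hpu]; exact hz.2.2
    have hb := (h.metric_bounds p hpm v).2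
    rw [hv, hd, hpx] at hb
    refine Real.sqrt_le_iff.2 ⟨hl0, hb.trans ?_⟩
    simp only [pt_zero, tail_pt, norm_zero, zero_div]
    rw [zero_pow two_ne_zero, add_zero, div_le_iff₀ (by positivity)]
    exact le_of_eq (by ring)

/-- A horizontal segment at height `M`, of Euclidean length at most `M`, has bounded length. -/
lemma IsCollarChart.dist_le_horizontal (h : IsCollarChart g e q κ δ) {z z' : Interior n X}
    (hz : (z : X) ∈ closedCylinder e (tail (e.extend (𝓡∂ (n + 1)) q)) δ)
    (hz' : (z' : X) ∈ closedCylinder e (tail (e.extend (𝓡∂ (n + 1)) q)) δ)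
    (heq : coord e z 0 = coord e z' 0)
    (hle : ‖tail (coord e z') - tail (coord e z)‖ ≤ coord e z 0) :
    riemannianDist g z z' ≤ ENNReal.ofReal (1 / κ) := by
  have hκ := h.κ_pos
  have hM := coord_pos h.mem_maximalAtlas hz.1
  set M := coord e z 0 with hMdef
  set y := tail (coord e z) with hydef
  set y' := tail (coord e z') with hydef'
  set u : ℝ → EuclideanSpace ℝ (Fin (n + 1)) := fun t => ptL n (M, y + t • (y' - y)) with hu
  refine riemannianDist_le_of_curve g h.mem_maximalAtlas (u := u) ?_ ?_ ?_ hz.1 hz'.1 ?_ ?_ ?_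
  · exact (ptL n).contDiff.comp (contDiff_const.prodMk
      (contDiff_const.add (contDiff_id.smul contDiff_const)))
  · intro t ht
    exact h.mem_target _ hM.le hz.2.1 (norm_add_smul_sub_sub_le hz.2.2 hz'.2.2 ht)
  · intro t _
    exact hM
  · simp only [hu, ptL_apply, zero_smul, add_zero]
    exact (pt_tail _).symm
  · simp only [hu, ptL_apply, one_smul, add_sub_cancel, heq]
    exact (pt_tail _).symm
  · intro t ht p hp hpu v hv
    have hd : deriv u t = pt 0 (y' - y) := by
      have h1 : HasDerivAt (fun t : ℝ => (M, y + t • (y' - y))) ((0 : ℝ), y' - y) t := by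
        refine HasDerivAt.prodMk (hasDerivAt_const _ _) ?_
        simpa using ((hasDerivAt_id t).smul_const (y' - y)).const_add y
      exact ((ptL n).hasFDerivAt.comp_hasDerivAt t h1).deriv
    have hpx : coord e p 0 = M := by rw [hpu]; rfl
    have hpm : (p : X) ∈ closedCylinder e (tail (e.extend (𝓡∂ (n + 1)) q)) δ := by
      refine ⟨hp, hpx.le.trans hz.2.1, ?_⟩
      rw [show e.extend (𝓡∂ (n + 1)) p = u t from hpu]
      exact norm_add_smul_sub_sub_le hz.2.2 hz'.2.2 ht
    have hb := (h.metric_bounds p hpm v).2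
    rw [hv, hd, hpx] at hb
    refine Real.sqrt_le_iff.2 ⟨by positivity, hb.trans ?_⟩
    simp only [pt_zero, tail_pt]
    rw [zero_pow two_ne_zero, zero_add, ← div_pow]
    have : ‖y' - y‖ / κ / M ≤ 1 / κ := by
      rw [div_div, div_le_div_iff₀ (by positivity) hκ]
      nlinarith
    gcongr

/-- Climbing vertically to the height `M` and then moving horizontally by at most `M`. -/
lemma IsCollarChart.dist_le (h : IsCollarChart g e q κ δ) {z z' : Interior n X}
    (hz : (z : X) ∈ closedCylinder e (tail (e.extend (𝓡∂ (n + 1)) q)) δ)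
    (hz' : (z' : X) ∈ closedCylinder e (tail (e.extend (𝓡∂ (n + 1)) q)) δ)
    (hle : coord e z 0 ≤ coord e z' 0)
    (htail : ‖tail (coord e z') - tail (coord e z)‖ ≤ coord e z' 0) :
    riemannianDist g z z' ≤
      ENNReal.ofReal (Real.log (coord e z' 0) - Real.log (coord e z 0) + 1 / κ) := by
  have hκ := h.κ_pos
  have hx := coord_pos h.mem_maximalAtlas hz.1
  have hM := coord_pos h.mem_maximalAtlas hz'.1
  obtain ⟨m, hm, hmu⟩ := exists_coord_eq h.mem_maximalAtlas
    (u := pt (coord e z' 0) (tail (coord e z))) (h.mem_target _ hM.le hz'.2.1 hz.2.2) hM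
  have hmm : (m : X) ∈ closedCylinder e (tail (e.extend (𝓡∂ (n + 1)) q)) δ := by
    refine ⟨hm, ?_, ?_⟩
    · rw [show e.extend (𝓡∂ (n + 1)) m = _ from hmu]; exact hz'.2.1
    · rw [show e.extend (𝓡∂ (n + 1)) m = _ from hmu]; exact hz.2.2
  have h1 := h.dist_le_vertical hz hmm (by rw [hmu]; exact hle) (by rw [hmu]; rfl)
  have h2 := h.dist_le_horizontal hmm hz' (by rw [hmu]; rfl) (by rw [hmu]; exact htail)
  rw [hmu, pt_zero] at h1
  refine (riemannianDist_triangle g z m z').trans ((add_le_add h1 h2).trans ?_)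
  rw [ENNReal.ofReal_add (sub_nonneg.2 (Real.log_le_log hx hle)) (by positivity)]

/-- Near a point `(q, q)` of the boundary of the diagonal, the distance is at least
`log ((x² + x'² + |y - y'|²) / (x x'))`, up to a bounded error. A path staying in the collar is
measured by the Busemann function of one of its end points, and a path leaving it is at least as
long as two paths from the end points to the boundary of the collar. -/
lemma IsCollarChart.exists_le_dist [T2Space X] (h : IsCollarChart g e q κ δ) :
    ∃ C : ℝ, ∀ z z' : Interior n X,
      (z : X) ∈ cylinder e (tail (e.extend (𝓡∂ (n + 1)) q)) (δ / 2) →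
      (z' : X) ∈ cylinder e (tail (e.extend (𝓡∂ (n + 1)) q)) (δ / 2) →
      ENNReal.ofReal (Real.log (coord e z 0 ^ 2 + coord e z' 0 ^ 2 +
          ‖tail (coord e z') - tail (coord e z)‖ ^ 2) - Real.log (coord e z 0)
          - Real.log (coord e z' 0) - C) ≤ riemannianDist g z z' := by
  have hκ := h.κ_pos
  have hδ := h.δ_pos
  set y₀ := tail (e.extend (𝓡∂ (n + 1)) q) with hy₀
  set k : ℝ := min 1 (κ ^ 2) / 2 with hk
  have hk0 : 0 < k := by positivity
  set c : ℝ := min δ (κ ^ 2 * δ / 4) with hc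
  -- the first constant serves for paths staying in the collar, the second for the others
  refine ⟨max (-Real.log k) (Real.log (2 * δ ^ 2) - 2 * Real.log c), fun z z' hz hz' => ?_⟩
  have hx := coord_pos h.mem_maximalAtlas hz.1
  have hx' := coord_pos h.mem_maximalAtlas hz'.1
  have hxδ : coord e z 0 < δ / 2 := hz.2.1
  have hxδ' : coord e z' 0 < δ / 2 := hz'.2.1
  have hD : ‖tail (coord e z') - tail (coord e z)‖ < δ := by
    have h1 : ‖tail (coord e z) - y₀‖ < δ / 2 := hz.2.2
    have h2 : ‖tail (coord e z') - y₀‖ < δ / 2 := hz'.2.2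
    have := norm_sub_le (tail (coord e z') - y₀) (tail (coord e z) - y₀)
    rw [sub_sub_sub_cancel_right] at this
    linarith
  refine le_riemannianDist g fun γ hγ h0 h1 => ?_
  by_cases hstay : ∀ t ∈ Icc (0 : ℝ) 1, (γ t : X) ∈ cylinder e y₀ δ
  · have hstay' := fun t ht => cylinder_subset_closedCylinder (hstay t ht)
    have b1 := h.enorm_busemann_sub_le_length (tail (coord e z)) zero_le_one hγ hstay'
    have b2 := h.enorm_busemann_sub_le_length (tail (coord e z')) zero_le_one hγ hstay'
    rw [h0, h1, busemann_self, Real.enorm_eq_ofReal_abs] at b1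
    rw [h0, h1, busemann_self, Real.enorm_eq_ofReal_abs, abs_sub_comm] at b2
    rw [busemann] at b1 b2
    rw [norm_sub_rev] at b2
    set x := coord e z 0
    set x' := coord e z' 0
    set D := ‖tail (coord e z') - tail (coord e z)‖
    have hmax := le_max_left (-Real.log k) (Real.log (2 * δ ^ 2) - 2 * Real.log c)
    have hkR : 0 < k * (x ^ 2 + x' ^ 2 + D ^ 2) := by positivity
    have hlogk : Real.log (k * (x ^ 2 + x' ^ 2 + D ^ 2)) =
        Real.log k + Real.log (x ^ 2 + x' ^ 2 + D ^ 2) :=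
      Real.log_mul hk0.ne' (by positivity)
    have hkR' : 2 * (k * (x ^ 2 + x' ^ 2 + D ^ 2)) ≤
        (x ^ 2 + κ ^ 2 * D ^ 2) + (x' ^ 2 + κ ^ 2 * D ^ 2) := by
      have e1 : 2 * k ≤ 1 := by rw [hk]; linarith [min_le_left 1 (κ ^ 2)]
      have e2 : 2 * k ≤ κ ^ 2 := by rw [hk]; linarith [min_le_right 1 (κ ^ 2)]
      nlinarith [mul_le_mul_of_nonneg_right e1 (sq_nonneg x),
        mul_le_mul_of_nonneg_right e1 (sq_nonneg x'),
        mul_le_mul_of_nonneg_right e2 (sq_nonneg D), mul_nonneg (sq_nonneg κ) (sq_nonneg D)]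
    rcases le_total (x ^ 2 + κ ^ 2 * D ^ 2) (x' ^ 2 + κ ^ 2 * D ^ 2) with hcase | hcase
    · refine le_trans (ENNReal.ofReal_le_ofReal (le_trans ?_ (le_abs_self _))) b1
      have := Real.log_le_log hkR (show _ ≤ x' ^ 2 + κ ^ 2 * D ^ 2 by linarith)
      linarith
    · refine le_trans (ENNReal.ofReal_le_ofReal (le_trans ?_ (le_abs_self _))) b2
      have := Real.log_le_log hkR (show _ ≤ x ^ 2 + κ ^ 2 * D ^ 2 by linarith)
      linarith
  · push Not at hstay
    obtain ⟨t, ht, htn⟩ := hstay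
    have b1 := h.le_length_of_notMem ht.1 (hγ.mono (Icc_subset_Icc_right ht.2))
      (by rw [h0]; exact hz) htn
    have b2 := h.le_length_of_notMem' ht.2 (hγ.mono (Icc_subset_Icc_left ht.1)) htn
      (by rw [h1]; exact hz')
    rw [h0] at b1
    rw [h1] at b2
    rw [← length_add g γ ht.1 ht.2]
    refine le_trans ?_ (add_le_add b1 b2)
    refine le_trans (ENNReal.ofReal_le_ofReal ?_) ENNReal.ofReal_add_le
    have hD0 := norm_nonneg (tail (coord e z') - tail (coord e z))
    set x := coord e z 0
    set x' := coord e z' 0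
    set D := ‖tail (coord e z') - tail (coord e z)‖
    have hmax := le_max_right (-Real.log k) (Real.log (2 * δ ^ 2) - 2 * Real.log c)
    have hR : x ^ 2 + x' ^ 2 + D ^ 2 ≤ 2 * δ ^ 2 := by nlinarith
    have := Real.log_le_log (by positivity : 0 < x ^ 2 + x' ^ 2 + D ^ 2) hR
    linarith

/-- Near a point `(q, q)` of the boundary of the diagonal, the distance is at most
`log ((x² + x'² + |y - y'|²) / (x x'))`, up to a bounded error. -/
lemma IsCollarChart.dist_le_log (h : IsCollarChart g e q κ δ) {z z' : Interior n X}
    (hz : (z : X) ∈ cylinder e (tail (e.extend (𝓡∂ (n + 1)) q)) (δ / 2))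
    (hz' : (z' : X) ∈ cylinder e (tail (e.extend (𝓡∂ (n + 1)) q)) (δ / 2)) :
    riemannianDist g z z' ≤ ENNReal.ofReal (Real.log (coord e z 0 ^ 2 + coord e z' 0 ^ 2 +
        ‖tail (coord e z') - tail (coord e z)‖ ^ 2) - Real.log (coord e z 0)
        - Real.log (coord e z' 0) + 2 / κ) := by
  have hκ := h.κ_pos
  have hδ := h.δ_pos
  set y₀ := tail (e.extend (𝓡∂ (n + 1)) q) with hy₀
  have hx := coord_pos h.mem_maximalAtlas hz.1
  have hx' := coord_pos h.mem_maximalAtlas hz'.1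
  have hxδ : coord e z 0 < δ / 2 := hz.2.1
  have hxδ' : coord e z' 0 < δ / 2 := hz'.2.1
  have hzδ := cylinder_subset_closedCylinder (cylinder_mono (by linarith : δ / 2 ≤ δ) hz)
  have hzδ' := cylinder_subset_closedCylinder (cylinder_mono (by linarith : δ / 2 ≤ δ) hz')
  have hD : ‖tail (coord e z') - tail (coord e z)‖ < δ := by
    have h1 : ‖tail (coord e z) - y₀‖ < δ / 2 := hz.2.2
    have h2 : ‖tail (coord e z') - y₀‖ < δ / 2 := hz'.2.2
    have := norm_sub_le (tail (coord e z') - y₀) (tail (coord e z) - y₀)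
    rw [sub_sub_sub_cancel_right] at this
    linarith
  -- climb from both points to the height `M`, above the point `y'`
  obtain ⟨M, hxM, hxM', hDM, hMδ, hMR⟩ : ∃ M, coord e z 0 ≤ M ∧ coord e z' 0 ≤ M ∧
      ‖tail (coord e z') - tail (coord e z)‖ ≤ M ∧ M ≤ δ ∧
      M ^ 2 ≤ coord e z 0 ^ 2 + coord e z' 0 ^ 2 +
        ‖tail (coord e z') - tail (coord e z)‖ ^ 2 := by
    refine ⟨max (max (coord e z 0) (coord e z' 0)) ‖tail (coord e z') - tail (coord e z)‖,
      (le_max_left _ _).trans (le_max_left _ _), (le_max_right _ _).trans (le_max_left _ _),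
      le_max_right _ _, max_le (max_le (by linarith) (by linarith)) hD.le, ?_⟩
    rcases max_choice (max (coord e z 0) (coord e z' 0))
      ‖tail (coord e z') - tail (coord e z)‖ with hh | hh <;> rw [hh]
    · rcases max_choice (coord e z 0) (coord e z' 0) with hh' | hh' <;> rw [hh'] <;>
        linarith [sq_nonneg (coord e z 0), sq_nonneg (coord e z' 0),
          sq_nonneg ‖tail (coord e z') - tail (coord e z)‖]
    · linarith [sq_nonneg (coord e z 0), sq_nonneg (coord e z' 0)]
  have hM : 0 < M := hx.trans_le hxM
  obtain ⟨m, hm, hmu⟩ := exists_coord_eq h.mem_maximalAtlas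
    (u := pt M (tail (coord e z'))) (h.mem_target _ hM.le hMδ hzδ'.2.2) hM
  have hmm : (m : X) ∈ closedCylinder e y₀ δ := by
    refine ⟨hm, ?_, ?_⟩
    · rw [show e.extend (𝓡∂ (n + 1)) m = _ from hmu]; exact hMδ
    · rw [show e.extend (𝓡∂ (n + 1)) m = _ from hmu]; exact hzδ'.2.2
  have d1 := h.dist_le hzδ hmm (by rw [hmu]; exact hxM) (by rw [hmu]; exact hDM)
  have d2 := h.dist_le hzδ' hmm (by rw [hmu]; exact hxM') (by rw [hmu]; simpa using hM.le)
  rw [riemannianDist_comm] at d2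
  rw [hmu, pt_zero] at d1 d2
  refine (riemannianDist_triangle g z m z').trans ((add_le_add d1 d2).trans ?_)
  have hl := Real.log_le_log hx hxM
  have hl' := Real.log_le_log hx' hxM'
  have hκ' : 0 < 1 / κ := by positivity
  rw [← ENNReal.ofReal_add (by linarith) (by linarith)]
  refine ENNReal.ofReal_le_ofReal ?_
  have hlog := Real.log_le_log (by positivity) hMR
  rw [Real.log_pow] at hlog
  push_cast at hlog
  have : 2 / κ = 1 / κ + 1 / κ := by ring
  linarith

end CollarEstimates

/-! ### Distance estimates away from the boundary of the diagonal -/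

section FarEstimates

variable {n : ℕ} {X : Type*} [TopologicalSpace X] [ChartedSpace (EuclideanHalfSpace (n + 1)) X]
  [IsManifold (𝓡∂ (n + 1)) ∞ X]

variable (n) in
/-- `σ` is a local model of a boundary defining function of `X` at `p`: the constant `1` if `p` is
an interior point, and the first coordinate of a chart if `p` is a boundary point. -/
def IsBoundaryCoordinate (p : X) (σ : X → ℝ) : Prop :=
  (p ∈ (𝓡∂ (n + 1)).interior X ∧ ∀ z, σ z = 1) ∨
    (p ∈ (𝓡∂ (n + 1)).boundary X ∧ ∃ e ∈ IsManifold.maximalAtlas (𝓡∂ (n + 1)) ∞ X,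
      p ∈ e.source ∧ ∀ z, σ z = e.extend (𝓡∂ (n + 1)) z 0)

lemma IsBoundaryCoordinate.eventually_pos {p : X} {σ : X → ℝ} (h : IsBoundaryCoordinate n p σ) :
    ∃ U ∈ 𝓝 p, ∀ z : Interior n X, (z : X) ∈ U → 0 < σ z := by
  rcases h with ⟨-, hσ⟩ | ⟨-, e, he, hpe, hσ⟩
  · exact ⟨univ, Filter.univ_mem, fun z _ => by simp [hσ]⟩
  · exact ⟨e.source, e.open_source.mem_nhds hpe, fun z hz => by
      rw [hσ]; exact coord_pos he hz⟩

/-- Near `p`, the distance to the fixed point `m` is at most `-log σ` up to a constant, and a path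
between `U` and the complement of `W` has length at least `-log σ` up to a constant. -/
structure IsEndEstimate (g : InteriorMetric n X) (σ : X → ℝ) (W U : Set X) (m : Interior n X)
    (C : ℝ) : Prop where
  nonneg : ∀ z : Interior n X, (z : X) ∈ U → 0 ≤ C - Real.log (σ z)
  dist_le : ∀ z : Interior n X, (z : X) ∈ U →
    riemannianDist g z m ≤ ENNReal.ofReal (C - Real.log (σ z))
  le_length : ∀ (γ : ℝ → Interior n X) (a b : ℝ), a ≤ b →
    ContMDiffOn 𝓘(ℝ, ℝ) (𝓡∂ (n + 1)) 1 γ (Icc a b) → (γ a : X) ∈ U → (γ b : X) ∉ W →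
    ENNReal.ofReal (-Real.log (σ (γ a)) - C) ≤ length g γ a b
  le_length' : ∀ (γ : ℝ → Interior n X) (a b : ℝ), a ≤ b →
    ContMDiffOn 𝓘(ℝ, ℝ) (𝓡∂ (n + 1)) 1 γ (Icc a b) → (γ a : X) ∉ W → (γ b : X) ∈ U →
    ENNReal.ofReal (-Real.log (σ (γ b)) - C) ≤ length g γ a b

lemma eventually_dist_lt_one (g : InteriorMetric n X) (m : Interior n X) :
    ∃ V ∈ 𝓝 (m : X), ∀ z : Interior n X, (z : X) ∈ V → riemannianDist g m z < 1 := by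
  obtain ⟨V, hV, hsub⟩ := mem_nhds_induced _ _ _ |>.1 (eventually_riemannianDist_lt_one g m)
  exact ⟨V, hV, fun z hz => hsub hz⟩

/-- For a boundary point `p`, the neighbourhoods `U ⊆ W` are cylinders in a collar chart. For an
interior point `p`, the function `-log σ` vanishes and the lower bounds on lengths are void. -/
lemma exists_isEndEstimate [T2Space X] {g : InteriorMetric n X}
    (hg : IsAsymptoticallyHyperbolic g) (p : X) :
    ∃ σ, IsBoundaryCoordinate n p σ ∧ ∀ V ∈ 𝓝 p, ∃ W U m C, IsOpen W ∧ W ⊆ V ∧ U ⊆ W ∧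
      U ∈ 𝓝 p ∧ IsEndEstimate g σ W U m C := by
  by_cases hp : p ∈ (𝓡∂ (n + 1)).boundary X
  · obtain ⟨e, κ, δ, h⟩ := exists_isCollarChart hg hp
    refine ⟨fun z => e.extend (𝓡∂ (n + 1)) z 0,
      Or.inr ⟨hp, e, h.mem_maximalAtlas, h.mem_source, fun _ => rfl⟩, fun V hV => ?_⟩
    obtain ⟨r, hr, hrV⟩ := exists_cylinder_subset h.mem_source h.head_eq_zero hV
    obtain ⟨δ', hδ', hle, hler⟩ : ∃ δ' > 0, δ' ≤ δ ∧ δ' ≤ r :=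
      ⟨min δ r, lt_min h.δ_pos hr, min_le_left _ _, min_le_right _ _⟩
    have h' := h.mono hδ' hle
    have hκ := h.κ_pos
    set y₀ := tail (e.extend (𝓡∂ (n + 1)) p) with hy₀
    obtain ⟨m, hm, hmu⟩ := exists_coord_eq h.mem_maximalAtlas (u := pt δ' y₀)
      (h'.mem_target _ hδ'.le le_rfl (by simp [hy₀, hδ'.le])) hδ'
    have hmm : (m : X) ∈ closedCylinder e y₀ δ' := by
      refine ⟨hm, ?_, ?_⟩ <;> rw [show e.extend (𝓡∂ (n + 1)) m = _ from hmu]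
      · exact le_rfl
      · simp [hδ'.le]
    set c := min δ' (κ ^ 2 * δ' / 4)
    have hC1 := le_max_left (Real.log δ' + 1 / κ) (-Real.log c)
    have hC2 := le_max_right (Real.log δ' + 1 / κ) (-Real.log c)
    have hκ' : 0 < 1 / κ := by positivity
    refine ⟨cylinder e y₀ δ', cylinder e y₀ (δ' / 2), m, max (Real.log δ' + 1 / κ) (-Real.log c),
      isOpen_cylinder, (cylinder_mono hler).trans hrV, cylinder_mono (by linarith),
      cylinder_mem_nhds h.mem_source (by positivity) h.head_eq_zero, ?_, ?_, ?_, ?_⟩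
    · intro z hz
      have := Real.log_le_log (coord_pos h.mem_maximalAtlas hz.1)
        (hz.2.1.le.trans (by linarith : δ' / 2 ≤ δ'))
      linarith
    · intro z hz
      have hzδ := cylinder_subset_closedCylinder (cylinder_mono (by linarith : δ' / 2 ≤ δ') hz)
      have hd := h'.dist_le hzδ hmm (by rw [hmu]; exact hzδ.2.1)
        (by rw [hmu, norm_sub_rev]; exact hzδ.2.2)
      refine hd.trans (ENNReal.ofReal_le_ofReal ?_)
      rw [hmu, pt_zero]
      linarith
    · intro γ a b hab hγ ha hb
      refine le_trans (ENNReal.ofReal_le_ofReal ?_) (h'.le_length_of_notMem hab hγ ha hb)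
      linarith
    · intro γ a b hab hγ ha hb
      refine le_trans (ENNReal.ofReal_le_ofReal ?_) (h'.le_length_of_notMem' hab hγ ha hb)
      linarith
  · have hpi : p ∈ (𝓡∂ (n + 1)).interior X := by
      rwa [← ModelWithCorners.compl_interior, mem_compl_iff, not_not] at hp
    refine ⟨fun _ => 1, Or.inl ⟨hpi, fun _ => rfl⟩, fun V hV => ?_⟩
    obtain ⟨V', hV', hd⟩ := eventually_dist_lt_one g (⟨p, hpi⟩ : Interior n X)
    refine ⟨interior V, interior V ∩ V', ⟨p, hpi⟩, 1, isOpen_interior, interior_subset,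
      inter_subset_left, Filter.inter_mem (interior_mem_nhds.2 hV) hV', ?_, ?_, ?_, ?_⟩
    · simp
    · intro z hz
      rw [riemannianDist_comm]
      simpa using (hd z hz.2).le
    · intro γ a b _ _ _ _
      simp [ENNReal.ofReal_of_nonpos]
    · intro γ a b _ _ _ _
      simp [ENNReal.ofReal_of_nonpos]

/-- Interior points are dense. The metric only serves to provide a chart at a boundary point which
contains a full cylinder. -/
lemma exists_interior_mem {g : InteriorMetric n X} (hg : IsAsymptoticallyHyperbolic g) {p : X}
    {V : Set X} (hV : V ∈ 𝓝 p) : ∃ z : Interior n X, (z : X) ∈ V := by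
  by_cases hp : p ∈ (𝓡∂ (n + 1)).boundary X
  · obtain ⟨e, κ, δ, h⟩ := exists_isCollarChart hg hp
    obtain ⟨r, hr, hrV⟩ := exists_cylinder_subset h.mem_source h.head_eq_zero hV
    have hδ := h.δ_pos
    have hlt : 0 < min δ r / 2 := by positivity
    obtain ⟨m, hm, hmu⟩ := exists_coord_eq h.mem_maximalAtlas
      (u := pt (min δ r / 2) (tail (e.extend (𝓡∂ (n + 1)) p)))
      (h.mem_target _ hlt.le (by rw [pt_zero]; linarith [min_le_left δ r]) (by simp [hδ.le])) hlt
    refine ⟨m, hrV ⟨hm, ?_, ?_⟩⟩ <;> rw [show e.extend (𝓡∂ (n + 1)) m = _ from hmu]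
    · rw [pt_zero]; linarith [min_le_right δ r, lt_min hδ hr]
    · simpa using hr
  · rw [← ModelWithCorners.compl_interior, mem_compl_iff, not_not] at hp
    exact ⟨⟨p, hp⟩, mem_of_mem_nhds hV⟩

/-- The distance is finite, as `X` is connected and every point of `X` has a neighbourhood whose
interior points have finite distance from each other. -/
lemma riemannianDist_ne_top [T2Space X] [ConnectedSpace X] {g : InteriorMetric n X}
    (hg : IsAsymptoticallyHyperbolic g) (z z' : Interior n X) : riemannianDist g z z' ≠ ⊤ := by
  have hloc : ∀ p : X, ∃ U ∈ 𝓝 p, ∀ w w' : Interior n X, (w : X) ∈ U → (w' : X) ∈ U →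
      riemannianDist g w w' ≠ ⊤ := by
    intro p
    obtain ⟨σ, -, hσ⟩ := exists_isEndEstimate hg p
    obtain ⟨W, U, m, C, -, -, -, hU, hest⟩ := hσ univ Filter.univ_mem
    refine ⟨U, hU, fun w w' hw hw' => ne_top_of_le_ne_top ?_ (riemannianDist_triangle g w m w')⟩
    have h1 := ne_top_of_le_ne_top ENNReal.ofReal_ne_top (hest.dist_le w hw)
    have h2 := ne_top_of_le_ne_top ENNReal.ofReal_ne_top (hest.dist_le w' hw')
    rw [riemannianDist_comm] at h2
    exact ENNReal.add_ne_top.2 ⟨h1, h2⟩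
  set S : Set X := {p | ∃ U ∈ 𝓝 p, ∀ w : Interior n X, (w : X) ∈ U →
    riemannianDist g z w ≠ ⊤} with hS
  have hopen : IsOpen S := by
    rw [isOpen_iff_mem_nhds]
    rintro p ⟨U, hU, hfin⟩
    filter_upwards [eventually_mem_nhds_iff.2 hU] with s hs using ⟨U, hs, hfin⟩
  have hclosed : IsClosed S := by
    rw [← isOpen_compl_iff, isOpen_iff_mem_nhds]
    intro p hp
    obtain ⟨U, hU, hfin⟩ := hloc p
    filter_upwards [eventually_mem_nhds_iff.2 hU] with s hs
    rintro ⟨U', hU', hfin'⟩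
    obtain ⟨w, hw⟩ := exists_interior_mem hg (Filter.inter_mem hs hU')
    refine hp ⟨U, hU, fun w' hw' => ne_top_of_le_ne_top ?_ (riemannianDist_triangle g z w w')⟩
    exact ENNReal.add_ne_top.2 ⟨hfin' w hw.2, hfin w w' hw.1 hw'⟩
  have hz : (z : X) ∈ S := by
    obtain ⟨V, hV, hd⟩ := eventually_dist_lt_one g z
    exact ⟨V, hV, fun w hw => ((hd w hw).trans ENNReal.one_lt_top).ne⟩
  have huniv : S = univ := IsClopen.eq_univ ⟨hclosed, hopen⟩ ⟨z, hz⟩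
  obtain ⟨U, hU, hfin⟩ := huniv ▸ mem_univ (z' : X)
  exact hfin z' (mem_of_mem_nhds hU)

lemma IsEndEstimate.toReal_dist_le [T2Space X] [ConnectedSpace X] {g : InteriorMetric n X}
    (hg : IsAsymptoticallyHyperbolic g) {σ σ' : X → ℝ} {W U W' U' : Set X} {m m' : Interior n X}
    {C C' : ℝ} (h : IsEndEstimate g σ W U m C) (h' : IsEndEstimate g σ' W' U' m' C')
    {z z' : Interior n X} (hz : (z : X) ∈ U) (hz' : (z' : X) ∈ U') :
    (riemannianDist g z z').toReal ≤
      -Real.log (σ z) - Real.log (σ' z') + (C + C' + (riemannianDist g m m').toReal) := by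
  have h1 := ENNReal.toReal_mono (by
      exact ENNReal.add_ne_top.2 ⟨riemannianDist_ne_top hg z m, riemannianDist_ne_top hg m z'⟩)
    (riemannianDist_triangle g z m z')
  have h2 := ENNReal.toReal_mono (by
      exact ENNReal.add_ne_top.2 ⟨riemannianDist_ne_top hg m m', riemannianDist_ne_top hg m' z'⟩)
    (riemannianDist_triangle g m m' z')
  rw [ENNReal.toReal_add (riemannianDist_ne_top hg _ _) (riemannianDist_ne_top hg _ _)] at h1 h2
  have h3 := ENNReal.toReal_le_of_le_ofReal (h.nonneg z hz) (h.dist_le z hz)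
  have h4 := ENNReal.toReal_le_of_le_ofReal (h'.nonneg z' hz') (h'.dist_le z' hz')
  rw [riemannianDist_comm g z'] at h4
  linarith

/-- Near a pair of points not on the boundary of the diagonal, the distance differs from
`-log σ - log σ'` by a bounded amount. For `p ≠ p'`, a path between disjoint neighbourhoods of `p`
and `p'` has to leave both of them. -/
lemma exists_dist_estimate [T2Space X] [ConnectedSpace X] {g : InteriorMetric n X}
    (hg : IsAsymptoticallyHyperbolic g) {p p' : X}
    (hne : ¬ (p = p' ∧ p ∈ (𝓡∂ (n + 1)).boundary X)) :
    ∃ σ σ', IsBoundaryCoordinate n p σ ∧ IsBoundaryCoordinate n p' σ' ∧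
      ∃ C : ℝ, ∃ U ∈ 𝓝 p, ∃ U' ∈ 𝓝 p', ∀ z z' : Interior n X, (z : X) ∈ U → (z' : X) ∈ U' →
        |(riemannianDist g z z').toReal - (-Real.log (σ z) - Real.log (σ' z'))| ≤ C := by
  obtain ⟨σ, hσ, hest⟩ := exists_isEndEstimate hg p
  obtain ⟨σ', hσ', hest'⟩ := exists_isEndEstimate hg p'
  refine ⟨σ, σ', hσ, hσ', ?_⟩
  by_cases hpp : p = p'
  · subst hpp
    have hpb : p ∉ (𝓡∂ (n + 1)).boundary X := fun hb => hne ⟨rfl, hb⟩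
    have hone : ∀ τ, IsBoundaryCoordinate n p τ → ∀ z, τ z = 1 := by
      rintro τ (⟨-, h1⟩ | ⟨hb, -⟩)
      · exact h1
      · exact absurd hb hpb
    obtain ⟨W, U, m, C, -, -, -, hU, h⟩ := hest univ Filter.univ_mem
    obtain ⟨W', U', m', C', -, -, -, hU', h'⟩ := hest' univ Filter.univ_mem
    refine ⟨C + C' + (riemannianDist g m m').toReal, U, hU, U', hU', fun z z' hz hz' => ?_⟩
    have := h.toReal_dist_le hg h' hz hz'
    rw [hone σ hσ, hone σ' hσ', Real.log_one] at this ⊢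
    rw [abs_of_nonneg] <;> linarith [(riemannianDist g z z').toReal_nonneg]
  · obtain ⟨V, V', hV, hV', hdisj⟩ := t2_separation_nhds hpp
    obtain ⟨W, U, m, C, hW, hWV, hUW, hU, h⟩ := hest V hV
    obtain ⟨W', U', m', C', hW', hWV', hUW', hU', h'⟩ := hest' V' hV'
    refine ⟨C + C' + (riemannianDist g m m').toReal, U, hU, U', hU', fun z z' hz hz' => ?_⟩
    have hup := h.toReal_dist_le hg h' hz hz'
    have hlow : ENNReal.ofReal (-Real.log (σ z) - Real.log (σ' z') - (C + C')) ≤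
        riemannianDist g z z' := by
      refine le_riemannianDist g fun γ hγ h0 h1 => ?_
      obtain ⟨t, ht, htW, htW'⟩ : ∃ t ∈ Icc (0 : ℝ) 1, (γ t : X) ∉ W ∧ (γ t : X) ∉ W' := by
        by_contra! hcov
        have hc : ContinuousOn (fun t => (γ t : X)) (Icc 0 1) :=
          continuous_subtype_val.comp_continuousOn hγ.continuousOn
        have hpre := (isPreconnected_Icc (a := (0 : ℝ)) (b := 1)).image _ hc
        obtain ⟨s, -, hsW, hsW'⟩ := hpre W W' hW hW'
          (by
            rintro _ ⟨t, ht, rfl⟩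
            exact or_iff_not_imp_left.2 (hcov t ht))
          ⟨γ 0, ⟨0, by simp, rfl⟩, hUW (by rwa [h0])⟩
          ⟨γ 1, ⟨1, by simp, rfl⟩, hUW' (by rwa [h1])⟩
        exact hdisj.notMem_of_mem_left (hWV hsW) (hWV' hsW')
      have b1 := h.le_length γ 0 t ht.1 (hγ.mono (Icc_subset_Icc_right ht.2))
        (by rwa [h0]) htW
      have b2 := h'.le_length' γ t 1 ht.2 (hγ.mono (Icc_subset_Icc_left ht.1)) htW'
        (by rwa [h1])
      rw [h0] at b1
      rw [h1] at b2
      rw [← length_add g γ ht.1 ht.2]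
      refine le_trans ?_ (add_le_add b1 b2)
      refine le_trans (ENNReal.ofReal_le_ofReal ?_) ENNReal.ofReal_add_le
      linarith
    have hlow' := (ENNReal.ofReal_le_iff_le_toReal (riemannianDist_ne_top hg z z')).1 hlow
    rw [abs_le]
    constructor <;> linarith [(riemannianDist g m m').toReal_nonneg]

end FarEstimates

/-! ### Functions vanishing to first order on a face -/

section FirstOrder

/-- The functions `u` and `v` are comparable along the filter `l`: each is bounded by a constant
multiple of the other. -/
def Comparable {α : Type*} (l : Filter α) (u v : α → ℝ) : Prop :=
  ∃ C > 0, ∀ᶠ a in l, u a ≤ C * v a ∧ v a ≤ C * u a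

lemma Comparable.comp_tendsto {α β : Type*} {l : Filter α} {l' : Filter β} {u v : α → ℝ}
    (h : Comparable l u v) {f : β → α} (hf : Filter.Tendsto f l' l) :
    Comparable l' (u ∘ f) (v ∘ f) := by
  obtain ⟨C, hC, hev⟩ := h
  exact ⟨C, hC, hf.eventually hev⟩

lemma Comparable.congr_right {α : Type*} {l : Filter α} {u v v' : α → ℝ}
    (h : Comparable l u v) (hv : v =ᶠ[l] v') : Comparable l u v' := by
  obtain ⟨C, hC, hev⟩ := h
  refine ⟨C, hC, ?_⟩
  filter_upwards [hev, hv] with a ha hva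
  rwa [← hva]

lemma comparable_of_tendsto_pos {α : Type*} {l : Filter α} {u v : α → ℝ} {a b : ℝ}
    (ha : 0 < a) (hb : 0 < b) (hu : Filter.Tendsto u l (𝓝 a)) (hv : Filter.Tendsto v l (𝓝 b)) :
    Comparable l u v := by
  refine ⟨max (2 * a / (b / 2)) (2 * b / (a / 2)), by positivity, ?_⟩
  filter_upwards [hu.eventually_lt_const (by linarith : a < 2 * a),
    hu.eventually_const_lt (by linarith : a / 2 < a),
    hv.eventually_lt_const (by linarith : b < 2 * b),
    hv.eventually_const_lt (by linarith : b / 2 < b)] with x h1 h2 h3 h4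
  constructor
  · calc u x ≤ 2 * a / (b / 2) * (b / 2) := by rw [div_mul_cancel₀ _ (by positivity)]; exact h1.le
      _ ≤ _ := by gcongr; exact le_max_left _ _
  · calc v x ≤ 2 * b / (a / 2) * (a / 2) := by rw [div_mul_cancel₀ _ (by positivity)]; exact h3.le
      _ ≤ _ := by gcongr; exact le_max_right _ _

variable {F : Type*} [NormedAddCommGroup F] [NormedSpace ℝ F] {S : Set F} {c₀ v₀ : F}
  {ℓ : F →L[ℝ] ℝ} {G : F → ℝ}

lemma tendsto_sub_smul (hc₀ : ℓ c₀ = 0) (hP : ∀ c ∈ S, c - ℓ c • v₀ ∈ S) :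
    Filter.Tendsto (fun c => c - ℓ c • v₀) (𝓝[S] c₀) (𝓝[S] c₀) := by
  refine tendsto_nhdsWithin_iff.2 ⟨?_, Filter.eventually_of_mem self_mem_nhdsWithin hP⟩
  have h : Continuous fun c => c - ℓ c • v₀ := by fun_prop
  have := h.tendsto c₀
  rw [hc₀, zero_smul, sub_zero] at this
  exact this.mono_left nhdsWithin_le_nhds

/-- If `G` vanishes on the face `ℓ = 0` of `S`, then its derivative at a point of the face is a
multiple of `ℓ`. Indeed, `G` vanishes after composition with the projection `c ↦ c - ℓ(c) v₀` of
`S` onto the face. -/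
lemma fderivWithin_apply_of_eq_zero (hS : UniqueDiffWithinAt ℝ S c₀)
    (hG : DifferentiableWithinAt ℝ G S c₀) (hc₀ : ℓ c₀ = 0) (hv₀ : ℓ v₀ = 1) (hmem : c₀ ∈ S)
    (hP : ∀ c ∈ S, c - ℓ c • v₀ ∈ S) (hG0 : ∀ᶠ c in 𝓝[S] c₀, ℓ c = 0 → G c = 0) (w : F) :
    fderivWithin ℝ G S c₀ w = ℓ w * fderivWithin ℝ G S c₀ v₀ := by
  set D := fderivWithin ℝ G S c₀
  have hPd : HasFDerivWithinAt (fun c => c - ℓ c • v₀)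
      (ContinuousLinearMap.id ℝ F - ℓ.smulRight v₀) S c₀ :=
    (hasFDerivWithinAt_id c₀ S).sub (ℓ.smulRight v₀).hasFDerivWithinAt
  have hPc₀ : c₀ - ℓ c₀ • v₀ = c₀ := by rw [hc₀, zero_smul, sub_zero]
  have hGd : HasFDerivWithinAt G D S (c₀ - ℓ c₀ • v₀) := by
    rw [hPc₀]; exact hG.hasFDerivWithinAt
  have hcomp := hGd.comp c₀ hPd hP
  have hzero : G ∘ (fun c => c - ℓ c • v₀) =ᶠ[𝓝[S] c₀] fun _ => 0 := by
    filter_upwards [(tendsto_sub_smul hc₀ hP).eventually hG0] with c hc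
    exact hc (by simp [hv₀])
  have hconst : HasFDerivWithinAt (G ∘ (fun c => c - ℓ c • v₀)) (0 : F →L[ℝ] ℝ) S c₀ :=
    (hasFDerivWithinAt_const (0 : ℝ) c₀ S).congr_of_eventuallyEq hzero
      (hzero.self_of_nhdsWithin hmem)
  have := congrArg (fun L => L w) (hS.eq hcomp hconst)
  simp at this
  linarith

/-- A function vanishing on the face `ℓ = 0` of a convex set `S`, with nonzero differential at a
point of this face, is comparable with `ℓ` near this point: apply the mean value inequality between
`c` and its projection `c - ℓ(c) v₀` to the face. -/
lemma comparable_of_fderivWithin_ne_zero (hconv : Convex ℝ S) (hS : UniqueDiffOn ℝ S)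
    (hG : ContDiffWithinAt ℝ 1 G S c₀) (hc₀ : ℓ c₀ = 0) (hv₀ : ℓ v₀ = 1) (hmem : c₀ ∈ S)
    (hℓ : ∀ c ∈ S, 0 ≤ ℓ c) (hP : ∀ c ∈ S, c - ℓ c • v₀ ∈ S)
    (hG0 : ∀ᶠ c in 𝓝[S] c₀, ℓ c = 0 → G c = 0) (hD : fderivWithin ℝ G S c₀ ≠ 0) :
    Comparable (𝓝[S] c₀) ℓ (fun c => |G c|) := by
  set D := fderivWithin ℝ G S c₀ with hDdef
  have hDw : ∀ w, D w = ℓ w * D v₀ := fun w =>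
    fderivWithin_apply_of_eq_zero (hS c₀ hmem) (hG.differentiableWithinAt one_ne_zero) hc₀ hv₀ hmem
      hP hG0 w
  have hDv : 0 < |D v₀| := by
    refine abs_pos.2 fun h0 => hD (ContinuousLinearMap.ext fun w => ?_)
    rw [hDw w, h0, mul_zero]; rfl
  set η : ℝ := |D v₀| / (2 * (‖v₀‖ + 1)) with hη
  have hη0 : 0 < η := by positivity
  have hcont : ContinuousWithinAt (fderivWithin ℝ G S) S c₀ :=
    (hG.fderivWithin_right (m := 0) hS (by simp) hmem).continuousWithinAt
  have hdiff : ∀ᶠ c in 𝓝[S] c₀, ContDiffWithinAt ℝ 1 G S c := by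
    have := hG.eventually (by simp)
    rwa [insert_eq_of_mem hmem] at this
  have hclose : ∀ᶠ c in 𝓝[S] c₀, ‖fderivWithin ℝ G S c - D‖ ≤ η := by
    have h0 : Filter.Tendsto (fun c => ‖fderivWithin ℝ G S c - D‖) (𝓝[S] c₀) (𝓝 0) := by
      have := (hcont.tendsto.sub_const D).norm
      rwa [← hDdef, sub_self, norm_zero] at this
    exact h0.eventually_le_const hη0
  obtain ⟨ε, hε, hball⟩ := Metric.mem_nhdsWithin_iff.1 (hdiff.and hclose)
  have hev : ∀ᶠ c in 𝓝[S] c₀, c ∈ Metric.ball c₀ ε ∩ S :=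
    Filter.inter_mem (nhdsWithin_le_nhds (Metric.ball_mem_nhds c₀ hε)) self_mem_nhdsWithin
  refine ⟨max (2 / |D v₀|) (2 * |D v₀|), by positivity, ?_⟩
  filter_upwards [hev, (tendsto_sub_smul hc₀ hP).eventually hev,
    (tendsto_sub_smul hc₀ hP).eventually hG0] with c hc hPc hG0c
  have hGP : G (c - ℓ c • v₀) = 0 := hG0c (by simp [hv₀])
  have hmv := ((convex_ball c₀ ε).inter hconv).norm_image_sub_le_of_norm_hasFDerivWithin_le'
    (f := G) (f' := fderivWithin ℝ G S) (φ := D) (C := η)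
    (fun x hx => (((hball hx).1.differentiableWithinAt one_ne_zero).hasFDerivWithinAt).mono
      inter_subset_right) (fun x hx => (hball hx).2) hPc hc
  rw [hGP, sub_zero, sub_sub_cancel, hDw, map_smul, hv₀, norm_smul, Real.norm_eq_abs,
    Real.norm_eq_abs, abs_of_nonneg (hℓ c hc.2), smul_eq_mul, mul_one] at hmv
  have hℓc := hℓ c hc.2
  have hηv : η * (ℓ c * ‖v₀‖) ≤ ℓ c * |D v₀| / 2 := by
    have : η * ‖v₀‖ ≤ |D v₀| / 2 := by
      rw [hη, div_mul_eq_mul_div, div_le_div_iff₀ (by positivity) two_pos]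
      nlinarith [norm_nonneg v₀]
    nlinarith
  have hmain := hmv.trans hηv
  have habs : |ℓ c * D v₀| = ℓ c * |D v₀| := by rw [abs_mul, abs_of_nonneg hℓc]
  have hup : |G c| ≤ 2 * |D v₀| * ℓ c := by
    have := abs_sub_abs_le_abs_sub (G c) (ℓ c * D v₀)
    rw [habs] at this
    nlinarith
  have hlow : ℓ c * |D v₀| ≤ 2 * |G c| := by
    have := abs_sub_abs_le_abs_sub (ℓ c * D v₀) (G c)
    rw [habs, abs_sub_comm] at this
    linarith
  constructor
  · calc ℓ c ≤ 2 / |D v₀| * |G c| := by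
          rw [div_mul_eq_mul_div, le_div_iff₀ hDv]; exact hlow
      _ ≤ _ := by gcongr; exact le_max_left _ _
  · exact hup.trans (by gcongr; exact le_max_right _ _)

end FirstOrder

/-! ### Boundary defining functions away from the front face -/

section OffDiagonal

variable {n : ℕ} {X : Type*} [TopologicalSpace X] [T2Space X]
  [ChartedSpace (EuclideanHalfSpace (n + 1)) X] [IsManifold (𝓡∂ (n + 1)) ∞ X]
  {e e' : OpenPartialHomeomorph X (EuclideanHalfSpace (n + 1))}

/-- A smooth function near a point of `X²` off the boundary of the diagonal, which vanishes to first
order on the face `ℓ = 0` of the product chart `e × e'`, is comparable with `ℓ`. -/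
lemma comparable_of_mfderiv_ne_zero (he : e ∈ IsManifold.maximalAtlas (𝓡∂ (n + 1)) ∞ X)
    (he' : e' ∈ IsManifold.maximalAtlas (𝓡∂ (n + 1)) ∞ X) {f : OffDiag n X → ℝ}
    {ℓ : EuclideanSpace ℝ (Fin (n + 1)) × EuclideanSpace ℝ (Fin (n + 1)) →L[ℝ] ℝ}
    {v₀ : EuclideanSpace ℝ (Fin (n + 1)) × EuclideanSpace ℝ (Fin (n + 1))}
    {P₀ : OffDiag n X} (hP₀ : P₀.1.1 ∈ e.source) (hP₀' : P₀.1.2 ∈ e'.source)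
    (hf : ContMDiffAt ((𝓡∂ (n + 1)).prod (𝓡∂ (n + 1))) 𝓘(ℝ, ℝ) ∞ f P₀)
    (hℓ : ∀ c ∈ range (𝓡∂ (n + 1)) ×ˢ range (𝓡∂ (n + 1)), 0 ≤ ℓ c)
    (hproj : ∀ c ∈ range (𝓡∂ (n + 1)) ×ˢ range (𝓡∂ (n + 1)),
      c - ℓ c • v₀ ∈ range (𝓡∂ (n + 1)) ×ˢ range (𝓡∂ (n + 1)))
    (hv₀ : ℓ v₀ = 1)
    (hf0 : ∀ P : OffDiag n X, P.1.1 ∈ e.source → P.1.2 ∈ e'.source →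
      ℓ (e.extend (𝓡∂ (n + 1)) P.1.1, e'.extend (𝓡∂ (n + 1)) P.1.2) = 0 → f P = 0)
    (hℓ₀ : ℓ (e.extend (𝓡∂ (n + 1)) P₀.1.1, e'.extend (𝓡∂ (n + 1)) P₀.1.2) = 0)
    (hdf : mfderiv ((𝓡∂ (n + 1)).prod (𝓡∂ (n + 1))) 𝓘(ℝ, ℝ) f P₀ ≠ 0) :
    Comparable (𝓝 P₀)
      (fun P => ℓ (e.extend (𝓡∂ (n + 1)) P.1.1, e'.extend (𝓡∂ (n + 1)) P.1.2))
      (fun P => |f P|) := by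
  classical
  set S : Set (EuclideanSpace ℝ (Fin (n + 1)) × EuclideanSpace ℝ (Fin (n + 1))) :=
    range (𝓡∂ (n + 1)) ×ˢ range (𝓡∂ (n + 1)) with hS
  set Φ : OffDiag n X → EuclideanSpace ℝ (Fin (n + 1)) × EuclideanSpace ℝ (Fin (n + 1)) :=
    fun P => (e.extend (𝓡∂ (n + 1)) P.1.1, e'.extend (𝓡∂ (n + 1)) P.1.2) with hΦ
  set Ψ : EuclideanSpace ℝ (Fin (n + 1)) × EuclideanSpace ℝ (Fin (n + 1)) → X × X :=
    fun c => ((e.extend (𝓡∂ (n + 1))).symm c.1, (e'.extend (𝓡∂ (n + 1))).symm c.2) with hΨ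
  -- `f` is extended by zero, to apply calculus in the product chart
  set f' : X × X → ℝ := fun P => if h : P ∈ OffDiag n X then f ⟨P, h⟩ else 0 with hf'
  set G : EuclideanSpace ℝ (Fin (n + 1)) × EuclideanSpace ℝ (Fin (n + 1)) → ℝ := f' ∘ Ψ with hG
  have hf'f : ∀ P : OffDiag n X, f' P.1 = f P := fun P => dif_pos P.2
  have hf's : ContMDiffAt ((𝓡∂ (n + 1)).prod (𝓡∂ (n + 1))) 𝓘(ℝ, ℝ) ∞ f' P₀.1 := by
    rw [← contMDiffAt_subtype_iff]
    exact hf.congr_of_eventuallyEq (Filter.Eventually.of_forall hf'f)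
  have hΦS : ∀ P, Φ P ∈ S := fun P => ⟨extend_mem_range _ _, extend_mem_range _ _⟩
  have hΨΦ : ∀ P : OffDiag n X, P.1.1 ∈ e.source → P.1.2 ∈ e'.source → Ψ (Φ P) = P.1 :=
    fun P h h' => Prod.ext (e.extend_left_inv h) (e'.extend_left_inv h')
  have hΨs : ContMDiffWithinAt
      𝓘(ℝ, EuclideanSpace ℝ (Fin (n + 1)) × EuclideanSpace ℝ (Fin (n + 1)))
      ((𝓡∂ (n + 1)).prod (𝓡∂ (n + 1))) ∞ Ψ S (Φ P₀) := by
    refine ContMDiffWithinAt.prodMk ?_ ?_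
    · exact (contMDiffWithinAt_extend_symm_range he hP₀).comp (Φ P₀)
        contDiff_fst.contMDiff.contMDiffAt.contMDiffWithinAt fun c hc => hc.1
    · exact (contMDiffWithinAt_extend_symm_range he' hP₀').comp (Φ P₀)
        contDiff_snd.contMDiff.contMDiffAt.contMDiffWithinAt fun c hc => hc.2
  have hGs : ContDiffWithinAt ℝ ∞ G S (Φ P₀) := by
    rw [← contMDiffWithinAt_iff_contDiffWithinAt]
    refine ContMDiffAt.comp_contMDiffWithinAt (Φ P₀) ?_ hΨs
    rw [hΨΦ P₀ hP₀ hP₀']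
    exact hf's
  have hsrc : ∀ᶠ P : OffDiag n X in 𝓝 P₀, P.1.1 ∈ e.source ∧ P.1.2 ∈ e'.source :=
    ((continuous_fst.comp continuous_subtype_val).continuousAt.eventually
        (e.open_source.mem_nhds hP₀)).and
      ((continuous_snd.comp continuous_subtype_val).continuousAt.eventually
        (e'.open_source.mem_nhds hP₀'))
  have hfG : f =ᶠ[𝓝 P₀] G ∘ Φ := by
    filter_upwards [hsrc] with P hP
    rw [hG, Function.comp_apply, Function.comp_apply, hΨΦ P hP.1 hP.2, hf'f]
  have hΦs : ContMDiffAt ((𝓡∂ (n + 1)).prod (𝓡∂ (n + 1)))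
      𝓘(ℝ, EuclideanSpace ℝ (Fin (n + 1)) × EuclideanSpace ℝ (Fin (n + 1))) ∞ Φ P₀ := by
    have h1 : ContMDiffAt ((𝓡∂ (n + 1)).prod (𝓡∂ (n + 1))) 𝓘(ℝ, EuclideanSpace ℝ (Fin (n + 1))) ∞
        (fun P : X × X => e.extend (𝓡∂ (n + 1)) P.1) P₀.1 :=
      ContMDiffAt.comp (P₀.1 : X × X) (e.contMDiffAt_extend he hP₀) contMDiffAt_fst
    have h2 : ContMDiffAt ((𝓡∂ (n + 1)).prod (𝓡∂ (n + 1))) 𝓘(ℝ, EuclideanSpace ℝ (Fin (n + 1))) ∞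
        (fun P : X × X => e'.extend (𝓡∂ (n + 1)) P.2) P₀.1 :=
      ContMDiffAt.comp (P₀.1 : X × X) (e'.contMDiffAt_extend he' hP₀') contMDiffAt_snd
    exact contMDiffAt_subtype_iff.2 (h1.prodMk_space h2)
  have hconv : Convex ℝ S := (𝓡∂ (n + 1)).convex_range.prod (𝓡∂ (n + 1)).convex_range
  have huniq : UniqueDiffOn ℝ S := (𝓡∂ (n + 1)).uniqueDiffOn.prod (𝓡∂ (n + 1)).uniqueDiffOn
  have hD : fderivWithin ℝ G S (Φ P₀) ≠ 0 := by
    intro h0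
    apply hdf
    have hGd : HasFDerivWithinAt G
        (0 : EuclideanSpace ℝ (Fin (n + 1)) × EuclideanSpace ℝ (Fin (n + 1)) →L[ℝ] ℝ) S (Φ P₀) := by
      rw [← h0]
      exact (hGs.differentiableWithinAt (by simp)).hasFDerivWithinAt
    have hΦd := (hΦs.mdifferentiableAt (by simp)).hasMFDerivAt.hasMFDerivWithinAt (s := univ)
    have hcomp := (HasMFDerivWithinAt.comp P₀ hGd.hasMFDerivWithinAt hΦd fun P _ => hΦS P)
    rw [hasMFDerivWithinAt_univ] at hcomp
    rw [hfG.mfderiv_eq, hcomp.mfderiv]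
    exact ContinuousLinearMap.zero_comp _
  have htarget : ∀ᶠ c in 𝓝[S] (Φ P₀), c.1 ∈ (e.extend (𝓡∂ (n + 1))).target ∧
      c.2 ∈ (e'.extend (𝓡∂ (n + 1))).target := by
    rw [hS, nhdsWithin_prod_eq]
    exact Filter.prod_mem_prod (e.extend_target_mem_nhdsWithin hP₀)
      (e'.extend_target_mem_nhdsWithin hP₀')
  have hoff : ∀ᶠ c in 𝓝[S] (Φ P₀), Ψ c ∈ OffDiag n X := by
    refine hΨs.continuousWithinAt.eventually ((OffDiag n X).isOpen.mem_nhds ?_)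
    rw [hΨΦ P₀ hP₀ hP₀']
    exact P₀.2
  have hG0 : ∀ᶠ c in 𝓝[S] (Φ P₀), ℓ c = 0 → G c = 0 := by
    filter_upwards [htarget, hoff] with c hc hco h0
    have hGc : G c = f ⟨Ψ c, hco⟩ := dif_pos hco
    rw [hGc]
    refine hf0 _ (extend_symm_mem_source hc.1) (extend_symm_mem_source hc.2) ?_
    have h1 := (e.extend (𝓡∂ (n + 1))).right_inv hc.1
    have h2 := (e'.extend (𝓡∂ (n + 1))).right_inv hc.2
    simp only [hΨ]
    rw [h1, h2]
    exact h0
  have hcmp := comparable_of_fderivWithin_ne_zero hconv huniq (hGs.of_le (by simp)) hℓ₀ hv₀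
    (hΦS P₀) hℓ hproj hG0 hD
  have hΦt : Filter.Tendsto Φ (𝓝 P₀) (𝓝[S] (Φ P₀)) :=
    tendsto_nhdsWithin_iff.2 ⟨hΦs.continuousAt, Filter.Eventually.of_forall hΦS⟩
  refine (hcmp.comp_tendsto hΦt).congr_right ?_
  filter_upwards [hfG] with P hP
  simp [hP]

end OffDiagonal

section OffDiagonalFaces

variable {n : ℕ} {X : Type*} [TopologicalSpace X] [T2Space X]
  [ChartedSpace (EuclideanHalfSpace (n + 1)) X] [IsManifold (𝓡∂ (n + 1)) ∞ X]
  {ρ : ZeroDoubleSpace n X → ℝ}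

lemma IsBoundaryDefiningFunction.pos {F : Set (ZeroDoubleSpace n X)}
    (h : IsBoundaryDefiningFunction F ρ) {ζ : ZeroDoubleSpace n X} (hζ : ζ ∉ F) : 0 < ρ ζ :=
  lt_of_le_of_ne (h.nonneg ζ) fun h0 => hζ ((h.eq_zero_iff ζ).1 h0.symm)

lemma IsBoundaryDefiningFunction.comparable_one {F : Set (ZeroDoubleSpace n X)}
    (h : IsBoundaryDefiningFunction F ρ) {P₀ : OffDiag n X} (hP₀ : .off P₀ ∉ F) :
    Comparable (𝓝 P₀) (fun _ => 1) (fun P => ρ (.off P)) :=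
  comparable_of_tendsto_pos one_pos (h.pos hP₀) tendsto_const_nhds
    h.smooth.1.continuous.continuousAt

/-- Off the boundary of the diagonal, a boundary defining function of the left face is comparable
with a boundary defining function of `X` in the first factor. -/
lemma IsBoundaryDefiningFunction.comparable_left
    (h : IsBoundaryDefiningFunction (leftFace n X) ρ) {P₀ : OffDiag n X} {σ : X → ℝ}
    (hσ : IsBoundaryCoordinate n P₀.1.1 σ) :
    Comparable (𝓝 P₀) (fun P => σ P.1.1) (fun P => ρ (.off P)) := by
  rcases hσ with ⟨hp, hσ⟩ | ⟨hp, e, he, hpe, hσ⟩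
  · have hnot : P₀.1.1 ∉ (𝓡∂ (n + 1)).boundary X := fun hb =>
      Set.disjoint_left.1 (𝓡∂ (n + 1)).disjoint_interior_boundary hp hb
    simp only [hσ]
    exact h.comparable_one hnot
  · have he' := IsManifold.chart_mem_maximalAtlas (I := 𝓡∂ (n + 1)) (n := ∞) P₀.1.2
    have hcmp := comparable_of_mfderiv_ne_zero he he' (f := fun P => ρ (.off P))
      (ℓ := (headL n).comp (ContinuousLinearMap.fst ℝ _ _)) (v₀ := (pt 1 0, 0)) (P₀ := P₀) hpe
      (mem_chart_source _ _) h.smooth.1.contMDiffAt ?_ ?_ rfl ?_ ?_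
      (h.differential_ne_zero (.off P₀) hp)
    · simp only [hσ]
      exact hcmp.congr_right (Filter.Eventually.of_forall fun P => abs_of_nonneg (h.nonneg _))
    · intro c hc
      have := hc.1
      rwa [range_halfSpace_model] at this
    · intro c hc
      refine ⟨?_, ?_⟩
      · rw [range_halfSpace_model]
        change 0 ≤ c.1 0 - c.1 0 * 1
        simp
      · change c.2 - c.1 0 • 0 ∈ _
        rw [smul_zero, sub_zero]
        exact hc.2
    · intro P hP _ h0
      exact (h.eq_zero_iff _).2 ((mem_boundary_iff_head_eq_zero he hP).2 h0)
    · exact (mem_boundary_iff_head_eq_zero he hpe).1 hp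

/-- Off the boundary of the diagonal, a boundary defining function of the right face is comparable
with a boundary defining function of `X` in the second factor. -/
lemma IsBoundaryDefiningFunction.comparable_right
    (h : IsBoundaryDefiningFunction (rightFace n X) ρ) {P₀ : OffDiag n X} {σ : X → ℝ}
    (hσ : IsBoundaryCoordinate n P₀.1.2 σ) :
    Comparable (𝓝 P₀) (fun P => σ P.1.2) (fun P => ρ (.off P)) := by
  rcases hσ with ⟨hp, hσ⟩ | ⟨hp, e, he, hpe, hσ⟩
  · have hnot : P₀.1.2 ∉ (𝓡∂ (n + 1)).boundary X := fun hb =>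
      Set.disjoint_left.1 (𝓡∂ (n + 1)).disjoint_interior_boundary hp hb
    simp only [hσ]
    exact h.comparable_one hnot
  · have he' := IsManifold.chart_mem_maximalAtlas (I := 𝓡∂ (n + 1)) (n := ∞) P₀.1.1
    have hcmp := comparable_of_mfderiv_ne_zero he' he (f := fun P => ρ (.off P))
      (ℓ := (headL n).comp (ContinuousLinearMap.snd ℝ _ _)) (v₀ := (0, pt 1 0)) (P₀ := P₀)
      (mem_chart_source _ _) hpe h.smooth.1.contMDiffAt ?_ ?_ rfl ?_ ?_
      (h.differential_ne_zero (.off P₀) hp)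
    · simp only [hσ]
      exact hcmp.congr_right (Filter.Eventually.of_forall fun P => abs_of_nonneg (h.nonneg _))
    · intro c hc
      have := hc.2
      rwa [range_halfSpace_model] at this
    · intro c hc
      refine ⟨?_, ?_⟩
      · change c.1 - c.2 0 • 0 ∈ _
        rw [smul_zero, sub_zero]
        exact hc.1
      · rw [range_halfSpace_model]
        change 0 ≤ c.2 0 - c.2 0 * 1
        simp
    · intro P _ hP h0
      exact (h.eq_zero_iff _).2 ((mem_boundary_iff_head_eq_zero he hP).2 h0)
    · exact (mem_boundary_iff_head_eq_zero he hpe).1 hp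

end OffDiagonalFaces

/-! ### Normal components in different charts -/

section FrontFace

variable {n : ℕ} {X : Type*} [TopologicalSpace X]
  [ChartedSpace (EuclideanHalfSpace (n + 1)) X] [IsManifold (𝓡∂ (n + 1)) ∞ X]
  {e : OpenPartialHomeomorph X (EuclideanHalfSpace (n + 1))}

/-- The differential at `q` of the chart `e`. -/
noncomputable def chartDifferential (e : OpenPartialHomeomorph X (EuclideanHalfSpace (n + 1)))
    (q : X) : TangentSpace (𝓡∂ (n + 1)) q →L[ℝ] EuclideanSpace ℝ (Fin (n + 1)) :=
  mfderiv (𝓡∂ (n + 1)) 𝓘(ℝ, EuclideanSpace ℝ (Fin (n + 1))) (e.extend (𝓡∂ (n + 1))) q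

/-- At a boundary point, the normal component with respect to any chart is a positive multiple of
the one with respect to the preferred chart, as the transition map preserves the half-space and its
boundary. -/
lemma exists_normalComponent_eq (he : e ∈ IsManifold.maximalAtlas (𝓡∂ (n + 1)) ∞ X) {q : X}
    (hqe : q ∈ e.source) (hq : q ∈ (𝓡∂ (n + 1)).boundary X) :
    ∃ c > 0, ∀ v : TangentSpace (𝓡∂ (n + 1)) q,
      normalComponent q v = c * chartDifferential e q v 0 := by
  set e₁ := chartAt (EuclideanHalfSpace (n + 1)) q with he₁
  have he₁m : e₁ ∈ IsManifold.maximalAtlas (𝓡∂ (n + 1)) ∞ X :=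
    IsManifold.chart_mem_maximalAtlas q
  have hqe₁ : q ∈ e₁.source := mem_chart_source _ q
  set u₀ := e.extend (𝓡∂ (n + 1)) q with hu₀
  have hu₀q : (e.extend (𝓡∂ (n + 1))).symm u₀ = q := e.extend_left_inv hqe
  have hu₀S : u₀ ∈ range (𝓡∂ (n + 1)) := extend_mem_range e q
  set τ : EuclideanSpace ℝ (Fin (n + 1)) → EuclideanSpace ℝ (Fin (n + 1)) :=
    e₁.extend (𝓡∂ (n + 1)) ∘ (e.extend (𝓡∂ (n + 1))).symm with hτ
  have hτs : ContDiffWithinAt ℝ ∞ τ (range (𝓡∂ (n + 1))) u₀ := by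
    rw [← contMDiffWithinAt_iff_contDiffWithinAt]
    refine ContMDiffAt.comp_contMDiffWithinAt u₀ ?_ (contMDiffWithinAt_extend_symm_range he hqe)
    rw [hu₀q]
    exact e₁.contMDiffAt_extend he₁m hqe₁
  have hτd := (hτs.differentiableWithinAt (by simp)).hasFDerivWithinAt
  set τ₀ : EuclideanSpace ℝ (Fin (n + 1)) → ℝ := fun u => headL n (τ u) with hτ₀
  have hτ₀d : HasFDerivWithinAt τ₀
      ((headL n).comp (fderivWithin ℝ τ (range (𝓡∂ (n + 1))) u₀)) (range (𝓡∂ (n + 1))) u₀ :=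
    (headL n).hasFDerivAt.comp_hasFDerivWithinAt u₀ hτd
  have huniq : UniqueDiffWithinAt ℝ (range (𝓡∂ (n + 1))) u₀ := (𝓡∂ (n + 1)).uniqueDiffOn u₀ hu₀S
  have hev : ∀ᶠ u in 𝓝[range (𝓡∂ (n + 1))] u₀, u ∈ (e.extend (𝓡∂ (n + 1))).target ∧
      (e.extend (𝓡∂ (n + 1))).symm u ∈ e₁.source := by
    refine Filter.Eventually.and (e.extend_target_mem_nhdsWithin hqe) ?_
    refine (contMDiffWithinAt_extend_symm_range he hqe).continuousWithinAt.eventually ?_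
    rw [hu₀q]
    exact e₁.open_source.mem_nhds hqe₁
  -- the first coordinate of one chart vanishes where the first coordinate of the other one does
  have hface := fderivWithin_apply_of_eq_zero (ℓ := headL n) (v₀ := pt 1 0) (G := τ₀) huniq
    hτ₀d.differentiableWithinAt ((mem_boundary_iff_head_eq_zero he hqe).1 hq) rfl hu₀S
    (by
      intro u _
      rw [range_halfSpace_model]
      change 0 ≤ u 0 - u 0 * 1
      simp)
    (by
      filter_upwards [hev] with u hu h0
      have hb : (e.extend (𝓡∂ (n + 1))).symm u ∈ (𝓡∂ (n + 1)).boundary X := by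
        rw [mem_boundary_iff_head_eq_zero he (extend_symm_mem_source hu.1),
          (e.extend (𝓡∂ (n + 1))).right_inv hu.1]
        exact h0
      exact (mem_boundary_iff_head_eq_zero he₁m hu.2).1 hb)
  rw [hτ₀d.fderivWithin huniq] at hface
  set c : ℝ := headL n (fderivWithin ℝ τ (range (𝓡∂ (n + 1))) u₀ (pt 1 0)) with hc
  have hchain : ∀ v : TangentSpace (𝓡∂ (n + 1)) q,
      normalComponent q v = c * chartDifferential e q v 0 := by
    intro v
    have hAd := (mdifferentiableAt_extend he hqe).hasMFDerivAt.hasMFDerivWithinAt (s := univ)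
    have hsub : univ ⊆ e.extend (𝓡∂ (n + 1)) ⁻¹' range (𝓡∂ (n + 1)) :=
      fun p _ => extend_mem_range e p
    have hcomp := HasMFDerivWithinAt.comp q hτd.hasMFDerivWithinAt hAd hsub
    rw [hasMFDerivWithinAt_univ] at hcomp
    have heq : e₁.extend (𝓡∂ (n + 1)) =ᶠ[𝓝 q] τ ∘ e.extend (𝓡∂ (n + 1)) := by
      filter_upwards [e.open_source.mem_nhds hqe] with p hp
      rw [hτ, Function.comp_apply, Function.comp_apply, e.extend_left_inv hp]
    have hB : mfderiv (𝓡∂ (n + 1)) 𝓘(ℝ, EuclideanSpace ℝ (Fin (n + 1)))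
        (extChartAt (𝓡∂ (n + 1)) q) q v =
        fderivWithin ℝ τ (range (𝓡∂ (n + 1))) u₀ (chartDifferential e q v) := by
      change mfderiv (𝓡∂ (n + 1)) 𝓘(ℝ, EuclideanSpace ℝ (Fin (n + 1)))
        (e₁.extend (𝓡∂ (n + 1))) q v = _
      rw [heq.mfderiv_eq, hcomp.mfderiv]
      rfl
    have := hface (chartDifferential e q v)
    rw [ContinuousLinearMap.comp_apply, ContinuousLinearMap.comp_apply, ← hc, mul_comm] at this
    exact (congrArg (fun z => headL n z) hB).trans this
  have hnonneg : 0 ≤ c := by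
    have hmin : IsLocalMinOn τ₀ (range (𝓡∂ (n + 1))) u₀ := by
      refine Filter.Eventually.of_forall fun u => ?_
      have h1 : τ₀ u₀ = 0 := by
        change e₁.extend (𝓡∂ (n + 1)) ((e.extend (𝓡∂ (n + 1))).symm u₀) 0 = 0
        rw [hu₀q]
        exact (mem_boundary_iff_head_eq_zero he₁m hqe₁).1 hq
      have h2 := extend_mem_range e₁ ((e.extend (𝓡∂ (n + 1))).symm u)
      rw [range_halfSpace_model] at h2
      rw [h1]
      exact h2
    have hmem : u₀ + pt 1 0 ∈ range (𝓡∂ (n + 1)) := by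
      rw [range_halfSpace_model] at hu₀S ⊢
      change 0 ≤ u₀ 0 + 1
      linarith [show 0 ≤ u₀ 0 from hu₀S]
    exact hmin.hasFDerivWithinAt_nonneg hτ₀d (y := pt 1 0)
      (mem_posTangentConeAt_of_segment_subset
        ((𝓡∂ (n + 1)).convex_range.segment_subset hu₀S hmem))
  have hne : c ≠ 0 := by
    intro h0
    obtain ⟨v, hv⟩ := surjective_mfderiv_extend he₁m hqe₁ (pt 1 0)
    have h1 : normalComponent q v = 1 := congrArg (fun z => headL n z) hv
    rw [hchain v, h0, zero_mul] at h1
    exact zero_ne_one h1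
  exact ⟨c, lt_of_le_of_ne hnonneg hne.symm, hchain⟩

end FrontFace

/-! ### Coordinates near the front face -/

section BlowupCone

variable {n : ℕ}

/-- The cone `r, a, a' ≥ 0`, which agrees with the coordinate domain near the front face. -/
def blowupCone (n : ℕ) : Set (BlowupCoord n) :=
  Ici 0 ×ˢ Ici 0 ×ˢ Ici 0 ×ˢ univ ×ˢ univ

lemma convex_blowupCone : Convex ℝ (blowupCone n) :=
  (convex_Ici 0).prod ((convex_Ici 0).prod ((convex_Ici 0).prod (convex_univ.prod convex_univ)))

lemma uniqueDiffOn_blowupCone : UniqueDiffOn ℝ (blowupCone n) :=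
  (uniqueDiffOn_Ici 0).prod ((uniqueDiffOn_Ici 0).prod ((uniqueDiffOn_Ici 0).prod
    (uniqueDiffOn_univ.prod uniqueDiffOn_univ)))

lemma blowupDomain_subset_blowupCone {X : Type*} [TopologicalSpace X]
    {e : OpenPartialHomeomorph X (EuclideanHalfSpace (n + 1))} : blowupDomain e ⊆ blowupCone n :=
  fun _ hc => ⟨hc.1, hc.2.1, hc.2.2.1, mem_univ _, mem_univ _⟩

lemma blowupDomain_mem_nhdsWithin {X : Type*} [TopologicalSpace X]
    {e : OpenPartialHomeomorph X (EuclideanHalfSpace (n + 1))} {c₀ : BlowupCoord n}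
    (hc₀ : c₀ ∈ blowupDomain e) (hr : c₀.1 = 0) : blowupDomain e ∈ 𝓝[blowupCone n] c₀ := by
  obtain ⟨r₀, a₀, a₀', w₀, y₀⟩ := c₀
  obtain rfl : r₀ = 0 := hr
  obtain ⟨-, -, -, hne, h1, -⟩ := hc₀
  rw [zero_mul] at h1
  have htarget : ∀ᶠ z in 𝓝[range (𝓡∂ (n + 1))] (pt 0 y₀), z ∈ (e.extend (𝓡∂ (n + 1))).target := by
    have := e.extend_target_mem_nhdsWithin (I := 𝓡∂ (n + 1)) (extend_symm_mem_source h1)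
    rwa [(e.extend (𝓡∂ (n + 1))).right_inv h1] at this
  have hne' : ∀ᶠ c : BlowupCoord n in 𝓝[blowupCone n] (0, a₀, a₀', w₀, y₀),
      ¬ (c.2.1 = 0 ∧ c.2.2.1 = 0 ∧ c.2.2.2.1 = 0) := by
    refine nhdsWithin_le_nhds (IsOpen.mem_nhds (isOpen_compl_iff.2 ?_) hne)
    exact (isClosed_eq (by fun_prop) (by fun_prop)).inter
      ((isClosed_eq (by fun_prop) (by fun_prop)).inter (isClosed_eq (by fun_prop) (by fun_prop)))
  have ht1 : Filter.Tendsto (fun c : BlowupCoord n => pt (c.1 * c.2.1) c.2.2.2.2)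
      (𝓝[blowupCone n] (0, a₀, a₀', w₀, y₀)) (𝓝[range (𝓡∂ (n + 1))] (pt 0 y₀)) := by
    refine tendsto_nhdsWithin_iff.2 ⟨?_, Filter.eventually_of_mem self_mem_nhdsWithin ?_⟩
    · have h : Continuous fun c : BlowupCoord n => pt (c.1 * c.2.1) c.2.2.2.2 :=
        (ptL n).continuous.comp
          (f := fun c : BlowupCoord n => (c.1 * c.2.1, c.2.2.2.2)) (by fun_prop)
      have := h.tendsto (0, a₀, a₀', w₀, y₀)
      simp only [zero_mul] at this
      exact this.mono_left nhdsWithin_le_nhds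
    · intro c hc
      rw [range_halfSpace_model]
      exact mul_nonneg (mem_Ici.1 hc.1) (mem_Ici.1 hc.2.1)
  have ht2 : Filter.Tendsto
      (fun c : BlowupCoord n => pt (c.1 * c.2.2.1) (c.2.2.2.2 + c.1 • c.2.2.2.1))
      (𝓝[blowupCone n] (0, a₀, a₀', w₀, y₀)) (𝓝[range (𝓡∂ (n + 1))] (pt 0 y₀)) := by
    refine tendsto_nhdsWithin_iff.2 ⟨?_, Filter.eventually_of_mem self_mem_nhdsWithin ?_⟩
    · have h : Continuous fun c : BlowupCoord n =>
          pt (c.1 * c.2.2.1) (c.2.2.2.2 + c.1 • c.2.2.2.1) :=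
        (ptL n).continuous.comp
          (f := fun c : BlowupCoord n => (c.1 * c.2.2.1, c.2.2.2.2 + c.1 • c.2.2.2.1))
          (by fun_prop)
      have := h.tendsto (0, a₀, a₀', w₀, y₀)
      simp only [zero_mul, zero_smul, add_zero] at this
      exact this.mono_left nhdsWithin_le_nhds
    · intro c hc
      rw [range_halfSpace_model]
      exact mul_nonneg (mem_Ici.1 hc.1) (mem_Ici.1 hc.2.2.1)
  filter_upwards [self_mem_nhdsWithin, hne', ht1.eventually htarget, ht2.eventually htarget]
    with c hc h1 h2 h3
  exact ⟨hc.1, hc.2.1, hc.2.2.1, h1, h2, h3⟩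

/-- The points `(a, a', w)` of the unit sphere with `a, a' ≥ 0`: they parametrize the fibres of the
front face. -/
def blowupSphere (n : ℕ) : Set (ℝ × ℝ × EuclideanSpace ℝ (Fin n)) :=
  {k | 0 ≤ k.1 ∧ 0 ≤ k.2.1 ∧ k.1 ^ 2 + k.2.1 ^ 2 + ‖k.2.2‖ ^ 2 = 1}

lemma isCompact_blowupSphere : IsCompact (blowupSphere n) := by
  refine IsCompact.of_isClosed_subset
    ((isCompact_Icc (a := (0 : ℝ)) (b := 1)).prod ((isCompact_Icc (a := (0 : ℝ)) (b := 1)).prod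
      (isCompact_closedBall (0 : EuclideanSpace ℝ (Fin n)) 1))) ?_ ?_
  · have h1 : IsClosed {k : ℝ × ℝ × EuclideanSpace ℝ (Fin n) | 0 ≤ k.1} :=
      isClosed_le (by fun_prop) (by fun_prop)
    have h2 : IsClosed {k : ℝ × ℝ × EuclideanSpace ℝ (Fin n) | 0 ≤ k.2.1} :=
      isClosed_le (by fun_prop) (by fun_prop)
    have h3 : IsClosed {k : ℝ × ℝ × EuclideanSpace ℝ (Fin n) |
        k.1 ^ 2 + k.2.1 ^ 2 + ‖k.2.2‖ ^ 2 = 1} := isClosed_eq (by fun_prop) (by fun_prop)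
    exact h1.inter (h2.inter h3)
  · rintro ⟨a, a', w⟩ ⟨h1, h2, h3⟩
    simp only at h1 h2 h3
    refine ⟨⟨h1, ?_⟩, ⟨h2, ?_⟩, mem_closedBall_zero_iff.2 ?_⟩ <;>
      nlinarith [sq_nonneg a, sq_nonneg a', sq_nonneg ‖w‖, norm_nonneg w]

end BlowupCone

/-! ### Boundary defining functions near the front face -/

section BlowupCoordinates

variable {n : ℕ} {X : Type*} [TopologicalSpace X] [T2Space X]
  [ChartedSpace (EuclideanHalfSpace (n + 1)) X] [IsManifold (𝓡∂ (n + 1)) ∞ X]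
  {e : OpenPartialHomeomorph X (EuclideanHalfSpace (n + 1))}

lemma mk_mem_leftFace_iff {q : (𝓡∂ (n + 1)).boundary X} (u : InwardPair (n := n) (q : X)) :
    .front q (Quotient.mk (normalSetoid (n := n) (q : X)) u) ∈ leftFace n X ↔
      normalComponent (q : X) u.1.1 = 0 := by
  constructor
  · rintro ⟨u', hu', h0⟩
    obtain ⟨t, -, w, hw, h1, -⟩ := Quotient.exact hu'
    rw [h1, map_add, map_smul, h0, hw, smul_zero, add_zero]
  · exact fun h => ⟨u, rfl, h⟩

lemma mk_mem_rightFace_iff {q : (𝓡∂ (n + 1)).boundary X} (u : InwardPair (n := n) (q : X)) :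
    .front q (Quotient.mk (normalSetoid (n := n) (q : X)) u) ∈ rightFace n X ↔
      normalComponent (q : X) u.1.2 = 0 := by
  constructor
  · rintro ⟨u', hu', h0⟩
    obtain ⟨t, -, w, hw, -, h2⟩ := Quotient.exact hu'
    rw [h2, map_add, map_smul, h0, hw, smul_zero, add_zero]
  · exact fun h => ⟨u, rfl, h⟩

/-- In the coordinates `(r, a, a', w, y)`, the left face is `a = 0`. -/
lemma HasCoord.mem_leftFace_iff (he : e ∈ IsManifold.maximalAtlas (𝓡∂ (n + 1)) ∞ X)
    {c : BlowupCoord n} {ζ : ZeroDoubleSpace n X} (h : HasCoord e c ζ) :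
    ζ ∈ leftFace n X ↔ c.2.1 = 0 := by
  obtain ⟨r, a, a', w, y⟩ := c
  cases ζ with
  | off P =>
    obtain ⟨hr, hP, -, h1, -⟩ := h
    change P.1.1 ∈ (𝓡∂ (n + 1)).boundary X ↔ a = 0
    rw [mem_boundary_iff_head_eq_zero he hP, h1, pt_zero, mul_eq_zero, or_iff_right hr.ne']
  | front q ν =>
    obtain ⟨-, hq, -, u, rfl, h1, -, -⟩ := h
    obtain ⟨c, hc, hN⟩ := exists_normalComponent_eq he hq q.2
    rw [mk_mem_leftFace_iff, hN, mul_eq_zero, or_iff_right hc.ne']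
    exact Eq.congr_left h1

/-- In the coordinates `(r, a, a', w, y)`, the right face is `a' = 0`. -/
lemma HasCoord.mem_rightFace_iff (he : e ∈ IsManifold.maximalAtlas (𝓡∂ (n + 1)) ∞ X)
    {c : BlowupCoord n} {ζ : ZeroDoubleSpace n X} (h : HasCoord e c ζ) :
    ζ ∈ rightFace n X ↔ c.2.2.1 = 0 := by
  obtain ⟨r, a, a', w, y⟩ := c
  cases ζ with
  | off P =>
    obtain ⟨hr, -, hP, -, h1⟩ := h
    change P.1.2 ∈ (𝓡∂ (n + 1)).boundary X ↔ a' = 0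
    rw [mem_boundary_iff_head_eq_zero he hP, h1, pt_zero, mul_eq_zero, or_iff_right hr.ne']
  | front q ν =>
    obtain ⟨-, hq, -, u, rfl, -, h1, -⟩ := h
    obtain ⟨c, hc, hN⟩ := exists_normalComponent_eq he hq q.2
    rw [mk_mem_rightFace_iff, hN, mul_eq_zero, or_iff_right hc.ne']
    exact Eq.congr_left h1

/-- Every point of the coordinate domain is the coordinate tuple of a point of `X²₀`. -/
lemma exists_hasCoord (he : e ∈ IsManifold.maximalAtlas (𝓡∂ (n + 1)) ∞ X) {c : BlowupCoord n}
    (hc : c ∈ blowupDomain e) : ∃ ζ : ZeroDoubleSpace n X, HasCoord e c ζ := by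
  obtain ⟨r, a, a', w, y⟩ := c
  obtain ⟨hr, ha, ha', hne, h1, h2⟩ := hc
  rcases hr.eq_or_lt with rfl | hr
  · rw [zero_mul] at h1
    have hs := extend_symm_mem_source h1
    have hpt := (e.extend (𝓡∂ (n + 1))).right_inv h1
    have hq : (e.extend (𝓡∂ (n + 1))).symm (pt 0 y) ∈ (𝓡∂ (n + 1)).boundary X := by
      rw [mem_boundary_iff_head_eq_zero he hs, hpt, pt_zero]
    obtain ⟨k, hk, hN⟩ := exists_normalComponent_eq he hs hq
    obtain ⟨v, hv⟩ := surjective_mfderiv_extend he hs (pt a 0)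
    obtain ⟨v', hv'⟩ := surjective_mfderiv_extend he hs (pt a' w)
    change chartDifferential e _ v = _ at hv
    change chartDifferential e _ v' = _ at hv'
    have hNv : normalComponent _ v = k * a := by rw [hN, hv, pt_zero]
    have hNv' : normalComponent _ v' = k * a' := by rw [hN, hv', pt_zero]
    refine ⟨.front ⟨_, hq⟩ (Quotient.mk _ ⟨(v, v'), ?_, ?_, ?_⟩), rfl, hs, hpt, _, rfl, ?_, ?_, ?_⟩
    · change 0 ≤ normalComponent _ v
      rw [hNv]; positivity
    · change 0 ≤ normalComponent _ v'
      rw [hNv']; positivity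
    · rintro ⟨h0, h⟩
      change normalComponent _ v = 0 at h0
      change v = v' at h
      subst h
      rw [hv] at hv'
      have hw : (0 : EuclideanSpace ℝ (Fin n)) = w := congrArg tail hv'
      have haa : a = a' := congrArg (fun z => headL n z) hv'
      have ha0 : a = 0 := by
        rw [hNv] at h0
        exact (mul_eq_zero.1 h0).resolve_left hk.ne'
      exact hne ⟨ha0, haa ▸ ha0, hw.symm⟩
    · exact congrArg (fun z => headL n z) hv
    · exact congrArg (fun z => headL n z) hv'
    · change tail (chartDifferential e _ v') - tail (chartDifferential e _ v) = w
      rw [hv, hv', tail_pt, tail_pt, sub_zero]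
  · have hs := extend_symm_mem_source h1
    have hs' := extend_symm_mem_source h2
    have hpt := (e.extend (𝓡∂ (n + 1))).right_inv h1
    have hpt' := (e.extend (𝓡∂ (n + 1))).right_inv h2
    refine ⟨.off ⟨((e.extend (𝓡∂ (n + 1))).symm (pt (r * a) y),
      (e.extend (𝓡∂ (n + 1))).symm (pt (r * a') (y + r • w))), ?_⟩, hr, hs, hs', hpt, hpt'⟩
    rintro ⟨h, hb⟩
    have heq : pt (r * a) y = pt (r * a') (y + r • w) := by
      rw [← hpt, ← hpt']
      exact congrArg (e.extend (𝓡∂ (n + 1))) h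
    have h0 : r * a = 0 := by
      have := (mem_boundary_iff_head_eq_zero he hs).1 hb
      rwa [hpt] at this
    have ha0 : a = 0 := (mul_eq_zero.1 h0).resolve_left hr.ne'
    have haa : r * a = r * a' := congrArg (fun z => headL n z) heq
    have ha0' : a' = 0 := (mul_eq_zero.1 (haa.symm.trans h0)).resolve_left hr.ne'
    have hw : y = y + r • w := congrArg tail heq
    have hw0 : r • w = 0 := by simpa using hw
    exact hne ⟨ha0, ha0', (smul_eq_zero.1 hw0).resolve_left hr.ne'⟩

/-- Near the front face, a boundary defining function of a face given by `ℓ = 0` in the coordinates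
`(r, a, a', w, y)` is comparable with `ℓ`. -/
lemma IsBoundaryDefiningFunction.comparable_front {F : Set (ZeroDoubleSpace n X)}
    {ρ : ZeroDoubleSpace n X → ℝ} (h : IsBoundaryDefiningFunction F ρ)
    (he : e ∈ IsManifold.maximalAtlas (𝓡∂ (n + 1)) ∞ X) {G : BlowupCoord n → ℝ}
    (hG : IsSmoothExpr ρ e G) {ℓ : BlowupCoord n →L[ℝ] ℝ} {v₀ : BlowupCoord n}
    (hF : ∀ c ζ, HasCoord e c ζ → (ζ ∈ F ↔ ℓ c = 0)) (hv₀ : ℓ v₀ = 1)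
    (hℓ : ∀ c ∈ blowupCone n, 0 ≤ ℓ c) (hP : ∀ c ∈ blowupCone n, c - ℓ c • v₀ ∈ blowupCone n)
    {c₀ : BlowupCoord n} (hc₀ : c₀ ∈ blowupDomain e) (hr : c₀.1 = 0) :
    Comparable (𝓝[blowupCone n] c₀) ℓ G := by
  have hD := blowupDomain_mem_nhdsWithin hc₀ hr
  have hmem : c₀ ∈ blowupCone n := blowupDomain_subset_blowupCone hc₀
  have hGs : ContDiffWithinAt ℝ ∞ G (blowupCone n) c₀ :=
    (hG.1 c₀ hc₀).mono_of_mem_nhdsWithin hD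
  have hGF : ∀ c ∈ blowupDomain e, 0 ≤ G c ∧ (G c = 0 ↔ ℓ c = 0) := by
    intro c hc
    obtain ⟨ζ, hζ⟩ := exists_hasCoord he hc
    rw [← hG.2 c hc ζ hζ, h.eq_zero_iff, hF c ζ hζ]
    exact ⟨h.nonneg ζ, Iff.rfl⟩
  rcases (hℓ c₀ hmem).eq_or_lt with h0 | hpos
  · obtain ⟨ζ, hζ⟩ := exists_hasCoord he hc₀
    have hdiff : fderivWithin ℝ G (blowupCone n) c₀ ≠ 0 := by
      have hζF := (hF c₀ ζ hζ).2 h0.symm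
      have heq : fderivWithin ℝ G (blowupDomain e) c₀ = fderivWithin ℝ G (blowupCone n) c₀ :=
        by
        refine fderivWithin_congr_set (nhdsWithin_eq_iff_eventuallyEq.1 ?_)
        exact le_antisymm (nhdsWithin_mono _ blowupDomain_subset_blowupCone)
          (nhdsWithin_le_iff.2 hD)
      rw [← heq]
      cases ζ with
      | off P => exact absurd hr hζ.1.ne'
      | front q ν => exact h.differential_ne_zero _ hζF e he G hG c₀ hc₀ hζ
    refine (comparable_of_fderivWithin_ne_zero convex_blowupCone uniqueDiffOn_blowupCone
      (hGs.of_le (by simp)) h0.symm hv₀ hmem hℓ hP ?_ hdiff).congr_right ?_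
    · filter_upwards [hD] with c hc using (hGF c hc).2.2
    · filter_upwards [hD] with c hc using abs_of_nonneg (hGF c hc).1
  · have hGpos : 0 < G c₀ :=
      lt_of_le_of_ne (hGF c₀ hc₀).1 fun h0 => hpos.ne' ((hGF c₀ hc₀).2.1 h0.symm)
    exact comparable_of_tendsto_pos hpos hGpos ℓ.continuous.continuousWithinAt.tendsto
      hGs.continuousWithinAt.tendsto

/-- The comparison of a boundary defining function with `ℓ` is uniform along the fibre of the front
face over a boundary point, as this fibre is compact. -/
lemma IsBoundaryDefiningFunction.exists_comparable_front {F : Set (ZeroDoubleSpace n X)}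
    {ρ : ZeroDoubleSpace n X → ℝ} (h : IsBoundaryDefiningFunction F ρ)
    (he : e ∈ IsManifold.maximalAtlas (𝓡∂ (n + 1)) ∞ X) {G : BlowupCoord n → ℝ}
    (hG : IsSmoothExpr ρ e G) {ℓ : BlowupCoord n →L[ℝ] ℝ} {v₀ : BlowupCoord n}
    (hF : ∀ c ζ, HasCoord e c ζ → (ζ ∈ F ↔ ℓ c = 0)) (hv₀ : ℓ v₀ = 1)
    (hℓ : ∀ c ∈ blowupCone n, 0 ≤ ℓ c) (hP : ∀ c ∈ blowupCone n, c - ℓ c • v₀ ∈ blowupCone n)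
    {y₀ : EuclideanSpace ℝ (Fin n)} (hy₀ : pt 0 y₀ ∈ (e.extend (𝓡∂ (n + 1))).target) :
    ∃ C > 0, ∀ᶠ x : ℝ × EuclideanSpace ℝ (Fin n) in 𝓝 (0, y₀), ∀ k ∈ blowupSphere n, 0 ≤ x.1 →
      ℓ (x.1, k.1, k.2.1, k.2.2, x.2) ≤ C * G (x.1, k.1, k.2.1, k.2.2, x.2) ∧
        G (x.1, k.1, k.2.1, k.2.2, x.2) ≤ C * ℓ (x.1, k.1, k.2.1, k.2.2, x.2) := by
  have hmono : ∀ {C D u v : ℝ}, 0 < C → C ≤ D → 0 ≤ u → u ≤ C * v ∧ v ≤ C * u →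
      u ≤ D * v ∧ v ≤ D * u := by
    intro C D u v hC hCD hu huv
    have hv : 0 ≤ v := (mul_nonneg_iff_of_pos_left hC).1 (hu.trans huv.1)
    exact ⟨huv.1.trans (by gcongr), huv.2.trans (by gcongr)⟩
  suffices h : ∃ C > 0, ∀ᶠ x : ℝ × EuclideanSpace ℝ (Fin n) in 𝓝 (0, y₀), ∀ k ∈ blowupSphere n,
      ((x.1, k.1, k.2.1, k.2.2, x.2) : BlowupCoord n) ∈ blowupCone n →
      ℓ (x.1, k.1, k.2.1, k.2.2, x.2) ≤ C * G (x.1, k.1, k.2.1, k.2.2, x.2) ∧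
        G (x.1, k.1, k.2.1, k.2.2, x.2) ≤ C * ℓ (x.1, k.1, k.2.1, k.2.2, x.2) by
    obtain ⟨C, hC, hev⟩ := h
    refine ⟨C, hC, hev.mono fun x hx k hk hx0 => hx k hk ?_⟩
    exact ⟨hx0, hk.1, hk.2.1, mem_univ _, mem_univ _⟩
  refine isCompact_blowupSphere.induction_on
    (p := fun T => ∃ C > 0, ∀ᶠ x : ℝ × EuclideanSpace ℝ (Fin n) in 𝓝 (0, y₀), ∀ k ∈ T,
      ((x.1, k.1, k.2.1, k.2.2, x.2) : BlowupCoord n) ∈ blowupCone n →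
      ℓ (x.1, k.1, k.2.1, k.2.2, x.2) ≤ C * G (x.1, k.1, k.2.1, k.2.2, x.2) ∧
        G (x.1, k.1, k.2.1, k.2.2, x.2) ≤ C * ℓ (x.1, k.1, k.2.1, k.2.2, x.2)) ?_ ?_ ?_ ?_
  · exact ⟨1, one_pos, Filter.Eventually.of_forall fun _ _ hk => absurd hk (notMem_empty _)⟩
  · rintro s t hst ⟨C, hC, hev⟩
    exact ⟨C, hC, hev.mono fun x hx k hk => hx k (hst hk)⟩
  · rintro s t ⟨C, hC, hev⟩ ⟨C', hC', hev'⟩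
    refine ⟨C + C', by positivity, ?_⟩
    filter_upwards [hev, hev'] with x hx hx' k hk hxk
    rcases hk with hk | hk
    · exact hmono hC (by linarith) (hℓ _ hxk) (hx k hk hxk)
    · exact hmono hC' (by linarith) (hℓ _ hxk) (hx' k hk hxk)
  · intro k₀ hk₀
    have hc₀ : ((0, k₀.1, k₀.2.1, k₀.2.2, y₀) : BlowupCoord n) ∈ blowupDomain e := by
      refine ⟨le_rfl, hk₀.1, hk₀.2.1, ?_, by rwa [zero_mul],
        by rwa [zero_mul, zero_smul, add_zero]⟩
      rintro ⟨h1, h2, h3⟩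
      have := hk₀.2.2
      rw [h1, h2, h3, norm_zero] at this
      norm_num at this
    obtain ⟨C, hC, hev⟩ := h.comparable_front he hG hF hv₀ hℓ hP hc₀ rfl
    rw [eventually_nhdsWithin_iff] at hev
    have hcont : Continuous fun p : (ℝ × ℝ × EuclideanSpace ℝ (Fin n)) ×
        ℝ × EuclideanSpace ℝ (Fin n) =>
        ((p.2.1, p.1.1, p.1.2.1, p.1.2.2, p.2.2) : BlowupCoord n) := by fun_prop
    have hev' := (hcont.tendsto (k₀, 0, y₀)).eventually hev
    rw [nhds_prod_eq, Filter.eventually_prod_iff] at hev'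
    obtain ⟨P, hPk, Q, hQ, hPQ⟩ := hev'
    exact ⟨{k | P k}, nhdsWithin_le_nhds hPk, C, hC, hQ.mono fun x hx k hk => hPQ hk hx⟩

/-- The distance to the boundary of the diagonal, in terms of the coordinates `u`, `u'` of the two
points: the function `r` of polar coordinates at the front face. -/
noncomputable def frontRadius (u u' : EuclideanSpace ℝ (Fin (n + 1))) : ℝ :=
  Real.sqrt (u 0 ^ 2 + u' 0 ^ 2 + ‖tail u' - tail u‖ ^ 2)

/-- The polar coordinates, with `a² + a'² + |w|² = 1`, of a pair of points with coordinates `u` and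
`u'`. -/
noncomputable def polarCoord (u u' : EuclideanSpace ℝ (Fin (n + 1))) : BlowupCoord n :=
  (frontRadius u u', u 0 / frontRadius u u', u' 0 / frontRadius u u',
    (frontRadius u u')⁻¹ • (tail u' - tail u), tail u)

lemma frontRadius_pos {u u' : EuclideanSpace ℝ (Fin (n + 1))} (h : 0 < u 0) :
    0 < frontRadius u u' := Real.sqrt_pos.2 (by positivity)

lemma frontRadius_sq (u u' : EuclideanSpace ℝ (Fin (n + 1))) :
    frontRadius u u' ^ 2 = u 0 ^ 2 + u' 0 ^ 2 + ‖tail u' - tail u‖ ^ 2 :=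
  Real.sq_sqrt (by positivity)

lemma polarCoord_mem_blowupSphere {u u' : EuclideanSpace ℝ (Fin (n + 1))} (h : 0 < u 0)
    (h' : 0 < u' 0) : ((polarCoord u u').2.1, (polarCoord u u').2.2.1, (polarCoord u u').2.2.2.1) ∈
      blowupSphere n := by
  have hr := frontRadius_pos (u' := u') h
  refine ⟨div_nonneg h.le hr.le, div_nonneg h'.le hr.le, ?_⟩
  change (u 0 / frontRadius u u') ^ 2 + (u' 0 / frontRadius u u') ^ 2 +
    ‖(frontRadius u u')⁻¹ • (tail u' - tail u)‖ ^ 2 = 1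
  rw [norm_smul, Real.norm_of_nonneg (inv_nonneg.2 hr.le), mul_pow, div_pow, div_pow, inv_pow,
    ← div_eq_inv_mul, ← add_div, ← add_div, ← frontRadius_sq, div_self (by positivity)]

lemma hasCoord_polarCoord {z z' : Interior n X}
    (he : e ∈ IsManifold.maximalAtlas (𝓡∂ (n + 1)) ∞ X)
    (hz : (z : X) ∈ e.source) (hz' : (z' : X) ∈ e.source) :
    HasCoord e (polarCoord (coord e z) (coord e z')) (ofInterior z z') := by
  have hr := frontRadius_pos (u' := coord e z') (coord_pos he hz)
  refine ⟨hr, hz, hz', ?_, ?_⟩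
  · rw [mul_div_cancel₀ _ hr.ne']
    exact (pt_tail _).symm
  · rw [mul_div_cancel₀ _ hr.ne', smul_inv_smul₀ hr.ne', add_sub_cancel]
    exact (pt_tail _).symm

lemma polarCoord_mem_blowupDomain {z z' : Interior n X}
    (he : e ∈ IsManifold.maximalAtlas (𝓡∂ (n + 1)) ∞ X)
    (hz : (z : X) ∈ e.source) (hz' : (z' : X) ∈ e.source) :
    polarCoord (coord e z) (coord e z') ∈ blowupDomain e := by
  have hx := coord_pos he hz
  have hx' := coord_pos he hz'
  have hr := frontRadius_pos (u' := coord e z') hx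
  refine ⟨hr.le, (div_pos hx hr).le, (div_pos hx' hr).le, fun h => (div_pos hx hr).ne' h.1, ?_, ?_⟩
  · rw [← (hasCoord_polarCoord he hz hz').2.2.2.1]
    exact extend_mem_target hz
  · rw [← (hasCoord_polarCoord he hz hz').2.2.2.2]
    exact extend_mem_target hz'

/-- Near a boundary point of the diagonal, a boundary defining function of a face given by `ℓ = 0`
is comparable with `ℓ`, evaluated at polar coordinates. -/
lemma IsBoundaryDefiningFunction.exists_comparable_polarCoord {F : Set (ZeroDoubleSpace n X)}
    {ρ : ZeroDoubleSpace n X → ℝ} (h : IsBoundaryDefiningFunction F ρ)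
    (he : e ∈ IsManifold.maximalAtlas (𝓡∂ (n + 1)) ∞ X) {ℓ : BlowupCoord n →L[ℝ] ℝ}
    {v₀ : BlowupCoord n}
    (hF : ∀ c (ζ : ZeroDoubleSpace n X), HasCoord e c ζ → (ζ ∈ F ↔ ℓ c = 0)) (hv₀ : ℓ v₀ = 1)
    (hℓ : ∀ c ∈ blowupCone n, 0 ≤ ℓ c) (hP : ∀ c ∈ blowupCone n, c - ℓ c • v₀ ∈ blowupCone n)
    {q : X} (hqe : q ∈ e.source) (hq : q ∈ (𝓡∂ (n + 1)).boundary X) :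
    ∃ C > 0, ∃ U ∈ 𝓝 q, ∀ z z' : Interior n X, (z : X) ∈ U → (z' : X) ∈ U →
      ℓ (polarCoord (coord e z) (coord e z')) ≤ C * ρ (ofInterior z z') ∧
        ρ (ofInterior z z') ≤ C * ℓ (polarCoord (coord e z) (coord e z')) := by
  obtain ⟨G, hG⟩ := h.smooth.2 e he
  set u₀ := e.extend (𝓡∂ (n + 1)) q with hu₀
  have hq0 : u₀ 0 = 0 := (mem_boundary_iff_head_eq_zero he hqe).1 hq
  have hy₀ : pt 0 (tail u₀) ∈ (e.extend (𝓡∂ (n + 1))).target := by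
    rw [← hq0, pt_tail]
    exact extend_mem_target hqe
  obtain ⟨C, hC, hev⟩ := h.exists_comparable_front he hG hF hv₀ hℓ hP hy₀
  have hcont : Continuous fun p : EuclideanSpace ℝ (Fin (n + 1)) × EuclideanSpace ℝ (Fin (n + 1)) =>
      (frontRadius p.1 p.2, tail p.1) := by
    refine Continuous.prodMk (Real.continuous_sqrt.comp ?_)
      ((tailL n).continuous.comp continuous_fst)
    have h1 : Continuous fun p : EuclideanSpace ℝ (Fin (n + 1)) ×
        EuclideanSpace ℝ (Fin (n + 1)) => tail p.1 := (tailL n).continuous.comp continuous_fst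
    have h2 : Continuous fun p : EuclideanSpace ℝ (Fin (n + 1)) ×
        EuclideanSpace ℝ (Fin (n + 1)) => tail p.2 := (tailL n).continuous.comp continuous_snd
    fun_prop
  have hr0 : frontRadius u₀ u₀ = 0 := by
    rw [frontRadius, hq0, sub_self, norm_zero]
    norm_num
  have hev' := (hcont.tendsto (u₀, u₀)).eventually (by
    rw [hr0]
    exact hev)
  have hec := e.continuousAt_extend (I := 𝓡∂ (n + 1)) hqe
  have hev'' := (hec.prodMap' hec).tendsto.eventually hev'
  rw [nhds_prod_eq, Filter.eventually_prod_iff] at hev''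
  obtain ⟨P, hPq, Q, hQ, hPQ⟩ := hev''
  refine ⟨C, hC, {p | P p} ∩ {p | Q p} ∩ e.source,
    Filter.inter_mem (Filter.inter_mem hPq hQ) (e.open_source.mem_nhds hqe), ?_⟩
  rintro z z' ⟨⟨hz, -⟩, hze⟩ ⟨⟨-, hz'⟩, hze'⟩
  have hx := coord_pos he hze
  have hx' := coord_pos he hze'
  have := hPQ hz hz' _ (polarCoord_mem_blowupSphere hx hx') (frontRadius_pos hx).le
  rw [hG.2 _ (polarCoord_mem_blowupDomain he hze hze') _ (hasCoord_polarCoord he hze hze')]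
  exact this

lemma IsBoundaryDefiningFunction.exists_comparable_polarCoord_left {ρ : ZeroDoubleSpace n X → ℝ}
    (h : IsBoundaryDefiningFunction (leftFace n X) ρ)
    (he : e ∈ IsManifold.maximalAtlas (𝓡∂ (n + 1)) ∞ X)
    {q : X} (hqe : q ∈ e.source) (hq : q ∈ (𝓡∂ (n + 1)).boundary X) :
    ∃ C > 0, ∃ U ∈ 𝓝 q, ∀ z z' : Interior n X, (z : X) ∈ U → (z' : X) ∈ U →
      coord e z 0 / frontRadius (coord e z) (coord e z') ≤ C * ρ (ofInterior z z') ∧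
        ρ (ofInterior z z') ≤ C * (coord e z 0 / frontRadius (coord e z) (coord e z')) := by
  refine h.exists_comparable_polarCoord he
    (ℓ := (ContinuousLinearMap.fst ℝ _ _).comp (ContinuousLinearMap.snd ℝ _ _))
    (v₀ := (0, 1, 0, 0, 0)) (fun c ζ hc => hc.mem_leftFace_iff he) rfl (fun c hc => hc.2.1) ?_
    hqe hq
  rintro ⟨r, a, a', w, y⟩ ⟨hr, ha, ha', -, -⟩
  refine ⟨?_, ?_, ?_, mem_univ _, mem_univ _⟩
  · change 0 ≤ r - a * 0
    simpa using hr
  · change 0 ≤ a - a * 1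
    simp
  · change 0 ≤ a' - a * 0
    simpa using ha'

lemma IsBoundaryDefiningFunction.exists_comparable_polarCoord_right {ρ : ZeroDoubleSpace n X → ℝ}
    (h : IsBoundaryDefiningFunction (rightFace n X) ρ)
    (he : e ∈ IsManifold.maximalAtlas (𝓡∂ (n + 1)) ∞ X)
    {q : X} (hqe : q ∈ e.source) (hq : q ∈ (𝓡∂ (n + 1)).boundary X) :
    ∃ C > 0, ∃ U ∈ 𝓝 q, ∀ z z' : Interior n X, (z : X) ∈ U → (z' : X) ∈ U →
      coord e z' 0 / frontRadius (coord e z) (coord e z') ≤ C * ρ (ofInterior z z') ∧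
        ρ (ofInterior z z') ≤ C * (coord e z' 0 / frontRadius (coord e z) (coord e z')) := by
  refine h.exists_comparable_polarCoord he
    (ℓ := (ContinuousLinearMap.fst ℝ _ _).comp
      ((ContinuousLinearMap.snd ℝ _ _).comp (ContinuousLinearMap.snd ℝ _ _)))
    (v₀ := (0, 0, 1, 0, 0)) (fun c ζ hc => hc.mem_rightFace_iff he) rfl (fun c hc => hc.2.2.1) ?_
    hqe hq
  rintro ⟨r, a, a', w, y⟩ ⟨hr, ha, ha', -, -⟩
  refine ⟨?_, ?_, ?_, mem_univ _, mem_univ _⟩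
  · change 0 ≤ r - a' * 0
    simpa using hr
  · change 0 ≤ a - a' * 0
    simpa using ha
  · change 0 ≤ a' - a' * 1
    simp

end BlowupCoordinates

/-! ### The distance in terms of boundary defining functions -/

section DistanceEstimate

variable {n : ℕ} {X : Type*} [TopologicalSpace X] [T2Space X]
  [ChartedSpace (EuclideanHalfSpace (n + 1)) X] [IsManifold (𝓡∂ (n + 1)) ∞ X]
  {g : InteriorMetric n X} {ρL ρR : ZeroDoubleSpace n X → ℝ}

lemma abs_log_sub_log_le {C u v : ℝ} (hu : 0 < u) (hv : 0 < v) (h : u ≤ C * v ∧ v ≤ C * u) :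
    |Real.log u - Real.log v| ≤ Real.log C := by
  have hC : 0 < C := (mul_pos_iff_of_pos_right hv).1 (hu.trans_le h.1)
  have h1 := Real.log_le_log hu h.1
  have h2 := Real.log_le_log hv h.2
  rw [Real.log_mul hC.ne' hv.ne'] at h1
  rw [Real.log_mul hC.ne' hu.ne'] at h2
  rw [abs_le]
  constructor <;> linarith

lemma ofInterior_notMem_leftFace (z z' : Interior n X) : ofInterior z z' ∉ leftFace n X :=
  fun h => Set.disjoint_left.1 (𝓡∂ (n + 1)).disjoint_interior_boundary z.2 h

lemma ofInterior_notMem_rightFace (z z' : Interior n X) : ofInterior z z' ∉ rightFace n X :=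
  fun h => Set.disjoint_left.1 (𝓡∂ (n + 1)).disjoint_interior_boundary z'.2 h

lemma ofInterior_injective {z z' w w' : Interior n X} (h : ofInterior z z' = ofInterior w w') :
    z = w ∧ z' = w' := by
  have h1 := congrArg Subtype.val (ZeroDoubleSpace.off.inj h)
  exact ⟨Subtype.ext (congrArg Prod.fst h1), Subtype.ext (congrArg Prod.snd h1)⟩

/-- The difference of the two sides of the asymptotic formula for the distance. -/
noncomputable def distanceError (g : InteriorMetric n X) (ρL ρR : ZeroDoubleSpace n X → ℝ)
    (z z' : Interior n X) : ℝ :=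
  (riemannianDist g z z').toReal +
    Real.log (ρL (ofInterior z z') * ρR (ofInterior z z'))

lemma distanceError_eq (hL : IsBoundaryDefiningFunction (leftFace n X) ρL)
    (hR : IsBoundaryDefiningFunction (rightFace n X) ρR) (z z' : Interior n X) :
    distanceError g ρL ρR z z' = (riemannianDist g z z').toReal +
      Real.log (ρL (ofInterior z z')) + Real.log (ρR (ofInterior z z')) := by
  rw [distanceError, Real.log_mul (hL.pos (ofInterior_notMem_leftFace z z')).ne'
    (hR.pos (ofInterior_notMem_rightFace z z')).ne', add_assoc]

variable [ConnectedSpace X]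

/-- Near the boundary of the diagonal, the distance is `log (r² / (x x'))` up to a bounded error,
while `ρL` and `ρR` are comparable with `x / r` and `x' / r`. -/
lemma exists_distanceError_le_of_mem_boundary (hg : IsAsymptoticallyHyperbolic g)
    (hL : IsBoundaryDefiningFunction (leftFace n X) ρL)
    (hR : IsBoundaryDefiningFunction (rightFace n X) ρR) {q : X}
    (hq : q ∈ (𝓡∂ (n + 1)).boundary X) :
    ∃ C : ℝ, ∃ U ∈ 𝓝 q, ∀ z z' : Interior n X, (z : X) ∈ U → (z' : X) ∈ U →
      |distanceError g ρL ρR z z'| ≤ C := by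
  obtain ⟨e, κ, δ, h⟩ := exists_isCollarChart hg hq
  obtain ⟨C, hlow⟩ := h.exists_le_dist
  obtain ⟨CL, -, UL, hUL, hcL⟩ :=
    hL.exists_comparable_polarCoord_left h.mem_maximalAtlas h.mem_source hq
  obtain ⟨CR, -, UR, hUR, hcR⟩ :=
    hR.exists_comparable_polarCoord_right h.mem_maximalAtlas h.mem_source hq
  refine ⟨|C| + 2 / κ + Real.log CL + Real.log CR,
    cylinder e (tail (e.extend (𝓡∂ (n + 1)) q)) (δ / 2) ∩ UL ∩ UR,
    Filter.inter_mem (Filter.inter_mem (cylinder_mem_nhds h.mem_source (half_pos h.δ_pos)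
      h.head_eq_zero) hUL) hUR, ?_⟩
  rintro z z' ⟨⟨hz, hzL⟩, hzR⟩ ⟨⟨hz', hzL'⟩, hzR'⟩
  have hx := coord_pos h.mem_maximalAtlas hz.1
  have hx' := coord_pos h.mem_maximalAtlas hz'.1
  have hr := frontRadius_pos (u' := coord e z') hx
  have hlow := hlow z z' hz hz'
  have hup := h.dist_le_log hz hz'
  have hκ : 0 < 2 / κ := div_pos two_pos h.κ_pos
  rw [← frontRadius_sq] at hlow hup
  rw [ENNReal.ofReal_le_iff_le_toReal (riemannianDist_ne_top hg z z')] at hlow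
  have hnonneg : 0 ≤ Real.log (frontRadius (coord e z) (coord e z') ^ 2) -
      Real.log (coord e z 0) - Real.log (coord e z' 0) := by
    have : Real.log (coord e z 0 * coord e z' 0) ≤
        Real.log (frontRadius (coord e z) (coord e z') ^ 2) := by
      refine Real.log_le_log (mul_pos hx hx') ?_
      rw [frontRadius_sq]
      nlinarith [sq_nonneg (coord e z 0 - coord e z' 0), mul_pos hx hx',
        sq_nonneg ‖tail (coord e z') - tail (coord e z)‖]
    rw [Real.log_mul hx.ne' hx'.ne'] at this
    linarith
  have hup' := ENNReal.toReal_le_of_le_ofReal (by linarith) hup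
  have h1 := abs_log_sub_log_le (div_pos hx hr) (hL.pos (ofInterior_notMem_leftFace z z'))
    (hcL z z' hzL hzL')
  have h2 := abs_log_sub_log_le (div_pos hx' hr) (hR.pos (ofInterior_notMem_rightFace z z'))
    (hcR z z' hzR hzR')
  rw [Real.log_div hx.ne' hr.ne', abs_le] at h1
  rw [Real.log_div hx'.ne' hr.ne', abs_le] at h2
  rw [Real.log_pow] at hlow hup'
  push_cast at hlow hup'
  rw [distanceError_eq hL hR, abs_le]
  have := le_abs_self C
  have := neg_abs_le C
  constructor <;> linarith

/-- Away from the boundary of the diagonal, both the distance and `-log ρL - log ρR` split as sums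
of contributions of the two points. -/
lemma exists_distanceError_le_of_ne (hg : IsAsymptoticallyHyperbolic g)
    (hL : IsBoundaryDefiningFunction (leftFace n X) ρL)
    (hR : IsBoundaryDefiningFunction (rightFace n X) ρR) {p p' : X}
    (hne : ¬ (p = p' ∧ p ∈ (𝓡∂ (n + 1)).boundary X)) :
    ∃ C : ℝ, ∃ W ∈ 𝓝 (p, p'), ∀ z z' : Interior n X, ((z : X), (z' : X)) ∈ W →
      |distanceError g ρL ρR z z'| ≤ C := by
  obtain ⟨σ, σ', hσ, hσ', C, U, hU, U', hU', hest⟩ := exists_dist_estimate hg hne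
  have hP₀ : (p, p') ∈ OffDiag n X := hne
  obtain ⟨CL, -, hcL⟩ := hL.comparable_left (P₀ := ⟨(p, p'), hP₀⟩) hσ
  obtain ⟨CR, -, hcR⟩ := hR.comparable_right (P₀ := ⟨(p, p'), hP₀⟩) hσ'
  obtain ⟨V, hV, hpos⟩ := hσ.eventually_pos
  obtain ⟨V', hV', hpos'⟩ := hσ'.eventually_pos
  obtain ⟨W, hW, hWc⟩ := mem_nhds_subtype _ _ _ |>.1 (hcL.and hcR)
  refine ⟨C + Real.log CL + Real.log CR, (U ∩ V) ×ˢ (U' ∩ V') ∩ W, Filter.inter_mem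
    (prod_mem_nhds (Filter.inter_mem hU hV) (Filter.inter_mem hU' hV')) hW, ?_⟩
  rintro z z' ⟨⟨⟨hzU, hzV⟩, hzU', hzV'⟩, hzW⟩
  have hzz' : ((z : X), (z' : X)) ∈ OffDiag n X := fun h =>
    Set.disjoint_left.1 (𝓡∂ (n + 1)).disjoint_interior_boundary z.2 h.2
  obtain ⟨h1, h2⟩ := hWc (show (⟨_, hzz'⟩ : OffDiag n X) ∈ _ from hzW)
  have h1' := abs_log_sub_log_le (hpos z hzV) (hL.pos (ofInterior_notMem_leftFace z z')) h1
  have h2' := abs_log_sub_log_le (hpos' z' hzV') (hR.pos (ofInterior_notMem_rightFace z z')) h2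
  have h3 := hest z z' hzU hzU'
  rw [distanceError_eq hL hR]
  rw [abs_le] at h1' h2' h3 ⊢
  constructor <;> linarith

lemma exists_distanceError_le [CompactSpace X] (hg : IsAsymptoticallyHyperbolic g)
    (hL : IsBoundaryDefiningFunction (leftFace n X) ρL)
    (hR : IsBoundaryDefiningFunction (rightFace n X) ρR) :
    ∃ C : ℝ, ∀ z z' : Interior n X, |distanceError g ρL ρR z z'| ≤ C := by
  have hloc : ∀ P : X × X, ∃ C : ℝ, ∃ W ∈ 𝓝 P, ∀ z z' : Interior n X, ((z : X), (z' : X)) ∈ W →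
      |distanceError g ρL ρR z z'| ≤ C := by
    rintro ⟨p, p'⟩
    by_cases hP : p = p' ∧ p ∈ (𝓡∂ (n + 1)).boundary X
    · obtain ⟨rfl, hp⟩ := hP
      obtain ⟨C, U, hU, h⟩ := exists_distanceError_le_of_mem_boundary hg hL hR hp
      exact ⟨C, U ×ˢ U, prod_mem_nhds hU hU, fun z z' hz => h z z' hz.1 hz.2⟩
    · exact exists_distanceError_le_of_ne hg hL hR hP
  have := isCompact_univ.induction_on (X := X × X)
    (p := fun T => ∃ C : ℝ, ∀ z z' : Interior n X, ((z : X), (z' : X)) ∈ T →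
      |distanceError g ρL ρR z z'| ≤ C) ⟨0, fun _ _ h => absurd h (notMem_empty _)⟩
    (fun s t hst ⟨C, h⟩ => ⟨C, fun z z' hz => h z z' (hst hz)⟩)
    (fun s t ⟨C, h⟩ ⟨C', h'⟩ => ⟨max C C', fun z z' hz => hz.elim
      (fun hz => (h z z' hz).trans (le_max_left _ _))
      (fun hz => (h' z z' hz).trans (le_max_right _ _))⟩)
    (fun P _ => by
      obtain ⟨C, W, hW, h⟩ := hloc P
      exact ⟨W, nhdsWithin_le_nhds hW, C, h⟩)
  obtain ⟨C, h⟩ := this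
  exact ⟨C, fun z z' => h z z' (mem_univ _)⟩

end DistanceEstimate

end AsymptoticallyHyperbolic

open AsymptoticallyHyperbolic
theorem proposition3p3 (n : ℕ) (X : Type*) [TopologicalSpace X] [T2Space X] [CompactSpace X]
    [ConnectedSpace X] [ChartedSpace (EuclideanHalfSpace (n + 1)) X]
    [IsManifold (𝓡∂ (n + 1)) ∞ X]
    (g : InteriorMetric n X) (hg : IsAsymptoticallyHyperbolic g)
    (ρL ρR : ZeroDoubleSpace n X → ℝ)
    (hL : IsBoundaryDefiningFunction (leftFace n X) ρL)
    (hR : IsBoundaryDefiningFunction (rightFace n X) ρR) :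
    ∃ b : ZeroDoubleSpace n X → ℝ, (∃ C : ℝ, ∀ ζ, |b ζ| ≤ C) ∧
      ∀ z z' : Interior n X, riemannianDist g z z' ≠ ⊤ ∧
        (riemannianDist g z z').toReal =
          -Real.log (ρL (ofInterior z z') * ρR (ofInterior z z')) + b (ofInterior z z') := by
  classical
  obtain ⟨C, hC⟩ := exists_distanceError_le hg hL hR
  -- the value of `b` on the boundary of `X²₀` is irrelevant
  refine ⟨fun ζ => if h : ∃ w : Interior n X × Interior n X, ofInterior w.1 w.2 = ζ then
    distanceError g ρL ρR h.choose.1 h.choose.2 else 0, ⟨|C|, fun ζ => ?_⟩, fun z z' => ?_⟩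
  · dsimp only
    split_ifs with h
    · exact (hC _ _).trans (le_abs_self C)
    · rw [abs_zero]
      exact abs_nonneg C
  · refine ⟨riemannianDist_ne_top hg z z', ?_⟩
    have h : ∃ w : Interior n X × Interior n X, ofInterior w.1 w.2 = ofInterior z z' :=
      ⟨(z, z'), rfl⟩
    obtain ⟨h1, h2⟩ := ofInterior_injective h.choose_spec
    beta_reduce
    rw [dif_pos h, h1, h2, distanceError]
    ring
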